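/- Let $k$ be an algebraically closed field of characteristic zero and $A$ a complete noetherian local $k$-algebra with maximal ideal $\mathfrak m_A$ and residue field $k$. **Definitions.** A matrix factorization (MF) of an element $w$ of a commutative ring $S$ is a diagram $M_0\xrightarrow{\varphi}M_1\xrightarrow{\psi}M_0$ of finite free $S$-modules with $\varphi\psi=\psi\varphi=w$; equivalently, a $\mathbb Z/2$-graded finite free module with an odd operator of square $w$. It has rank $r$ if $M_0=M_1=S^r$. A morphism is a pair $(\sigma,\tau)$, $\sigma:M_0\to M_0'$, $\tau:M_1\to M_1'$, with $\varphi'\sigma=\tau\varphi$, $\psi'\tau=\sigma\psi$; it is homotopic to zero if $\sigma=\psi'h_0+h_1\varphi$ and $\tau=\varphi'h_1+h_0\psi$ for some $h_0:M_0\to M_1'$, $h_1:M_1\to M_0'$. ${\rm MF}_S(w)$ is the category of MFs of $w$ and homotopy classes of morphisms. The tensor product $M\otimes M'$ is the graded tensor product, an MF of $w+w'$. A quadratic ($\epsilon=1$) or symplectic ($\epsilon=-1$) form on $M$ is an isomorphism $b=(b_0,b_1)$ from $M$ to $M^*:\ M_1^*\xrightarrow{-{}^t\varphi}M_0^*\xrightarrow{-{}^t\psi}M_1^*$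 with ${}^tb_0=-\epsilon b_1$. A twisted quadratic ($\epsilon=1$) or twisted symplectic ($\epsilon=-1$) form on $M$ is an isomorphism $q=(q_0,q_1)$ from $M$ to $M^T:\ M_0^*\xrightarrow{{}^t\psi}M_1^*\xrightarrow{{}^t\varphi}M_0^*$ with ${}^tq_i=\epsilon q_i$. An isomorphism $F$ carries a form $b$ to $b'$ if ${}^tFb'F=b$ (similarly for twisted forms). For an MF $(P,Q)$ of $\pi\in\mathfrak m_A$ over $A$, put $\theta(P,Q)=(Q,-P)\otimes(x,y)$, where $(x,y)$ is the rank one MF of $xy$; it is an MF of $xy-\pi$ over $A[[x,y]]$, and $\theta$ is a functor. Let $(x,y)$ carry its quadratic form $b_0=1$, $b_1=-1$. By tensor product with it, a twisted form of sign $\epsilon$ on $(P,Q)$ induces a form of sign $\epsilon$ on $\theta(P,Q)$, and a form of sign $\epsilon$ on $(P,Q)$ induces a twisted form of sign $-\epsilon$ on $\theta(P,Q)$. Let $\overline{\mathbf M}_r$ be the MF of $xy$ over $k[[x,y]]$ given by $\overline\varphi={\rm diag}(x1_r,y1_r)$, $\overline\psi={\rm diag}(y1_r,x1_r)$. A deformation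 of $\overline{\mathbf M}_r$ to $A$ is an MF $M$ over $A[[x,y]]$, of some potential $\omega\in A[[x,y]]$ reducing to $xy$, whose reduction to $k[[x,y]]$ is $\overline{\mathbf M}_r$. A deformation of $\overline{\mathbf M}_r$ with a (twisted) form is such an $M$ with a (twisted) form of the same type and sign which reduces to the given one. An infinitesimal change of variables is an $A$-automorphism of $A[[x,y]]$ that reduces to the identity of $k[[x,y]]$. **Theorem.** (i) For every $r$: (a) For every deformation $M$ of $\overline{\mathbf M}_r$ to $A$, of potential $\omega$, there are $\pi\in\mathfrak m_A$, an MF $(P,Q)$ of $\pi$ of rank $r$ over $A$ with entries in $\mathfrak m_A$, an infinitesimal change of variables $g$ with $g(\omega)=xy-\pi$, and an isomorphism $g(M)\simeq\theta(P,Q)$ whose reduction to $k[[x,y]]$ is the standard identification $\overline{\mathbf M}_r\simeq\theta(0,0)$ (change of sign of the last $r$ basis vectors of $M_0$). (b) Let $\overline b$ be a form of sign $\epsilon$ (quadratic or symplectic) on $\overline{\mathbf M}_r$. There are a twisted form $\overline q$ of sign $\epsilon$ on the rank $r$ MF $(0,0)$ of $0$ over $k$ and an isomorphism $\overline F:\overline{\mathbf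 M}_r\simeq\theta(0,0)$ carrying $\overline b$ to the form induced by $\overline q$. For any such $\overline q$ and $\overline F$, and every deformation $(M,b)$ of $(\overline{\mathbf M}_r,\overline b)$ to $A$, there are $\pi,(P,Q),g$ as in (a) such that the constant form $\overline q\otimes1$ is a twisted form on $(P,Q)$, and an isomorphism $g(M)\simeq\theta(P,Q)$ lifting $\overline F$ and carrying $g(b)$ to the form on $\theta(P,Q)$ induced by $\overline q\otimes 1$. (c) The same holds with forms and twisted forms exchanged: a twisted form of sign $-\epsilon$ on $\overline{\mathbf M}_r$ and its deformations correspond to forms of sign $\epsilon$ on $(0,0)$ and on $(P,Q)$. (ii) For every $\pi\in\mathfrak m_A$, the Faltings–Knörrer functor $\theta:{\rm MF}_A(\pi)\to{\rm MF}_{A[[x,y]]}(xy-\pi)$ is an equivalence of categories. -/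

import Mathlib

open CategoryTheory Matrix
open scoped Kronecker

/-- A rectangular matrix is invertible if it has a two-sided inverse. -/
def Matrix.IsInvertible {S : Type*} [CommRing S] {m n : Type*} [Fintype m] [Fintype n]
    [DecidableEq m] [DecidableEq n] (b : Matrix m n S) : Prop :=
  ∃ c : Matrix n m S, b * c = 1 ∧ c * b = 1

section Basic

universe u

/-- A matrix factorization of `w` over `S`: a diagram `M₀ --φ--> M₁ --ψ--> M₀` of free modules with
finite bases `I` (of `M₀`) and `J` (of `M₁`), such that `φψ = w` and `ψφ = w`. Equivalently, a
`ℤ/2`-graded finite free module with an odd operator of square `w`. -/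
structure MatFac (S : Type u) [CommRing S] (I J : Type) [Fintype I] [Fintype J]
    [DecidableEq I] [DecidableEq J] (w : S) where
  φ : Matrix J I S
  ψ : Matrix I J S
  φ_mul_ψ : φ * ψ = w • (1 : Matrix J J S)
  ψ_mul_φ : ψ * φ = w • (1 : Matrix I I S)

namespace MatFac

variable {S : Type u} [CommRing S]
variable {I J : Type} [Fintype I] [Fintype J] [DecidableEq I] [DecidableEq J]
variable {I' J' : Type} [Fintype I'] [Fintype J'] [DecidableEq I'] [DecidableEq J']
variable {I'' J'' : Type} [Fintype I''] [Fintype J''] [DecidableEq I''] [DecidableEq J'']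
variable {w w' w'' : S}

/-! ### Morphisms and homotopies -/

/-- A closed morphism of degree zero `(σ, τ) : M → M'`, with `σ : M₀ → M₀'` and `τ : M₁ → M₁'`,
that is, a morphism of diagrams. -/
@[ext]
structure Hom (M : MatFac S I J w) (M' : MatFac S I' J' w') where
  σ : Matrix I' I S
  τ : Matrix J' J S
  comm_φ : M'.φ * σ = τ * M.φ
  comm_ψ : M'.ψ * τ = σ * M.ψ

/-- `f` is an isomorphism if both of its components are invertible. -/
def Hom.IsIso {M : MatFac S I J w} {M' : MatFac S I' J' w'} (f : Hom M M') : Prop :=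
  f.σ.IsInvertible ∧ f.τ.IsInvertible

/-- The identity morphism. -/
def Hom.id (M : MatFac S I J w) : Hom M M :=
  ⟨1, 1, by simp, by simp⟩

/-- Composition of morphisms, in diagrammatic order. -/
def Hom.comp {M : MatFac S I J w} {M' : MatFac S I' J' w'} {M'' : MatFac S I'' J'' w''}
    (f : Hom M M') (g : Hom M' M'') : Hom M M'' where
  σ := g.σ * f.σ
  τ := g.τ * f.τ
  comm_φ := by rw [← Matrix.mul_assoc, g.comm_φ, Matrix.mul_assoc, f.comm_φ, Matrix.mul_assoc]
  comm_ψ := by rw [← Matrix.mul_assoc, g.comm_ψ, Matrix.mul_assoc, f.comm_ψ, Matrix.mul_assoc]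

/-- `f` and `g` are homotopic if `f - g = D(h) = Q'h + hQ` for an odd map `h = (h₀, h₁)`, with
`h₀ : M₀ → M₁'` and `h₁ : M₁ → M₀'`. -/
def Hom.Homotopic {M : MatFac S I J w} {M' : MatFac S I' J' w'} (f g : Hom M M') : Prop :=
  ∃ (h₀ : Matrix J' I S) (h₁ : Matrix I' J S),
    f.σ - g.σ = M'.ψ * h₀ + h₁ * M.φ ∧ f.τ - g.τ = M'.φ * h₁ + h₀ * M.ψ

/-! ### Operations on matrix factorizations -/

/-- The same matrix factorization, for an equal potential. -/
def copy (M : MatFac S I J w) (h : w = w') : MatFac S I J w' :=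
  ⟨M.φ, M.ψ, h ▸ M.φ_mul_ψ, h ▸ M.ψ_mul_φ⟩

/-- Base change along a ring homomorphism. -/
def map {T : Type*} [CommRing T] (f : S →+* T) (M : MatFac S I J w) : MatFac T I J (f w) where
  φ := M.φ.map f
  ψ := M.ψ.map f
  φ_mul_ψ := by
    rw [← Matrix.map_mul, M.φ_mul_ψ]; ext i j
    by_cases h : i = j <;> simp [h]
  ψ_mul_φ := by
    rw [← Matrix.map_mul, M.ψ_mul_φ]; ext i j
    by_cases h : i = j <;> simp [h]

/-- Renaming of the bases. -/
def reindex (e : I ≃ I') (f : J ≃ J') (M : MatFac S I J w) : MatFac S I' J' w where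
  φ := M.φ.submatrix f.symm e.symm
  ψ := M.ψ.submatrix e.symm f.symm
  φ_mul_ψ := by
    rw [Matrix.submatrix_mul_equiv, M.φ_mul_ψ]; ext i j; simp [Matrix.one_apply]
  ψ_mul_φ := by
    rw [Matrix.submatrix_mul_equiv, M.ψ_mul_φ]; ext i j; simp [Matrix.one_apply]

/-- The passage from a matrix factorization `(P, Q)` of `w` to the matrix factorization `(Q, -P)`
of `-w`. -/
def twist (M : MatFac S I J w) : MatFac S J I (-w) where
  φ := M.ψ
  ψ := -M.φ
  φ_mul_ψ := by rw [Matrix.mul_neg, M.ψ_mul_φ, neg_smul]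
  ψ_mul_φ := by rw [Matrix.neg_mul, M.φ_mul_ψ, neg_smul]

/-- The graded tensor product `M ⊗ M'`. The even part is `M₀ ⊗ M₀' ⊕ M₁ ⊗ M₁'`, the odd part is
`M₀ ⊗ M₁' ⊕ M₁ ⊗ M₀'`. -/
def tensor (M : MatFac S I J w) (M' : MatFac S I' J' w') :
    MatFac S ((I × I') ⊕ (J × J')) ((I × J') ⊕ (J × I')) (w + w') where
  φ := fromBlocks ((1 : Matrix I I S) ⊗ₖ M'.φ) (M.ψ ⊗ₖ (1 : Matrix J' J' S))
    (M.φ ⊗ₖ (1 : Matrix I' I' S)) (-((1 : Matrix J J S) ⊗ₖ M'.ψ))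
  ψ := fromBlocks ((1 : Matrix I I S) ⊗ₖ M'.ψ) (M.ψ ⊗ₖ (1 : Matrix I' I' S))
    (M.φ ⊗ₖ (1 : Matrix J' J' S)) (-((1 : Matrix J J S) ⊗ₖ M'.φ))
  φ_mul_ψ := by
    rw [fromBlocks_multiply, ← fromBlocks_one, fromBlocks_smul]
    simp only [Matrix.mul_neg, Matrix.neg_mul, ← mul_kronecker_mul, Matrix.one_mul, Matrix.mul_one,
      φ_mul_ψ, ψ_mul_φ, smul_kronecker, kronecker_smul, one_kronecker_one, neg_neg, smul_zero,
      add_neg_cancel, add_smul]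
    congr 1
    exact add_comm _ _
  ψ_mul_φ := by
    rw [fromBlocks_multiply, ← fromBlocks_one, fromBlocks_smul]
    simp only [Matrix.mul_neg, Matrix.neg_mul, ← mul_kronecker_mul, Matrix.one_mul, Matrix.mul_one,
      φ_mul_ψ, ψ_mul_φ, smul_kronecker, kronecker_smul, one_kronecker_one, neg_neg, smul_zero,
      add_neg_cancel, add_smul]
    congr 1
    exact add_comm _ _

/-! ### The corresponding operations on morphisms -/

/-- The same morphism, for equal potentials. -/
def Hom.copy {u u' : S} {M : MatFac S I J w} {M' : MatFac S I' J' w'} (f : Hom M M')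
    (h : w = u) (h' : w' = u') : Hom (M.copy h) (M'.copy h') :=
  ⟨f.σ, f.τ, f.comm_φ, f.comm_ψ⟩

/-- Base change of morphisms. -/
def Hom.map {T : Type*} [CommRing T] (F : S →+* T) {M : MatFac S I J w} {M' : MatFac S I' J' w'}
    (f : Hom M M') : Hom (M.map F) (M'.map F) where
  σ := f.σ.map F
  τ := f.τ.map F
  comm_φ := by
    change M'.φ.map F * f.σ.map F = f.τ.map F * M.φ.map F
    rw [← Matrix.map_mul, f.comm_φ, Matrix.map_mul]
  comm_ψ := by
    change M'.ψ.map F * f.τ.map F = f.σ.map F * M.ψ.map F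
    rw [← Matrix.map_mul, f.comm_ψ, Matrix.map_mul]

/-- Renaming of the bases, on morphisms. -/
def Hom.reindex {K L K' L' : Type} [Fintype K] [Fintype L] [DecidableEq K] [DecidableEq L]
    [Fintype K'] [Fintype L'] [DecidableEq K'] [DecidableEq L']
    {M : MatFac S I J w} {M' : MatFac S I' J' w'} (e : I ≃ K) (f : J ≃ L) (e' : I' ≃ K')
    (f' : J' ≃ L') (a : Hom M M') : Hom (M.reindex e f) (M'.reindex e' f') where
  σ := a.σ.submatrix e'.symm e.symm
  τ := a.τ.submatrix f'.symm f.symm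
  comm_φ := by
    change M'.φ.submatrix _ _ * _ = _ * M.φ.submatrix _ _
    rw [Matrix.submatrix_mul_equiv, Matrix.submatrix_mul_equiv, a.comm_φ]
  comm_ψ := by
    change M'.ψ.submatrix _ _ * _ = _ * M.ψ.submatrix _ _
    rw [Matrix.submatrix_mul_equiv, Matrix.submatrix_mul_equiv, a.comm_ψ]

/-- The passage from `(P, Q)` to `(Q, -P)`, on morphisms. -/
def Hom.twist {M : MatFac S I J w} {M' : MatFac S I' J' w'} (f : Hom M M') :
    Hom M.twist M'.twist where
  σ := f.τ
  τ := f.σ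
  comm_φ := f.comm_ψ
  comm_ψ := by
    change -M'.φ * f.σ = f.τ * -M.φ
    rw [Matrix.neg_mul, Matrix.mul_neg, f.comm_φ]

/-- The morphism `f ⊗ 1 : M ⊗ N → M' ⊗ N`. -/
def Hom.tensorRight {M : MatFac S I J w} {M' : MatFac S I' J' w'} (f : Hom M M')
    (N : MatFac S I'' J'' w'') : Hom (M.tensor N) (M'.tensor N) where
  σ := fromBlocks (f.σ ⊗ₖ (1 : Matrix I'' I'' S)) 0 0 (f.τ ⊗ₖ (1 : Matrix J'' J'' S))
  τ := fromBlocks (f.σ ⊗ₖ (1 : Matrix J'' J'' S)) 0 0 (f.τ ⊗ₖ (1 : Matrix I'' I'' S))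
  comm_φ := by
    simp only [tensor, fromBlocks_multiply, Matrix.mul_zero, Matrix.zero_mul, add_zero, zero_add,
      Matrix.neg_mul, Matrix.mul_neg, ← mul_kronecker_mul, Matrix.one_mul, Matrix.mul_one,
      f.comm_φ, f.comm_ψ, neg_zero]
  comm_ψ := by
    simp only [tensor, fromBlocks_multiply, Matrix.mul_zero, Matrix.zero_mul, add_zero, zero_add,
      Matrix.neg_mul, Matrix.mul_neg, ← mul_kronecker_mul, Matrix.one_mul, Matrix.mul_one,
      f.comm_φ, f.comm_ψ, neg_zero]

/-! ### Quadratic and symplectic forms -/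

/-- A quadratic (`ε = 1`) or symplectic (`ε = -1`) form on `M`: an isomorphism `b` from `M` to
`M* : M₁* --(-φᵀ)--> M₀* --(-ψᵀ)--> M₁*` such that `bᵀ = -ε b`, with components
`b₀ : M₀ → M₁*` and `b₁ : M₁ → M₀*`. -/
structure BilinForm (M : MatFac S I J w) (ε : ℤˣ) where
  b₀ : Matrix J I S
  b₁ : Matrix I J S
  comm_φ : -(M.φᵀ * b₀) = b₁ * M.φ
  comm_ψ : -(M.ψᵀ * b₁) = b₀ * M.ψ
  transpose_b₀ : b₀ᵀ = -(ε • b₁)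
  transpose_b₁ : b₁ᵀ = -(ε • b₀)
  inv_b₀ : b₀.IsInvertible
  inv_b₁ : b₁.IsInvertible

/-- A twisted quadratic (`ε = 1`) or twisted symplectic (`ε = -1`) form on `M`: an isomorphism `q`
from `M` to `Mᵀ : M₀* --ψᵀ--> M₁* --φᵀ--> M₀*` such that `qᵀ = ε q`, with components
`q₀ : M₀ → M₀*` and `q₁ : M₁ → M₁*`. -/
structure TwistedForm (M : MatFac S I J w) (ε : ℤˣ) where
  q₀ : Matrix I I S
  q₁ : Matrix J J S
  comm_φ : M.ψᵀ * q₀ = q₁ * M.φ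
  comm_ψ : M.φᵀ * q₁ = q₀ * M.ψ
  transpose_q₀ : q₀ᵀ = ε • q₀
  transpose_q₁ : q₁ᵀ = ε • q₁
  inv_q₀ : q₀.IsInvertible
  inv_q₁ : q₁.IsInvertible

/-- A morphism `f : M → M'` carries the form `b` to the form `b'`, in the sense that
`fᵀ b' f = b`. -/
def Hom.PreservesBilin {M : MatFac S I J w} {M' : MatFac S I' J' w'} {ε : ℤˣ} (f : Hom M M')
    (b : BilinForm M ε) (b' : BilinForm M' ε) : Prop :=
  f.τᵀ * b'.b₀ * f.σ = b.b₀ ∧ f.σᵀ * b'.b₁ * f.τ = b.b₁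

/-- A morphism `f : M → M'` carries the twisted form `q` to the twisted form `q'`, in the sense
that `fᵀ q' f = q`. -/
def Hom.PreservesTwisted {M : MatFac S I J w} {M' : MatFac S I' J' w'} {ε : ℤˣ} (f : Hom M M')
    (q : TwistedForm M ε) (q' : TwistedForm M' ε) : Prop :=
  f.σᵀ * q'.q₀ * f.σ = q.q₀ ∧ f.τᵀ * q'.q₁ * f.τ = q.q₁

end MatFac

section Invertible

variable {S : Type*} [CommRing S]
variable {m n m' n' : Type*} [Fintype m] [Fintype n] [DecidableEq m] [DecidableEq n]
  [Fintype m'] [Fintype n'] [DecidableEq m'] [DecidableEq n']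

theorem Matrix.IsInvertible.neg {b : Matrix m n S} (h : b.IsInvertible) : (-b).IsInvertible := by
  obtain ⟨c, h₁, h₂⟩ := h
  exact ⟨-c, by simp [h₁], by simp [h₂]⟩

theorem Matrix.IsInvertible.map {T : Type*} [CommRing T] (f : S →+* T) {b : Matrix m n S}
    (h : b.IsInvertible) : (b.map f).IsInvertible := by
  obtain ⟨c, h₁, h₂⟩ := h
  refine ⟨c.map f, ?_, ?_⟩
  · rw [← Matrix.map_mul, h₁, Matrix.map_one _ f.map_zero f.map_one]
  · rw [← Matrix.map_mul, h₂, Matrix.map_one _ f.map_zero f.map_one]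

theorem Matrix.IsInvertible.submatrix {b : Matrix m n S} (h : b.IsInvertible) (e : m' ≃ m)
    (f : n' ≃ n) : (b.submatrix e f).IsInvertible := by
  obtain ⟨c, h₁, h₂⟩ := h
  refine ⟨c.submatrix f e, ?_, ?_⟩
  · rw [Matrix.submatrix_mul_equiv, h₁, Matrix.submatrix_one_equiv]
  · rw [Matrix.submatrix_mul_equiv, h₂, Matrix.submatrix_one_equiv]

theorem Matrix.IsInvertible.kronecker {b : Matrix m n S} {b' : Matrix m' n' S}
    (h : b.IsInvertible) (h' : b'.IsInvertible) : (b ⊗ₖ b').IsInvertible := by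
  obtain ⟨c, h₁, h₂⟩ := h
  obtain ⟨c', h₁', h₂'⟩ := h'
  refine ⟨c ⊗ₖ c', ?_, ?_⟩
  · rw [← mul_kronecker_mul, h₁, h₁', one_kronecker_one]
  · rw [← mul_kronecker_mul, h₂, h₂', one_kronecker_one]

theorem Matrix.IsInvertible.diagBlocks {b : Matrix m n S} {b' : Matrix m' n' S}
    (h : b.IsInvertible) (h' : b'.IsInvertible) : (fromBlocks b 0 0 b').IsInvertible := by
  obtain ⟨c, h₁, h₂⟩ := h
  obtain ⟨c', h₁', h₂'⟩ := h'
  exact ⟨fromBlocks c 0 0 c', by simp [fromBlocks_multiply, h₁, h₁'],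
    by simp [fromBlocks_multiply, h₂, h₂']⟩

theorem Matrix.IsInvertible.offDiagBlocks {b : Matrix m n S} {b' : Matrix m' n' S}
    (h : b.IsInvertible) (h' : b'.IsInvertible) : (fromBlocks 0 b b' 0).IsInvertible := by
  obtain ⟨c, h₁, h₂⟩ := h
  obtain ⟨c', h₁', h₂'⟩ := h'
  exact ⟨fromBlocks 0 c' c 0, by simp [fromBlocks_multiply, h₁, h₁'],
    by simp [fromBlocks_multiply, h₂, h₂']⟩

end Invertible

namespace MatFac

variable {S : Type u} [CommRing S]
variable {I J : Type} [Fintype I] [Fintype J] [DecidableEq I] [DecidableEq J]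
variable {I' J' : Type} [Fintype I'] [Fintype J'] [DecidableEq I'] [DecidableEq J']
variable {w w' : S} {ε ε' : ℤˣ}

/-! ### Operations on forms -/

/-- The same form, for an equal potential. -/
def BilinForm.copy {M : MatFac S I J w} (b : BilinForm M ε) (h : w = w') :
    BilinForm (M.copy h) ε :=
  ⟨b.b₀, b.b₁, b.comm_φ, b.comm_ψ, b.transpose_b₀, b.transpose_b₁, b.inv_b₀, b.inv_b₁⟩

/-- The same twisted form, for an equal potential. -/
def TwistedForm.copy {M : MatFac S I J w} (q : TwistedForm M ε) (h : w = w') :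
    TwistedForm (M.copy h) ε :=
  ⟨q.q₀, q.q₁, q.comm_φ, q.comm_ψ, q.transpose_q₀, q.transpose_q₁, q.inv_q₀, q.inv_q₁⟩

/-- The same form, for an equal sign. -/
def BilinForm.copySign {M : MatFac S I J w} (b : BilinForm M ε) (h : ε = ε') : BilinForm M ε' :=
  ⟨b.b₀, b.b₁, b.comm_φ, b.comm_ψ, h ▸ b.transpose_b₀, h ▸ b.transpose_b₁, b.inv_b₀, b.inv_b₁⟩

/-- The same twisted form, for an equal sign. -/
def TwistedForm.copySign {M : MatFac S I J w} (q : TwistedForm M ε) (h : ε = ε') :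
    TwistedForm M ε' :=
  ⟨q.q₀, q.q₁, q.comm_φ, q.comm_ψ, h ▸ q.transpose_q₀, h ▸ q.transpose_q₁, q.inv_q₀, q.inv_q₁⟩

/-- Base change of forms. -/
def BilinForm.map {T : Type*} [CommRing T] (F : S →+* T) {M : MatFac S I J w}
    (b : BilinForm M ε) : BilinForm (M.map F) ε where
  b₀ := b.b₀.map F
  b₁ := b.b₁.map F
  comm_φ := by
    change -((M.φ.map F)ᵀ * b.b₀.map F) = b.b₁.map F * M.φ.map F
    rw [← Matrix.map_mul, ← b.comm_φ, Matrix.map_neg _ (by simp), Matrix.map_mul, transpose_map]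
  comm_ψ := by
    change -((M.ψ.map F)ᵀ * b.b₁.map F) = b.b₀.map F * M.ψ.map F
    rw [← Matrix.map_mul, ← b.comm_ψ, Matrix.map_neg _ (by simp), Matrix.map_mul, transpose_map]
  transpose_b₀ := by
    rw [← transpose_map, b.transpose_b₀]; ext i j
    rcases Int.units_eq_one_or ε with rfl | rfl <;> simp
  transpose_b₁ := by
    rw [← transpose_map, b.transpose_b₁]; ext i j
    rcases Int.units_eq_one_or ε with rfl | rfl <;> simp
  inv_b₀ := b.inv_b₀.map F
  inv_b₁ := b.inv_b₁.map F

/-- Base change of twisted forms. -/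
def TwistedForm.map {T : Type*} [CommRing T] (F : S →+* T) {M : MatFac S I J w}
    (q : TwistedForm M ε) : TwistedForm (M.map F) ε where
  q₀ := q.q₀.map F
  q₁ := q.q₁.map F
  comm_φ := by
    change (M.ψ.map F)ᵀ * q.q₀.map F = q.q₁.map F * M.φ.map F
    rw [← Matrix.map_mul, ← q.comm_φ, Matrix.map_mul, transpose_map]
  comm_ψ := by
    change (M.φ.map F)ᵀ * q.q₁.map F = q.q₀.map F * M.ψ.map F
    rw [← Matrix.map_mul, ← q.comm_ψ, Matrix.map_mul, transpose_map]
  transpose_q₀ := by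
    rw [← transpose_map, q.transpose_q₀]; ext i j
    rcases Int.units_eq_one_or ε with rfl | rfl <;> simp
  transpose_q₁ := by
    rw [← transpose_map, q.transpose_q₁]; ext i j
    rcases Int.units_eq_one_or ε with rfl | rfl <;> simp
  inv_q₀ := q.inv_q₀.map F
  inv_q₁ := q.inv_q₁.map F

/-- Renaming of the bases, on forms. -/
def BilinForm.reindex {M : MatFac S I J w} (b : BilinForm M ε) (e : I ≃ I') (f : J ≃ J') :
    BilinForm (M.reindex e f) ε where
  b₀ := b.b₀.submatrix f.symm e.symm
  b₁ := b.b₁.submatrix e.symm f.symm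
  comm_φ := by
    change -((M.φ.submatrix _ _)ᵀ * _) = _ * M.φ.submatrix _ _
    rw [transpose_submatrix, Matrix.submatrix_mul_equiv, Matrix.submatrix_mul_equiv, ← b.comm_φ,
      submatrix_neg]; rfl
  comm_ψ := by
    change -((M.ψ.submatrix _ _)ᵀ * _) = _ * M.ψ.submatrix _ _
    rw [transpose_submatrix, Matrix.submatrix_mul_equiv, Matrix.submatrix_mul_equiv, ← b.comm_ψ,
      submatrix_neg]; rfl
  transpose_b₀ := by rw [transpose_submatrix, b.transpose_b₀]; rfl
  transpose_b₁ := by rw [transpose_submatrix, b.transpose_b₁]; rfl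
  inv_b₀ := b.inv_b₀.submatrix _ _
  inv_b₁ := b.inv_b₁.submatrix _ _

/-- Renaming of the bases, on twisted forms. -/
def TwistedForm.reindex {M : MatFac S I J w} (q : TwistedForm M ε) (e : I ≃ I') (f : J ≃ J') :
    TwistedForm (M.reindex e f) ε where
  q₀ := q.q₀.submatrix e.symm e.symm
  q₁ := q.q₁.submatrix f.symm f.symm
  comm_φ := by
    change (M.ψ.submatrix _ _)ᵀ * _ = _ * M.φ.submatrix _ _
    rw [transpose_submatrix, Matrix.submatrix_mul_equiv, Matrix.submatrix_mul_equiv, ← q.comm_φ]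
  comm_ψ := by
    change (M.φ.submatrix _ _)ᵀ * _ = _ * M.ψ.submatrix _ _
    rw [transpose_submatrix, Matrix.submatrix_mul_equiv, Matrix.submatrix_mul_equiv, ← q.comm_ψ]
  transpose_q₀ := by rw [transpose_submatrix, q.transpose_q₀]; rfl
  transpose_q₁ := by rw [transpose_submatrix, q.transpose_q₁]; rfl
  inv_q₀ := q.inv_q₀.submatrix _ _
  inv_q₁ := q.inv_q₁.submatrix _ _

/-- A form on `(P, Q)` gives a form of the same type on `(Q, -P)`. -/
def BilinForm.twist {M : MatFac S I J w} (b : BilinForm M ε) : BilinForm M.twist ε where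
  b₀ := b.b₁
  b₁ := b.b₀
  comm_φ := b.comm_ψ
  comm_ψ := by
    change -((-M.φ)ᵀ * b.b₀) = b.b₁ * (-M.φ)
    rw [transpose_neg, Matrix.neg_mul, Matrix.mul_neg, b.comm_φ]
  transpose_b₀ := b.transpose_b₁
  transpose_b₁ := b.transpose_b₀
  inv_b₀ := b.inv_b₁
  inv_b₁ := b.inv_b₀

/-- A twisted form on `(P, Q)` gives a twisted form of the same type on `(Q, -P)`. -/
def TwistedForm.twist {M : MatFac S I J w} (q : TwistedForm M ε) : TwistedForm M.twist ε where
  q₀ := q.q₁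
  q₁ := -q.q₀
  comm_φ := by
    change (-M.φ)ᵀ * q.q₁ = -q.q₀ * M.ψ
    rw [transpose_neg, Matrix.neg_mul, Matrix.neg_mul, q.comm_ψ]
  comm_ψ := by
    change M.ψᵀ * (-q.q₀) = q.q₁ * (-M.φ)
    rw [Matrix.mul_neg, Matrix.mul_neg, q.comm_φ]
  transpose_q₀ := q.transpose_q₁
  transpose_q₁ := by rw [transpose_neg, q.transpose_q₀, smul_neg]
  inv_q₀ := q.inv_q₁
  inv_q₁ := q.inv_q₀.neg

/-- The tensor product `q ⊗ b'` of a twisted form with a form (with the Koszul sign rule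
`(q ⊗ b')(m ⊗ m') = (-1)^|m| q(m) ⊗ b'(m')`). It is a form. -/
def TwistedForm.tensorBilin {M : MatFac S I J w} {M' : MatFac S I' J' w'} (q : TwistedForm M ε)
    (b : BilinForm M' ε') : BilinForm (M.tensor M') (ε * ε') where
  b₀ := fromBlocks (q.q₀ ⊗ₖ b.b₀) 0 0 (-(q.q₁ ⊗ₖ b.b₁))
  b₁ := fromBlocks (q.q₀ ⊗ₖ b.b₁) 0 0 (-(q.q₁ ⊗ₖ b.b₀))
  comm_φ := by
    simp only [tensor, fromBlocks_transpose, fromBlocks_multiply, transpose_neg,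
      ← kroneckerMap_transpose, transpose_one, Matrix.mul_zero, Matrix.zero_mul, add_zero, zero_add,
      Matrix.neg_mul, Matrix.mul_neg, ← mul_kronecker_mul, Matrix.one_mul, Matrix.mul_one, neg_neg,
      fromBlocks_neg, q.comm_φ, q.comm_ψ, ← b.comm_φ, ← b.comm_ψ]
    congr 1 <;> · ext ⟨_, _⟩ ⟨_, _⟩; simp
  comm_ψ := by
    simp only [tensor, fromBlocks_transpose, fromBlocks_multiply, transpose_neg,
      ← kroneckerMap_transpose, transpose_one, Matrix.mul_zero, Matrix.zero_mul, add_zero, zero_add,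
      Matrix.neg_mul, Matrix.mul_neg, ← mul_kronecker_mul, Matrix.one_mul, Matrix.mul_one, neg_neg,
      fromBlocks_neg, q.comm_φ, q.comm_ψ, ← b.comm_φ, ← b.comm_ψ]
    congr 1 <;> · ext ⟨_, _⟩ ⟨_, _⟩; simp
  transpose_b₀ := by
    simp only [fromBlocks_transpose, transpose_neg, ← kroneckerMap_transpose, q.transpose_q₀,
      q.transpose_q₁, b.transpose_b₀, b.transpose_b₁, transpose_zero]
    rcases Int.units_eq_one_or ε with rfl | rfl <;>
    rcases Int.units_eq_one_or ε' with rfl | rfl <;>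
    · ext (⟨_, _⟩ | ⟨_, _⟩) (⟨_, _⟩ | ⟨_, _⟩) <;> simp
  transpose_b₁ := by
    simp only [fromBlocks_transpose, transpose_neg, ← kroneckerMap_transpose, q.transpose_q₀,
      q.transpose_q₁, b.transpose_b₀, b.transpose_b₁, transpose_zero]
    rcases Int.units_eq_one_or ε with rfl | rfl <;>
    rcases Int.units_eq_one_or ε' with rfl | rfl <;>
    · ext (⟨_, _⟩ | ⟨_, _⟩) (⟨_, _⟩ | ⟨_, _⟩) <;> simp
  inv_b₀ := (q.inv_q₀.kronecker b.inv_b₀).diagBlocks (q.inv_q₁.kronecker b.inv_b₁).neg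
  inv_b₁ := (q.inv_q₀.kronecker b.inv_b₁).diagBlocks (q.inv_q₁.kronecker b.inv_b₀).neg

/-- The tensor product `b ⊗ b'` of two forms (with the Koszul sign rule
`(b ⊗ b')(m ⊗ m') = (-1)^|m| b(m) ⊗ b'(m')`). It is a twisted form. -/
def BilinForm.tensorBilin {M : MatFac S I J w} {M' : MatFac S I' J' w'} (b : BilinForm M ε)
    (b' : BilinForm M' ε') : TwistedForm (M.tensor M') (-(ε * ε')) where
  q₀ := fromBlocks 0 (-(b.b₁ ⊗ₖ b'.b₁)) (b.b₀ ⊗ₖ b'.b₀) 0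
  q₁ := fromBlocks 0 (-(b.b₁ ⊗ₖ b'.b₀)) (b.b₀ ⊗ₖ b'.b₁) 0
  comm_φ := by
    simp only [tensor, fromBlocks_transpose, fromBlocks_multiply, transpose_neg,
      ← kroneckerMap_transpose, transpose_one, Matrix.mul_zero, Matrix.zero_mul, add_zero, zero_add,
      Matrix.neg_mul, Matrix.mul_neg, ← mul_kronecker_mul, Matrix.one_mul, Matrix.mul_one, neg_neg,
      ← b.comm_φ, ← b.comm_ψ, ← b'.comm_φ, ← b'.comm_ψ]
    congr 1 <;> · ext ⟨_, _⟩ ⟨_, _⟩; simp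
  comm_ψ := by
    simp only [tensor, fromBlocks_transpose, fromBlocks_multiply, transpose_neg,
      ← kroneckerMap_transpose, transpose_one, Matrix.mul_zero, Matrix.zero_mul, add_zero, zero_add,
      Matrix.neg_mul, Matrix.mul_neg, ← mul_kronecker_mul, Matrix.one_mul, Matrix.mul_one, neg_neg,
      ← b.comm_φ, ← b.comm_ψ, ← b'.comm_φ, ← b'.comm_ψ]
    congr 1 <;> · ext ⟨_, _⟩ ⟨_, _⟩; simp
  transpose_q₀ := by
    simp only [fromBlocks_transpose, transpose_neg, ← kroneckerMap_transpose, b.transpose_b₀,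
      b.transpose_b₁, b'.transpose_b₀, b'.transpose_b₁, transpose_zero]
    rcases Int.units_eq_one_or ε with rfl | rfl <;>
    rcases Int.units_eq_one_or ε' with rfl | rfl <;>
    · ext (⟨_, _⟩ | ⟨_, _⟩) (⟨_, _⟩ | ⟨_, _⟩) <;> simp
  transpose_q₁ := by
    simp only [fromBlocks_transpose, transpose_neg, ← kroneckerMap_transpose, b.transpose_b₀,
      b.transpose_b₁, b'.transpose_b₀, b'.transpose_b₁, transpose_zero]
    rcases Int.units_eq_one_or ε with rfl | rfl <;>
    rcases Int.units_eq_one_or ε' with rfl | rfl <;>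
    · ext (⟨_, _⟩ | ⟨_, _⟩) (⟨_, _⟩ | ⟨_, _⟩) <;> simp
  inv_q₀ := (b.inv_b₁.kronecker b'.inv_b₁).neg.offDiagBlocks (b.inv_b₀.kronecker b'.inv_b₀)
  inv_q₁ := (b.inv_b₁.kronecker b'.inv_b₀).neg.offDiagBlocks (b.inv_b₀.kronecker b'.inv_b₁)

end MatFac

/-! ### The categories of matrix factorizations -/

/-- The category of matrix factorizations of `w` over `S` and closed morphisms of degree zero. -/
structure MFCat (S : Type u) [CommRing S] (w : S) where
  {I J : Type}
  [fintypeI : Fintype I]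
  [fintypeJ : Fintype J]
  [decEqI : DecidableEq I]
  [decEqJ : DecidableEq J]
  mf : MatFac S I J w

attribute [instance] MFCat.fintypeI MFCat.fintypeJ MFCat.decEqI MFCat.decEqJ

instance MFCat.category (S : Type u) [CommRing S] (w : S) : Category (MFCat S w) where
  Hom M N := MatFac.Hom M.mf N.mf
  id M := MatFac.Hom.id M.mf
  comp f g := MatFac.Hom.comp f g
  id_comp f := by ext1 <;> simp [MatFac.Hom.comp, MatFac.Hom.id]
  comp_id f := by ext1 <;> simp [MatFac.Hom.comp, MatFac.Hom.id]
  assoc f g h := by ext1 <;> simp [MatFac.Hom.comp, Matrix.mul_assoc]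

/-- The homotopy relation on morphisms of matrix factorizations. -/
def MFCat.homotopy (S : Type u) [CommRing S] (w : S) : HomRel (MFCat S w) :=
  fun _ _ f g => MatFac.Hom.Homotopic f g

/-- Homotopy is an equivalence relation compatible with composition, so that the morphisms of the
quotient category are exactly the homotopy classes. -/
instance MFCat.congruence_homotopy (S : Type u) [CommRing S] (w : S) :
    Congruence (MFCat.homotopy S w) where
  equivalence := by
    refine ⟨fun f => ⟨0, 0, by simp, by simp⟩, ?_, ?_⟩
    · rintro f g ⟨h₀, h₁, e₀, e₁⟩
      refine ⟨-h₀, -h₁, ?_, ?_⟩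
      · rw [← neg_sub, e₀, Matrix.mul_neg, Matrix.neg_mul, neg_add]
      · rw [← neg_sub, e₁, Matrix.mul_neg, Matrix.neg_mul, neg_add]
    · rintro f g k ⟨h₀, h₁, e₀, e₁⟩ ⟨h₀', h₁', e₀', e₁'⟩
      refine ⟨h₀ + h₀', h₁ + h₁', ?_, ?_⟩
      · rw [← sub_add_sub_cancel _ g.σ, e₀, e₀', Matrix.mul_add, Matrix.add_mul]; abel
      · rw [← sub_add_sub_cancel _ g.τ, e₁, e₁', Matrix.mul_add, Matrix.add_mul]; abel
  comp_left := by
    rintro L M N f g g' ⟨h₀, h₁, e₀, e₁⟩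
    refine ⟨h₀ * f.σ, h₁ * f.τ, ?_, ?_⟩
    · change g.σ * f.σ - g'.σ * f.σ = _
      rw [← Matrix.sub_mul, e₀, Matrix.add_mul, Matrix.mul_assoc, Matrix.mul_assoc,
        Matrix.mul_assoc, f.comm_φ]
    · change g.τ * f.τ - g'.τ * f.τ = _
      rw [← Matrix.sub_mul, e₁, Matrix.add_mul, Matrix.mul_assoc, Matrix.mul_assoc,
        Matrix.mul_assoc, f.comm_ψ]
  comp_right := by
    rintro L M N f f' g ⟨h₀, h₁, e₀, e₁⟩
    refine ⟨g.τ * h₀, g.σ * h₁, ?_, ?_⟩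
    · change g.σ * f.σ - g.σ * f'.σ = _
      rw [← Matrix.mul_sub, e₀, Matrix.mul_add, ← Matrix.mul_assoc, ← g.comm_ψ, Matrix.mul_assoc,
        Matrix.mul_assoc]
    · change g.τ * f.τ - g.τ * f'.τ = _
      rw [← Matrix.mul_sub, e₁, Matrix.mul_add, ← Matrix.mul_assoc, ← g.comm_φ, Matrix.mul_assoc,
        Matrix.mul_assoc]

/-- The homotopy category of matrix factorizations of `w` over `S`: the morphisms `M → M'` are the
elements of `Ext⁰(M, M') = ker D / im D`. -/
abbrev HMF (S : Type u) [CommRing S] (w : S) := CategoryTheory.Quotient (MFCat.homotopy S w)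

end Basic

/-! ### The functor `θ` -/

section Theta

universe u

/-- The ring `A[[x, y]]`. -/
abbrev PS₂ (A : Type u) [CommRing A] : Type u := MvPowerSeries (Fin 2) A

/-- The product `xy` in `A[[x, y]]`. -/
noncomputable abbrev PS₂.xy (A : Type u) [CommRing A] : PS₂ A :=
  MvPowerSeries.X 0 * MvPowerSeries.X 1

namespace MatFac

variable {A : Type u} [CommRing A]
variable {I J : Type} [Fintype I] [Fintype J] [DecidableEq I] [DecidableEq J]
variable {I' J' : Type} [Fintype I'] [Fintype J'] [DecidableEq I'] [DecidableEq J']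

/-- The rank one matrix factorization `(x, y)` of `xy`. -/
noncomputable def xyMF (A : Type u) [CommRing A] : MatFac (PS₂ A) Unit Unit (PS₂.xy A) where
  φ := (MvPowerSeries.X 0 : PS₂ A) • 1
  ψ := (MvPowerSeries.X 1 : PS₂ A) • 1
  φ_mul_ψ := by simp [smul_smul, mul_comm]
  ψ_mul_φ := by simp [smul_smul]

/-- The quadratic form on `(x, y)`. -/
noncomputable def xyForm (A : Type u) [CommRing A] : BilinForm (xyMF A) 1 where
  b₀ := 1
  b₁ := -1
  comm_φ := by simp [xyMF]
  comm_ψ := by simp [xyMF]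
  transpose_b₀ := by simp
  transpose_b₁ := by simp
  inv_b₀ := ⟨1, by simp, by simp⟩
  inv_b₁ := ⟨-1, by simp, by simp⟩

/-- The identification `K ⊗ S ⊕ L ⊗ S = K ⊕ L` of bases. -/
abbrev sumUnitEquiv (K L : Type) : (K × Unit) ⊕ (L × Unit) ≃ K ⊕ L :=
  Equiv.sumCongr (Equiv.prodPUnit K) (Equiv.prodPUnit L)

/-- The tensor product `(Q, -P) ⊗ (x, y)` over `A[[x, y]]`. -/
noncomputable def thetaTensor {π : A} (N : MatFac A I J π) :
    MatFac (PS₂ A) ((J × Unit) ⊕ (I × Unit)) ((J × Unit) ⊕ (I × Unit))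
      (-(MvPowerSeries.C π : PS₂ A) + PS₂.xy A) :=
  (N.map (MvPowerSeries.C (σ := Fin 2) (R := A))).twist.tensor (xyMF A)

theorem theta_potential (π : A) :
    -(MvPowerSeries.C π : PS₂ A) + PS₂.xy A = PS₂.xy A - MvPowerSeries.C π := by ring

/-- `θ(P, Q) = (Q, -P) ⊗ (x, y)`, a matrix factorization of `xy - π` over `A[[x, y]]` for every
matrix factorization `(P, Q)` of `π` over `A`. -/
noncomputable def theta {π : A} (N : MatFac A I J π) :
    MatFac (PS₂ A) (J ⊕ I) (J ⊕ I) (PS₂.xy A - MvPowerSeries.C π) :=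
  (N.thetaTensor.reindex (sumUnitEquiv J I) (sumUnitEquiv J I)).copy (theta_potential π)

/-- The matrices of `θ(P, Q)`. -/
theorem theta_φ {π : A} (N : MatFac A I J π) :
    N.theta.φ = fromBlocks ((MvPowerSeries.X 0 : PS₂ A) • 1) (-N.φ.map MvPowerSeries.C)
      (N.ψ.map MvPowerSeries.C) (-((MvPowerSeries.X 1 : PS₂ A) • 1)) := by
  ext (i | i) (j | j) <;>
    simp [theta, thetaTensor, MatFac.copy, MatFac.reindex, MatFac.tensor, MatFac.twist, MatFac.map,
      xyMF, Matrix.one_apply]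

theorem theta_ψ {π : A} (N : MatFac A I J π) :
    N.theta.ψ = fromBlocks ((MvPowerSeries.X 1 : PS₂ A) • 1) (-N.φ.map MvPowerSeries.C)
      (N.ψ.map MvPowerSeries.C) (-((MvPowerSeries.X 0 : PS₂ A) • 1)) := by
  ext (i | i) (j | j) <;>
    simp [theta, thetaTensor, MatFac.copy, MatFac.reindex, MatFac.tensor, MatFac.twist, MatFac.map,
      xyMF, Matrix.one_apply]

/-- The form `q ⊗ b` on `(Q, -P) ⊗ (x, y)`. -/
noncomputable def TwistedForm.thetaTensor {π : A} {N : MatFac A I J π} {ε : ℤˣ}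
    (q : TwistedForm N ε) : BilinForm N.thetaTensor (ε * 1) :=
  (q.map (MvPowerSeries.C (σ := Fin 2) (R := A))).twist.tensorBilin (xyForm A)

/-- The twisted form `b' ⊗ b` on `(Q, -P) ⊗ (x, y)`. -/
noncomputable def BilinForm.thetaTensor {π : A} {N : MatFac A I J π} {ε : ℤˣ}
    (b : BilinForm N ε) : TwistedForm N.thetaTensor (-(ε * 1)) :=
  (b.map (MvPowerSeries.C (σ := Fin 2) (R := A))).twist.tensorBilin (xyForm A)

/-- A twisted form `q` on `(P, Q)` induces the form `q ⊗ b` on `θ(P, Q)`, where `b` is the quadratic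
form on `(x, y)`: twisted quadratic forms give quadratic forms, twisted symplectic forms give
symplectic forms. -/
noncomputable def TwistedForm.theta {π : A} {N : MatFac A I J π} {ε : ℤˣ} (q : TwistedForm N ε) :
    BilinForm N.theta ε :=
  ((q.thetaTensor.reindex (sumUnitEquiv J I) (sumUnitEquiv J I)).copy (theta_potential π)).copySign
    (mul_one ε)

/-- A form `b'` on `(P, Q)` induces the twisted form `b' ⊗ b` on `θ(P, Q)`, where `b` is the
quadratic form on `(x, y)`: quadratic forms give twisted symplectic forms, symplectic forms give
twisted quadratic forms. -/
noncomputable def BilinForm.theta {π : A} {N : MatFac A I J π} {ε : ℤˣ} (b : BilinForm N ε) :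
    TwistedForm N.theta (-ε) :=
  ((b.thetaTensor.reindex (sumUnitEquiv J I) (sumUnitEquiv J I)).copy (theta_potential π)).copySign
    (congrArg Neg.neg (mul_one ε))

/-- The morphism `f ⊗ 1`. -/
noncomputable def Hom.thetaTensor {π π' : A} {N : MatFac A I J π} {N' : MatFac A I' J' π'}
    (f : Hom N N') : Hom N.thetaTensor N'.thetaTensor :=
  (f.map (MvPowerSeries.C (σ := Fin 2) (R := A))).twist.tensorRight (xyMF A)

/-- The action of `θ` on morphisms. -/
noncomputable def Hom.theta {π π' : A} {N : MatFac A I J π} {N' : MatFac A I' J' π'}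
    (f : Hom N N') : Hom N.theta N'.theta :=
  (f.thetaTensor.reindex (sumUnitEquiv J I) (sumUnitEquiv J I) (sumUnitEquiv J' I')
    (sumUnitEquiv J' I')).copy (theta_potential π) (theta_potential π')

theorem Hom.theta_σ {π π' : A} {N : MatFac A I J π} {N' : MatFac A I' J' π'} (f : Hom N N') :
    f.theta.σ = fromBlocks (f.τ.map MvPowerSeries.C) 0 0 (f.σ.map MvPowerSeries.C) := by
  ext (i | i) (j | j) <;>
    simp [Hom.theta, Hom.thetaTensor, Hom.copy, Hom.reindex, Hom.tensorRight, Hom.twist, Hom.map]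

theorem Hom.theta_τ {π π' : A} {N : MatFac A I J π} {N' : MatFac A I' J' π'} (f : Hom N N') :
    f.theta.τ = fromBlocks (f.τ.map MvPowerSeries.C) 0 0 (f.σ.map MvPowerSeries.C) := by
  ext (i | i) (j | j) <;>
    simp [Hom.theta, Hom.thetaTensor, Hom.copy, Hom.reindex, Hom.tensorRight, Hom.twist, Hom.map]

theorem Hom.Homotopic.theta {π π' : A} {N : MatFac A I J π} {N' : MatFac A I' J' π'}
    {f g : Hom N N'} (h : f.Homotopic g) : f.theta.Homotopic g.theta := by
  obtain ⟨h₀, h₁, e₀, e₁⟩ := h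
  refine ⟨fromBlocks 0 (h₀.map MvPowerSeries.C) (-h₁.map MvPowerSeries.C) 0,
    fromBlocks 0 (h₀.map MvPowerSeries.C) (-h₁.map MvPowerSeries.C) 0, ?_, ?_⟩
  · rw [theta_σ, theta_σ, theta_φ, theta_ψ, fromBlocks_multiply, fromBlocks_multiply,
      fromBlocks_add, sub_eq_add_neg, fromBlocks_neg, fromBlocks_add]
    congr 1
    · rw [← sub_eq_add_neg, ← Matrix.map_sub _ (by simp), e₁, Matrix.map_add _ (by simp),
        Matrix.map_mul, Matrix.map_mul]
      simp
    · simp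
    · simp
    · rw [← sub_eq_add_neg, ← Matrix.map_sub _ (by simp), e₀, Matrix.map_add _ (by simp),
        Matrix.map_mul, Matrix.map_mul]
      simp
  · rw [theta_τ, theta_τ, theta_φ, theta_ψ, fromBlocks_multiply, fromBlocks_multiply,
      fromBlocks_add, sub_eq_add_neg, fromBlocks_neg, fromBlocks_add]
    congr 1
    · rw [← sub_eq_add_neg, ← Matrix.map_sub _ (by simp), e₁, Matrix.map_add _ (by simp),
        Matrix.map_mul, Matrix.map_mul]
      simp
    · simp
    · simp
    · rw [← sub_eq_add_neg, ← Matrix.map_sub _ (by simp), e₀, Matrix.map_add _ (by simp),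
        Matrix.map_mul, Matrix.map_mul]
      simp

end MatFac

/-- The functor `θ` on closed morphisms. -/
noncomputable def thetaClosed {A : Type u} [CommRing A] (π : A) :
    MFCat A π ⥤ MFCat (PS₂ A) (PS₂.xy A - MvPowerSeries.C π) where
  obj N := ⟨N.mf.theta⟩
  map f := MatFac.Hom.theta f
  map_id N := by
    apply MatFac.Hom.ext
    · refine (MatFac.Hom.theta_σ _).trans ?_
      change fromBlocks ((1 : Matrix N.J N.J A).map _) 0 0 ((1 : Matrix N.I N.I A).map _) = 1
      rw [Matrix.map_one _ (by simp) (by simp), Matrix.map_one _ (by simp) (by simp),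
        fromBlocks_one]
    · refine (MatFac.Hom.theta_τ _).trans ?_
      change fromBlocks ((1 : Matrix N.J N.J A).map _) 0 0 ((1 : Matrix N.I N.I A).map _) = 1
      rw [Matrix.map_one _ (by simp) (by simp), Matrix.map_one _ (by simp) (by simp),
        fromBlocks_one]
  map_comp {M N L} f g := by
    apply MatFac.Hom.ext
    · refine (MatFac.Hom.theta_σ _).trans ?_
      change fromBlocks ((g.τ * f.τ).map _) 0 0 ((g.σ * f.σ).map _) =
        (MatFac.Hom.theta g).σ * (MatFac.Hom.theta f).σ
      rw [MatFac.Hom.theta_σ, MatFac.Hom.theta_σ, fromBlocks_multiply, Matrix.map_mul,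
        Matrix.map_mul]
      simp
    · refine (MatFac.Hom.theta_τ _).trans ?_
      change fromBlocks ((g.τ * f.τ).map _) 0 0 ((g.σ * f.σ).map _) =
        (MatFac.Hom.theta g).τ * (MatFac.Hom.theta f).τ
      rw [MatFac.Hom.theta_τ, MatFac.Hom.theta_τ, fromBlocks_multiply, Matrix.map_mul,
        Matrix.map_mul]
      simp

/-- The functor `θ : MF_A(π) ⥤ MF_{A[[x, y]]}(xy - π)` between homotopy categories. -/
noncomputable def thetaFunctor {A : Type u} [CommRing A] (π : A) :
    HMF A π ⥤ HMF (PS₂ A) (PS₂.xy A - MvPowerSeries.C π) :=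
  CategoryTheory.Quotient.lift (MFCat.homotopy A π)
    (thetaClosed π ⋙ CategoryTheory.Quotient.functor _)
    fun _ _ _ _ h => CategoryTheory.Quotient.sound _ (MatFac.Hom.Homotopic.theta h)

end Theta

/-! ### Deformations -/

section Deformation

universe u v

namespace MatFac

/-- The matrix factorization `M̄_r = (diag(x 1_r, y 1_r), diag(y 1_r, x 1_r))` of `xy` over
`k[[x, y]]`. -/
noncomputable def Mbar (k : Type u) [CommRing k] (r : ℕ) :
    MatFac (PS₂ k) (Fin r ⊕ Fin r) (Fin r ⊕ Fin r) (PS₂.xy k) where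
  φ := fromBlocks ((MvPowerSeries.X 0 : PS₂ k) • 1) 0 0 ((MvPowerSeries.X 1 : PS₂ k) • 1)
  ψ := fromBlocks ((MvPowerSeries.X 1 : PS₂ k) • 1) 0 0 ((MvPowerSeries.X 0 : PS₂ k) • 1)
  φ_mul_ψ := by
    rw [fromBlocks_multiply, ← fromBlocks_one, fromBlocks_smul]
    simp [smul_smul, mul_comm]
  ψ_mul_φ := by
    rw [fromBlocks_multiply, ← fromBlocks_one, fromBlocks_smul]
    simp [smul_smul, mul_comm]

/-- The matrix factorization `(0, 0)` of `0` of rank `r`. -/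
def zeroMF (k : Type u) [CommRing k] (r : ℕ) : MatFac k (Fin r) (Fin r) 0 :=
  ⟨0, 0, by simp, by simp⟩

/-- The standard identification of `M̄_r` with `θ(0, 0)`: a change of sign of the last `r` basis
vectors of `M₀`. -/
noncomputable def MbarIso (k : Type u) [CommRing k] (r : ℕ) :
    Hom (Mbar k r) (zeroMF k r).theta where
  σ := fromBlocks 1 0 0 (-1)
  τ := 1
  comm_φ := by
    rw [theta_φ, Matrix.one_mul]; simp [zeroMF, Mbar, fromBlocks_multiply]
  comm_ψ := by
    rw [theta_ψ, Matrix.mul_one]; simp [zeroMF, Mbar, fromBlocks_multiply]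

section

variable {k : Type u} [Field k] {A : Type v} [CommRing A] [IsLocalRing A] [Algebra k A]
variable (hk : Function.Bijective (algebraMap k (IsLocalRing.ResidueField A)))

/-- The reduction `A → k` of a local `k`-algebra with residue field `k`. -/
noncomputable def residueMap : A →+* k :=
  (RingEquiv.ofBijective (algebraMap k (IsLocalRing.ResidueField A)) hk).symm.toRingHom.comp
    (IsLocalRing.residue A)

/-- The reduction `A[[x, y]] → k[[x, y]]`, coefficient by coefficient. -/
noncomputable def reduction : PS₂ A →+* PS₂ k :=
  MvPowerSeries.map (residueMap hk)

/-- An infinitesimal change of variables: an `A`-automorphism of `A[[x, y]]` whose reduction to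
`k[[x, y]]` is the identity. -/
def IsInfinitesimal (g : PS₂ A ≃ₐ[A] PS₂ A) : Prop :=
  ∀ f : PS₂ A, reduction hk (g f) = reduction hk f

variable {I J : Type} [Fintype I] [Fintype J] [DecidableEq I] [DecidableEq J]
variable {I' J' : Type} [Fintype I'] [Fintype J'] [DecidableEq I'] [DecidableEq J']

/-- `M` (of potential `w`, over `A`) reduces to `M₀` (of potential `w₀`, over `k`). -/
def IsDeformation {w₀ : PS₂ k} {w : PS₂ A} (M₀ : MatFac (PS₂ k) I J w₀)
    (M : MatFac (PS₂ A) I J w) : Prop :=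
  reduction hk w = w₀ ∧ M.φ.map (reduction hk) = M₀.φ ∧ M.ψ.map (reduction hk) = M₀.ψ

/-- The form `b` on `M` reduces to the form `b'` on `M₀`. -/
def BilinForm.ReducesTo {w₀ : PS₂ k} {w : PS₂ A} {M₀ : MatFac (PS₂ k) I J w₀}
    {M : MatFac (PS₂ A) I J w} {ε : ℤˣ} (b : BilinForm M ε) (b' : BilinForm M₀ ε) : Prop :=
  b.b₀.map (reduction hk) = b'.b₀ ∧ b.b₁.map (reduction hk) = b'.b₁

/-- The twisted form `q` on `M` reduces to the twisted form `q'` on `M₀`. -/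
def TwistedForm.ReducesTo {w₀ : PS₂ k} {w : PS₂ A} {M₀ : MatFac (PS₂ k) I J w₀}
    {M : MatFac (PS₂ A) I J w} {ε : ℤˣ} (q : TwistedForm M ε) (q' : TwistedForm M₀ ε) : Prop :=
  q.q₀.map (reduction hk) = q'.q₀ ∧ q.q₁.map (reduction hk) = q'.q₁

/-- The morphism `F` over `A` reduces to the morphism `F'` over `k`. -/
def Hom.ReducesTo {w₀ w₀' : PS₂ k} {w w' : PS₂ A} {M₀ : MatFac (PS₂ k) I J w₀}
    {M₀' : MatFac (PS₂ k) I' J' w₀'} {M : MatFac (PS₂ A) I J w} {M' : MatFac (PS₂ A) I' J' w'}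
    (F : Hom M M') (F' : Hom M₀ M₀') : Prop :=
  F.σ.map (reduction hk) = F'.σ ∧ F.τ.map (reduction hk) = F'.τ

end

/-- The entries of `(P, Q)` lie in the maximal ideal of `A`. -/
def IsReduced {A : Type v} [CommRing A] [IsLocalRing A] {π : A} {I J : Type} [Fintype I]
    [Fintype J] [DecidableEq I] [DecidableEq J] (N : MatFac A I J π) : Prop :=
  (∀ i j, N.φ i j ∈ IsLocalRing.maximalIdeal A) ∧ ∀ i j, N.ψ i j ∈ IsLocalRing.maximalIdeal A

/-- The form `b` over `A` is the constant form `b' ⊗ 1`, for a form `b'` over `k`. -/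
def BilinForm.IsConst {k : Type u} [CommRing k] {A : Type v} [CommRing A] [Algebra k A]
    {I J : Type} [Fintype I] [Fintype J] [DecidableEq I] [DecidableEq J] {w₀ : k} {w : A}
    {M₀ : MatFac k I J w₀} {M : MatFac A I J w} {ε : ℤˣ} (b : BilinForm M ε)
    (b' : BilinForm M₀ ε) : Prop :=
  b.b₀ = b'.b₀.map (algebraMap k A) ∧ b.b₁ = b'.b₁.map (algebraMap k A)

/-- The twisted form `q` over `A` is the constant form `q' ⊗ 1`, for a twisted form `q'` over
`k`. -/
def TwistedForm.IsConst {k : Type u} [CommRing k] {A : Type v} [CommRing A] [Algebra k A]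
    {I J : Type} [Fintype I] [Fintype J] [DecidableEq I] [DecidableEq J] {w₀ : k} {w : A}
    {M₀ : MatFac k I J w₀} {M : MatFac A I J w} {ε : ℤˣ} (q : TwistedForm M ε)
    (q' : TwistedForm M₀ ε) : Prop :=
  q.q₀ = q'.q₀.map (algebraMap k A) ∧ q.q₁ = q'.q₁.map (algebraMap k A)

end MatFac

end Deformation

/-! A matrix factorization is treated as a single odd operator D with D² equal to the potential. The
operator of θ(P, Q) is K + C, where K (`koszul`) is the operator of θ(0, 0) and C (`perturbation P
Q`) is constant and anticommutes with K. An isomorphism onto θ(P, Q) is thus an even invertible F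
with F D = (K + C) F. For D close to K this equation is solved by successive approximation.
Linearised, it asks to write the residue E = F D - (K + C) F as C' + [K, F'] up to smaller terms.
This is possible because odd operators anticommuting with K are, modulo commutators with K, constant
of the shape C'. Division by x and y makes this explicit in `exists_homotopy`. The relation D² = xy
- π makes E anticommute with K up to smaller terms and a constant, which the divisions ignore
(`Gauge.Approx.exists_next`). Completeness then yields `exists_gauge`, and `exists_hom_theta` reads
off that PQ = QP = π.

A form is a matrix B = b T, with b the constant model. For the anti-involution X* = b⁻¹ Xᵀ b, an
isometry is a solution of F* F = T. Since 2 is invertible, each approximation can be corrected by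
half of the defect T - F* F, and then the solution of the linearised equation can be averaged over
the involution, so that it respects the form. The result is `exists_unitary_gauge`, translated back
into matrices in `exists_isometric_gauge`.

The same approximation is run for two filtrations. For deformations of `Mbar` the 𝔪-adic one
suffices. When D agrees with K only in its linear part modulo 𝔪, the variables must be small as
well: x and y get weight 1 and 𝔪 gets weight 2. Over k, where 𝔪 = 0, this second filtration also
straightens a form to its constant part (`exists_isometry_theta_zeroMF`).

The potential is normalised separately: a Newton iteration writes ω = uv - π with u, v close to x, y
(`exists_eq_mul_sub_C`), and the substitution x ↦ u, y ↦ v is inverted (`exists_algEquiv_eq_sub_C`).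

For part (ii), full faithfulness is again division by x and y (`Hom.Homotopic.of_theta`,
`exists_theta_homotopic`). For essential surjectivity, unit entries are eliminated
(`exists_hEquiv_isReduced`). The linear part of what remains satisfies the Clifford relations of the
form xy over the residue field, whose representations are all sums of two standard ones
(`exists_clifford_basis`). After a constant change of bases the weighted approximation applies. -/

/-! ### Division by the variables of `A[[x, y]]` -/

namespace PS₂

universe u

variable {A : Type u} [CommRing A]

theorem coeff_single_add_X_mul (s : Fin 2) (d : Fin 2 →₀ ℕ) (f : PS₂ A) :
    MvPowerSeries.coeff (Finsupp.single s 1 + d) (MvPowerSeries.X s * f) =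
      MvPowerSeries.coeff d f := by
  rw [MvPowerSeries.X_def, MvPowerSeries.coeff_add_monomial_mul, one_mul]

theorem coeff_X_mul_of_eq_zero {s : Fin 2} {d : Fin 2 →₀ ℕ} (h : d s = 0) (f : PS₂ A) :
    MvPowerSeries.coeff d (MvPowerSeries.X s * f) = 0 := by
  rw [MvPowerSeries.X_def, MvPowerSeries.coeff_monomial_mul, if_neg]
  intro hle
  have := hle s
  simp [h] at this

theorem exists_eq_single_add {s : Fin 2} {d : Fin 2 →₀ ℕ} (h : d s ≠ 0) :
    ∃ e, d = Finsupp.single s 1 + e :=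
  ⟨d - Finsupp.single s 1, (add_tsub_cancel_of_le (by
    rw [Finsupp.single_le_iff]; omega)).symm⟩

theorem eq_zero_of_apply {d : Fin 2 →₀ ℕ} (h₀ : d 0 = 0) (h₁ : d 1 = 0) : d = 0 := by
  ext i; fin_cases i <;> simp [h₀, h₁]

/-- The quotient of the division of a power series by `x`. -/
noncomputable def shiftX (A : Type u) [CommRing A] : PS₂ A →ₗ[A] PS₂ A where
  toFun f := fun d => MvPowerSeries.coeff (Finsupp.single 0 1 + d) f
  map_add' f g := by ext d; exact map_add (MvPowerSeries.coeff _) f g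
  map_smul' a f := by ext d; exact map_smul (MvPowerSeries.coeff _) a f

/-- The quotient of the division of `f(0, y)` by `y`. -/
noncomputable def shiftY (A : Type u) [CommRing A] : PS₂ A →ₗ[A] PS₂ A where
  toFun f := fun d => if d 0 = 0 then MvPowerSeries.coeff (Finsupp.single 1 1 + d) f else 0
  map_add' f g := by
    ext d
    change (ite (d 0 = 0) _ _ : A) = (ite (d 0 = 0) _ _ : A) + (ite (d 0 = 0) _ _ : A)
    split_ifs <;> simp
  map_smul' a f := by
    ext d
    change ite (d 0 = 0) _ _ = a * ite (d 0 = 0) _ _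
    split_ifs <;> simp

theorem coeff_shiftX (d : Fin 2 →₀ ℕ) (f : PS₂ A) :
    MvPowerSeries.coeff d (shiftX A f) = MvPowerSeries.coeff (Finsupp.single 0 1 + d) f := rfl

theorem coeff_shiftY (d : Fin 2 →₀ ℕ) (f : PS₂ A) :
    MvPowerSeries.coeff d (shiftY A f) =
      if d 0 = 0 then MvPowerSeries.coeff (Finsupp.single 1 1 + d) f else 0 := rfl

theorem coeff_C_of_ne {d : Fin 2 →₀ ℕ} (h : d ≠ 0) (a : A) :
    MvPowerSeries.coeff d (MvPowerSeries.C a : PS₂ A) = 0 := by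
  classical
  rw [MvPowerSeries.coeff_C, if_neg h]

/-- Monomials divisible by x go to the second term and the remaining pure powers of y to the third.
This makes the quotients linear functions of f, so they can be applied to matrix identities. -/
theorem eq_C_add_shift (f : PS₂ A) :
    f = MvPowerSeries.C (MvPowerSeries.constantCoeff f) + MvPowerSeries.X 0 * shiftX A f +
      MvPowerSeries.X 1 * shiftY A f := by
  ext d
  by_cases h0 : d 0 = 0
  · by_cases h1 : d 1 = 0
    · obtain rfl := eq_zero_of_apply h0 h1
      simp
    · rw [map_add, map_add, coeff_C_of_ne (by rintro rfl; simp at h1), coeff_X_mul_of_eq_zero h0]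
      obtain ⟨e, rfl⟩ := exists_eq_single_add h1
      rw [coeff_single_add_X_mul, coeff_shiftY, if_pos (by simpa using h0)]
      simp
  · rw [map_add, map_add, coeff_C_of_ne (by rintro rfl; simp at h0)]
    obtain ⟨e, rfl⟩ := exists_eq_single_add h0
    rw [coeff_single_add_X_mul, coeff_shiftX]
    by_cases h1 : e 1 = 0
    · rw [coeff_X_mul_of_eq_zero (by simpa using h1)]; simp
    · obtain ⟨e, rfl⟩ := exists_eq_single_add h1
      rw [add_left_comm, coeff_single_add_X_mul, coeff_shiftY, if_neg (by simp)]
      simp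

@[simp] theorem shiftX_X_zero_mul (f : PS₂ A) : shiftX A (MvPowerSeries.X 0 * f) = f := by
  ext d; rw [coeff_shiftX, coeff_single_add_X_mul]

@[simp] theorem shiftX_X_one_mul (f : PS₂ A) :
    shiftX A (MvPowerSeries.X 1 * f) = MvPowerSeries.X 1 * shiftX A f := by
  ext d
  rw [coeff_shiftX]
  by_cases h : d 1 = 0
  · rw [coeff_X_mul_of_eq_zero (by simpa using h), coeff_X_mul_of_eq_zero h]
  · obtain ⟨e, rfl⟩ := exists_eq_single_add h
    rw [add_left_comm, coeff_single_add_X_mul, coeff_single_add_X_mul, coeff_shiftX]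

@[simp] theorem shiftY_X_zero_mul (f : PS₂ A) : shiftY A (MvPowerSeries.X 0 * f) = 0 := by
  ext d
  rw [coeff_shiftY]
  split_ifs with h
  · rw [coeff_X_mul_of_eq_zero (by simpa using h)]; simp
  · simp

-- The quotient by y ignores every monomial containing x, so only f(0, y) is recovered.
@[simp] theorem shiftY_X_one_mul (f : PS₂ A) :
    shiftY A (MvPowerSeries.X 1 * f) = f - MvPowerSeries.X 0 * shiftX A f := by
  ext d
  rw [coeff_shiftY, map_sub]
  split_ifs with h
  · rw [coeff_single_add_X_mul, coeff_X_mul_of_eq_zero h, sub_zero]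
  · obtain ⟨e, rfl⟩ := exists_eq_single_add h
    rw [coeff_single_add_X_mul, coeff_shiftX, sub_self]

-- Both quotients kill constants; for this reason a constant error is tolerated in
-- `exists_homotopy`.
@[simp] theorem shiftX_C (a : A) : shiftX A (MvPowerSeries.C a) = 0 := by
  ext d; rw [coeff_shiftX, coeff_C_of_ne (by intro h; simpa using DFunLike.congr_fun h 0)]; simp

@[simp] theorem shiftY_C (a : A) : shiftY A (MvPowerSeries.C a) = 0 := by
  ext d
  rw [coeff_shiftY, coeff_C_of_ne (by intro h; simpa using DFunLike.congr_fun h 1)]; simp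

theorem C_mul_eq_smul (a : A) (f : PS₂ A) : MvPowerSeries.C a * f = a • f :=
  (MvPowerSeries.smul_eq_C_mul f a).symm

@[simp] theorem shiftX_C_mul (a : A) (f : PS₂ A) :
    shiftX A (MvPowerSeries.C a * f) = MvPowerSeries.C a * shiftX A f := by
  rw [C_mul_eq_smul, C_mul_eq_smul, map_smul]

@[simp] theorem shiftY_C_mul (a : A) (f : PS₂ A) :
    shiftY A (MvPowerSeries.C a * f) = MvPowerSeries.C a * shiftY A f := by
  rw [C_mul_eq_smul, C_mul_eq_smul, map_smul]

@[simp] theorem shiftX_mul_C (a : A) (f : PS₂ A) :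
    shiftX A (f * MvPowerSeries.C a) = shiftX A f * MvPowerSeries.C a := by
  rw [mul_comm, shiftX_C_mul, mul_comm]

@[simp] theorem shiftY_mul_C (a : A) (f : PS₂ A) :
    shiftY A (f * MvPowerSeries.C a) = shiftY A f * MvPowerSeries.C a := by
  rw [mul_comm, shiftY_C_mul, mul_comm]

/-! ### Filtrations of `A[[x, y]]` -/

/-- The power series whose coefficients of total degree `d` lie in `𝔪 ^ E d`. -/
noncomputable def level (𝔪 : Ideal A) (E : ℕ → ℕ) : Submodule A (PS₂ A) where
  carrier := {f | ∀ d, MvPowerSeries.coeff d f ∈ 𝔪 ^ E d.degree}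
  add_mem' hf hg d := by rw [map_add]; exact add_mem (hf d) (hg d)
  zero_mem' d := by simp
  smul_mem' a f hf d := by rw [MvPowerSeries.coeff_smul]; exact Ideal.mul_mem_left _ _ (hf d)

variable {𝔪 : Ideal A} {E E' E'' : ℕ → ℕ}

theorem mem_level {f : PS₂ A} :
    f ∈ level 𝔪 E ↔ ∀ d, MvPowerSeries.coeff d f ∈ 𝔪 ^ E d.degree := Iff.rfl

theorem level_mono (h : ∀ d, E' d ≤ E d) : level 𝔪 E ≤ level 𝔪 E' :=
  fun _ hf d => Ideal.pow_le_pow_right (h _) (hf d)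

theorem mul_mem_level (h : ∀ i j, E'' (i + j) ≤ E i + E' j) {f g : PS₂ A}
    (hf : f ∈ level 𝔪 E) (hg : g ∈ level 𝔪 E') : f * g ∈ level 𝔪 E'' := by
  classical
  intro d
  rw [MvPowerSeries.coeff_mul]
  refine sum_mem fun p hp => ?_
  refine Ideal.pow_le_pow_right ?_ ((pow_add 𝔪 _ _).symm ▸ Ideal.mul_mem_mul (hf p.1) (hg p.2))
  rw [← Finset.HasAntidiagonal.mem_antidiagonal.1 hp, map_add]
  exact h _ _

theorem C_mem_level {a : A} (ha : a ∈ 𝔪 ^ E 0) : (MvPowerSeries.C a : PS₂ A) ∈ level 𝔪 E := by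
  intro d
  by_cases h : d = 0
  · subst h; simpa using ha
  · rw [coeff_C_of_ne h]; exact zero_mem _

theorem constantCoeff_mem {f : PS₂ A} (hf : f ∈ level 𝔪 E) :
    MvPowerSeries.constantCoeff f ∈ 𝔪 ^ E 0 := by
  simpa using hf 0

theorem shiftX_mem_level {f : PS₂ A} (hf : f ∈ level 𝔪 E) (h : ∀ d, E' d ≤ E (d + 1)) :
    shiftX A f ∈ level 𝔪 E' := by
  intro d
  rw [coeff_shiftX]
  refine Ideal.pow_le_pow_right ?_ (hf _)
  rw [map_add, Finsupp.degree_single, add_comm]; exact h _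

theorem shiftY_mem_level {f : PS₂ A} (hf : f ∈ level 𝔪 E) (h : ∀ d, E' d ≤ E (d + 1)) :
    shiftY A f ∈ level 𝔪 E' := by
  intro d
  rw [coeff_shiftY]
  split_ifs
  · refine Ideal.pow_le_pow_right ?_ (hf _)
    rw [map_add, Finsupp.degree_single, add_comm]; exact h _
  · exact zero_mem _

theorem X_mem_level (s : Fin 2) (h : E 1 = 0) : (MvPowerSeries.X s : PS₂ A) ∈ level 𝔪 E := by
  classical
  intro d
  rw [MvPowerSeries.coeff_X]
  split_ifs with hd
  · subst hd; simp [h]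
  · exact zero_mem _

end PS₂

/-! ### Weighted filtrations on matrices over A[[x, y]] -/

namespace PS₂

universe u
set_option linter.unusedSectionVars false

variable {A : Type u} [CommRing A]

/-- A filtration of `A[[x, y]]` by powers of an ideal `𝔪`: the coefficients of total degree `d` of
the elements of the `n`-th step lie in `𝔪 ^ e n d`. Division by a variable lowers the step
by `s`. -/
structure Weight where
  e : ℕ → ℕ → ℕ
  s : ℕ
  add_le : ∀ n n' i j, e (n + n') (i + j) ≤ e n i + e n' j
  -- One direction bounds the loss under division by a variable; at n = d = 0, together with `zero`,
  -- the equality puts x and y in step s.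
  shift : ∀ n d, e (n + s) (d + 1) = e n d
  zero : ∀ d, e 0 d = 0
  mono : ∀ n d, e n d ≤ e (n + 1) d
  unbounded : ∀ d N, ∃ n, N ≤ e n d
  -- A matrix congruent to 1 modulo step 1 then has constant term congruent to 1 modulo 𝔪, hence is
  -- invertible over a local ring.
  one : 1 ≤ e 1 0

/-- The `𝔪`-adic filtration. -/
def Weight.adic : Weight where
  e n _ := n
  s := 0
  add_le _ _ _ _ := le_rfl
  shift _ _ := rfl
  zero _ := rfl
  mono n _ := n.le_succ
  unbounded _ N := ⟨N, le_rfl⟩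
  one := le_rfl

/-- The filtration for which `x` and `y` have weight one and `𝔪` has weight two. -/
def Weight.double : Weight where
  -- The ceiling of (n - d) / 2, with truncated subtraction: a coefficient in 𝔪^j on a monomial of
  -- degree d has weight d + 2j.
  e n d := (n + 1 - d) / 2
  s := 1
  add_le n n' i j := by omega
  shift n d := by congr 1; omega
  zero d := by omega
  mono n d := by omega
  unbounded d N := ⟨d + 2 * N, by omega⟩
  one := by simp

theorem Weight.mono_le (w : Weight) {n n' : ℕ} (h : n ≤ n') (d : ℕ) : w.e n d ≤ w.e n' d :=
  monotone_nat_of_le_succ (f := fun n => w.e n d) (fun n => w.mono n d) h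

variable {m n l m' n' : Type*}

/-- The matrices with entries in the `k`-th step of a filtration. -/
noncomputable def fil (w : Weight) (𝔪 : Ideal A) (m n : Type*) (k : ℕ) :
    Submodule A (Matrix m n (PS₂ A)) where
  carrier := {M | ∀ i j, M i j ∈ level 𝔪 (w.e k)}
  add_mem' hM hN i j := add_mem (hM i j) (hN i j)
  zero_mem' _ _ := zero_mem _
  smul_mem' a _ hM i j := Submodule.smul_mem _ a (hM i j)

variable {w : Weight} {𝔪 : Ideal A} {k k' : ℕ}

theorem fil_anti (h : k' ≤ k) {M : Matrix m n (PS₂ A)} (hM : M ∈ fil w 𝔪 m n k) :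
    M ∈ fil w 𝔪 m n k' :=
  fun i j => level_mono (w.mono_le h) (hM i j)

theorem mul_mem_fil [Fintype n] {M : Matrix m n (PS₂ A)} {N : Matrix n l (PS₂ A)}
    (hM : M ∈ fil w 𝔪 m n k) (hN : N ∈ fil w 𝔪 n l k') : M * N ∈ fil w 𝔪 m l (k + k') := by
  intro i j
  rw [Matrix.mul_apply]
  exact sum_mem fun _ _ => mul_mem_level (fun a b => w.add_le _ _ a b) (hM _ _) (hN _ _)

theorem mem_fil_zero (M : Matrix m n (PS₂ A)) : M ∈ fil w 𝔪 m n 0 := fun i j d => by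
  simp [w.zero]

theorem mul_mem_fil_left [Fintype n] (M : Matrix m n (PS₂ A)) {N : Matrix n l (PS₂ A)}
    (hN : N ∈ fil w 𝔪 n l k) : M * N ∈ fil w 𝔪 m l k := by
  simpa using mul_mem_fil (mem_fil_zero M) hN

theorem mul_mem_fil_right [Fintype n] {M : Matrix m n (PS₂ A)} (N : Matrix n l (PS₂ A))
    (hM : M ∈ fil w 𝔪 m n k) : M * N ∈ fil w 𝔪 m l k := by
  simpa using mul_mem_fil hM (mem_fil_zero N)

theorem transpose_mem_fil {M : Matrix m n (PS₂ A)} (hM : M ∈ fil w 𝔪 m n k) :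
    Mᵀ ∈ fil w 𝔪 n m k := fun i j => hM j i

theorem fromBlocks_mem_fil {a : Matrix m n (PS₂ A)} {b : Matrix m n' (PS₂ A)}
    {c : Matrix m' n (PS₂ A)} {d : Matrix m' n' (PS₂ A)} :
    fromBlocks a b c d ∈ fil w 𝔪 (m ⊕ m') (n ⊕ n') k ↔ a ∈ fil w 𝔪 m n k ∧
      b ∈ fil w 𝔪 m n' k ∧ c ∈ fil w 𝔪 m' n k ∧ d ∈ fil w 𝔪 m' n' k := by
  constructor
  · intro h
    exact ⟨fun i j => h (.inl i) (.inl j), fun i j => h (.inl i) (.inr j),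
      fun i j => h (.inr i) (.inl j), fun i j => h (.inr i) (.inr j)⟩
  · rintro ⟨ha, hb, hc, hd⟩ (i | i) (j | j)
    exacts [ha i j, hb i j, hc i j, hd i j]

theorem map_C_mem_fil {M : Matrix m n A} (hM : ∀ i j, M i j ∈ 𝔪 ^ w.e k 0) :
    M.map (MvPowerSeries.C : A →+* PS₂ A) ∈ fil w 𝔪 m n k :=
  fun i j => C_mem_level (hM i j)

theorem map_shiftX_mem_fil {M : Matrix m n (PS₂ A)} (hM : M ∈ fil w 𝔪 m n (k + w.s)) :
    M.map (shiftX A) ∈ fil w 𝔪 m n k :=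
  fun i j => shiftX_mem_level (hM i j) fun d => (w.shift k d).ge

theorem map_shiftY_mem_fil {M : Matrix m n (PS₂ A)} (hM : M ∈ fil w 𝔪 m n (k + w.s)) :
    M.map (shiftY A) ∈ fil w 𝔪 m n k :=
  fun i j => shiftY_mem_level (hM i j) fun d => (w.shift k d).ge

/-! ### The odd operator of `θ(0, 0)` -/

section Koszul

variable {I J : Type} [Fintype I] [Fintype J] [DecidableEq I] [DecidableEq J]

/-- The odd operator of the matrix factorization `θ(0, 0)`. -/
noncomputable def koszul (A : Type u) [CommRing A] (I J : Type) [DecidableEq I] [DecidableEq J] :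
    Matrix ((J ⊕ I) ⊕ (J ⊕ I)) ((J ⊕ I) ⊕ (J ⊕ I)) (PS₂ A) :=
  fromBlocks 0 (fromBlocks ((MvPowerSeries.X 1 : PS₂ A) • 1) 0 0 (-((MvPowerSeries.X 0 : PS₂ A) • 1)))
    (fromBlocks ((MvPowerSeries.X 0 : PS₂ A) • 1) 0 0 (-((MvPowerSeries.X 1 : PS₂ A) • 1))) 0

/-- The constant part of the odd operator of the matrix factorization `θ(P, Q)`. -/
noncomputable def perturbation (P : Matrix J I A) (Q : Matrix I J A) :
    Matrix ((J ⊕ I) ⊕ (J ⊕ I)) ((J ⊕ I) ⊕ (J ⊕ I)) (PS₂ A) :=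
  fromBlocks 0 (fromBlocks 0 (-P.map MvPowerSeries.C) (Q.map MvPowerSeries.C) 0)
    (fromBlocks 0 (-P.map MvPowerSeries.C) (Q.map MvPowerSeries.C) 0) 0

theorem koszul_mul_koszul : koszul A I J * koszul A I J = PS₂.xy A • 1 := by
  simp only [koszul, fromBlocks_multiply, ← fromBlocks_one, fromBlocks_smul]
  simp [smul_smul, mul_comm]

/-- The signs of the graded tensor product are arranged for this cancellation, which gives (K + C)²
= xy + C². -/
theorem koszul_mul_perturbation (P : Matrix J I A) (Q : Matrix I J A) :
    koszul A I J * perturbation P Q + perturbation P Q * koszul A I J = 0 := by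
  simp [koszul, perturbation, fromBlocks_multiply, fromBlocks_add]

theorem perturbation_add (P P' : Matrix J I A) (Q Q' : Matrix I J A) :
    perturbation (P + P') (Q + Q') = perturbation P Q + perturbation P' Q' := by
  simp [perturbation, fromBlocks_add, Matrix.map_add, add_comm]

theorem perturbation_zero : perturbation (0 : Matrix J I A) 0 = 0 := by
  simp [perturbation]

theorem perturbation_mem_fil {P : Matrix J I A} {Q : Matrix I J A}
    (hP : ∀ i j, P i j ∈ 𝔪 ^ w.e k 0) (hQ : ∀ i j, Q i j ∈ 𝔪 ^ w.e k 0) :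
    perturbation P Q ∈ fil w 𝔪 _ _ k := by
  simp only [perturbation, fromBlocks_mem_fil, zero_mem, neg_mem_iff, map_C_mem_fil hP,
    map_C_mem_fil hQ, and_self]

theorem koszul_mem_fil : koszul A I J ∈ fil w 𝔪 _ _ w.s := by
  have h (s : Fin 2) : (MvPowerSeries.X s : PS₂ A) ∈ level 𝔪 (w.e w.s) :=
    X_mem_level s (by simpa [w.zero] using w.shift 0 0)
  have h' (s : Fin 2) (I : Type) [DecidableEq I] :
      (MvPowerSeries.X s : PS₂ A) • (1 : Matrix I I (PS₂ A)) ∈ fil w 𝔪 I I w.s := by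
    intro i j
    rw [Matrix.smul_apply, Matrix.one_apply]
    split_ifs
    · simpa using h s
    · simp
  simp only [koszul, fromBlocks_mem_fil, zero_mem, neg_mem_iff, h', and_self]

/-- Up to homotopy, an odd operator that anticommutes with the operator of `θ(0, 0)` is constant. -/
theorem exists_homotopy {φ ψ : Matrix (J ⊕ I) (J ⊕ I) (PS₂ A)} {n : ℕ}
    (hE : fromBlocks 0 ψ φ 0 ∈ fil w 𝔪 _ _ (n + w.s))
    (Z : Matrix ((J ⊕ I) ⊕ (J ⊕ I)) ((J ⊕ I) ⊕ (J ⊕ I)) A)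
    (h : koszul A I J * fromBlocks 0 ψ φ 0 + fromBlocks 0 ψ φ 0 * koszul A I J +
      Z.map (MvPowerSeries.C : A →+* PS₂ A) ∈ fil w 𝔪 _ _ (n + 1 + w.s + w.s)) :
    ∃ (P : Matrix J I A) (Q : Matrix I J A) (σ τ : Matrix (J ⊕ I) (J ⊕ I) (PS₂ A)),
      (∀ i j, P i j ∈ 𝔪 ^ w.e (n + w.s) 0) ∧ (∀ i j, Q i j ∈ 𝔪 ^ w.e (n + w.s) 0) ∧
      fromBlocks σ 0 0 τ ∈ fil w 𝔪 _ _ n ∧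
      fromBlocks 0 ψ φ 0 - perturbation P Q - (koszul A I J * fromBlocks σ 0 0 τ -
        fromBlocks σ 0 0 τ * koszul A I J) ∈ fil w 𝔪 _ _ (n + 1 + w.s) := by
  obtain ⟨a, b, c, d, rfl⟩ : ∃ a b c d, φ = fromBlocks a b c d :=
    ⟨_, _, _, _, (fromBlocks_toBlocks φ).symm⟩
  obtain ⟨a', b', c', d', rfl⟩ : ∃ a b c d, ψ = fromBlocks a b c d :=
    ⟨_, _, _, _, (fromBlocks_toBlocks ψ).symm⟩
  simp only [fromBlocks_mem_fil, zero_mem, true_and, and_true] at hE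
  obtain ⟨⟨ha', hb', hc', hd'⟩, ha, hb, hc, hd⟩ := hE
  -- Four of the eight blocks of the anticommutator suffice. Up to the constant Z they are y a + x
  -- a', x (b' - b), x (c' - c) and -(x d + y d').
  have e₁ := fun i j => h (.inl (.inl i)) (.inl (.inl j))
  have e₂ := fun i j => h (.inr (.inl i)) (.inr (.inr j))
  have e₃ := fun i j => h (.inl (.inr i)) (.inl (.inl j))
  have e₄ := fun i j => h (.inl (.inr i)) (.inl (.inr j))
  simp [koszul, fromBlocks_multiply, fromBlocks_add] at e₁ e₂ e₃ e₄
  have hX {f : PS₂ A} (hf : f ∈ level 𝔪 (w.e (n + 1 + w.s + w.s))) :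
      shiftX A f ∈ level 𝔪 (w.e (n + 1 + w.s)) := shiftX_mem_level hf fun d => (w.shift _ d).ge
  have hY {f : PS₂ A} (hf : f ∈ level 𝔪 (w.e (n + 1 + w.s + w.s))) :
      shiftY A f ∈ level 𝔪 (w.e (n + 1 + w.s)) := shiftY_mem_level hf fun d => (w.shift _ d).ge
  -- The constant terms of b and c survive every division and form P and Q. All other terms are
  -- divisible by x or y, up to the error controlled by the four blocks, and the quotients are the
  -- entries of the homotopy. Each division costs s steps and removes Z.
  refine ⟨-b.map MvPowerSeries.constantCoeff, c.map MvPowerSeries.constantCoeff,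
    fromBlocks (a.map (shiftX A)) (b.map (shiftX A)) (-c.map (shiftY A)) 0,
    fromBlocks 0 (b.map (shiftY A)) (-c.map (shiftX A)) (-d'.map (shiftX A)), ?_, ?_, ?_, ?_⟩
  · intro i j; simpa using constantCoeff_mem (hb i j)
  · intro i j; simpa using constantCoeff_mem (hc i j)
  · simp only [fromBlocks_mem_fil, zero_mem, neg_mem_iff, map_shiftX_mem_fil ha,
      map_shiftX_mem_fil hb, map_shiftX_mem_fil hc, map_shiftY_mem_fil hb,
      map_shiftY_mem_fil hc, map_shiftX_mem_fil hd', and_self]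
  · simp only [koszul, perturbation, fromBlocks_multiply, sub_eq_add_neg, fromBlocks_neg,
      fromBlocks_add, fromBlocks_mem_fil]
    simp only [fromBlocks_neg, fromBlocks_add, fromBlocks_mem_fil, Matrix.mul_zero,
      Matrix.zero_mul, zero_mem, true_and, and_true, add_zero, zero_add, neg_zero]
    refine ⟨⟨fun i j => ?_, fun i j => ?_, fun i j => ?_, fun i j => ?_⟩,
      fun i j => ?_, fun i j => ?_, fun i j => ?_, fun i j => ?_⟩
    · convert hX (e₁ i j) using 1
      simp [add_comm]
    · convert hX (e₂ i j) using 1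
      simp
      linear_combination eq_C_add_shift (b i j)
    · convert hX (e₃ i j) using 1
      simp
      linear_combination eq_C_add_shift (c i j)
    · convert neg_mem (hY (e₄ i j)) using 1
      simp [sub_eq_add_neg]
    · convert hY (e₁ i j) using 1
      simp [sub_eq_add_neg]
    · convert zero_mem (level 𝔪 (w.e (n + 1 + w.s))) using 1
      simp
      linear_combination eq_C_add_shift (b i j)
    · convert zero_mem (level 𝔪 (w.e (n + 1 + w.s))) using 1
      simp
      linear_combination eq_C_add_shift (c i j)
    · convert neg_mem (hX (e₄ i j)) using 1
      simp [add_comm]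

end Koszul

end PS₂

namespace PS₂

universe u
set_option linter.unusedSectionVars false

variable {A : Type u} [CommRing A] {w : Weight} {𝔪 : Ideal A}
variable {m n l : Type*}

/-! ### Completeness -/

/-- The rate E is not the identity, so completeness is applied to a subsequence `ν N` along which E
has reached N. Comparing both sequences through the telescoped differences transfers the bound to
every term. -/
theorem exists_adic_limit [IsAdicComplete 𝔪 A] {E : ℕ → ℕ} (hE : Monotone E)
    (hE' : ∀ N, ∃ n, N ≤ E n) {c : ℕ → A} (hc : ∀ n, c (n + 1) - c n ∈ 𝔪 ^ E n) :
    ∃ L, ∀ n, L - c n ∈ 𝔪 ^ E n := by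
  have hle : ∀ n n', n ≤ n' → c n' - c n ∈ 𝔪 ^ E n := by
    intro n n' h
    induction n', h using Nat.le_induction with
    | base => simp
    | succ k hk ih =>
      rw [← sub_add_sub_cancel (c (k + 1)) (c k)]
      exact add_mem (Ideal.pow_le_pow_right (hE hk) (hc k)) ih
  choose ν hν using hE'
  have hmin : ∀ N n, N ≤ E n → c (ν N) - c n ∈ 𝔪 ^ N := by
    intro N n hn
    rcases le_total n (ν N) with h | h
    · exact Ideal.pow_le_pow_right hn (hle _ _ h)
    · rw [← neg_mem_iff, neg_sub]
      exact Ideal.pow_le_pow_right (hν N) (hle _ _ h)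
  obtain ⟨L, hL⟩ := IsPrecomplete.prec (I := 𝔪) (M := A) inferInstance (f := fun N => c (ν N))
    (fun {N N'} h => by
      rw [SModEq.sub_mem, smul_eq_mul, Ideal.mul_top]
      exact hmin N _ (h.trans (hν N')))
  refine ⟨L, fun n => ?_⟩
  have h := hL (E n)
  rw [SModEq.sub_mem, smul_eq_mul, Ideal.mul_top] at h
  have := hmin (E n) n le_rfl
  convert sub_mem this h using 1
  ring

theorem exists_fil_limit [IsAdicComplete 𝔪 A] {F : ℕ → Matrix m n (PS₂ A)}
    (hF : ∀ k, F (k + 1) - F k ∈ fil w 𝔪 m n (k + 1)) :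
    ∃ L, ∀ k, L - F k ∈ fil w 𝔪 m n (k + 1) := by
  have (i : m) (j : n) (d : Fin 2 →₀ ℕ) := exists_adic_limit (𝔪 := 𝔪)
    (E := fun k => w.e (k + 1) d.degree)
    (fun _ _ h => w.mono_le (Nat.succ_le_succ h) _)
    (fun N => (w.unbounded d.degree N).imp fun k hk => hk.trans (w.mono _ _))
    (c := fun k => MvPowerSeries.coeff d (F k i j))
    (fun k => by simpa using hF k i j d)
  choose L hL using this
  exact ⟨fun i j d => L i j d, fun k i j d => hL i j d k⟩

theorem exists_matrix_limit [IsAdicComplete 𝔪 A] {F : ℕ → Matrix m n A} (s : ℕ)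
    (hF : ∀ k i j, (F (k + 1) - F k) i j ∈ 𝔪 ^ w.e (k + 1 + s) 0) :
    ∃ L : Matrix m n A, ∀ k i j, (L - F k) i j ∈ 𝔪 ^ w.e (k + 1 + s) 0 := by
  have (i : m) (j : n) := exists_adic_limit (𝔪 := 𝔪)
    (E := fun k => w.e (k + 1 + s) 0)
    (fun _ _ h => w.mono_le (by omega) _)
    (fun N => (w.unbounded 0 N).imp fun k hk => hk.trans (w.mono_le (by omega) _))
    (c := fun k => F k i j)
    (fun k => by simpa using hF k i j)
  choose L hL using this
  exact ⟨fun i j => L i j, fun k i j => hL i j k⟩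

/-- In each fixed degree the exponents of the filtration are unbounded, so every coefficient lies in
all powers of 𝔪. -/
theorem eq_zero_of_mem_fil [IsHausdorff 𝔪 A] {M : Matrix m n (PS₂ A)}
    (h : ∀ k, 1 ≤ k → M ∈ fil w 𝔪 m n k) : M = 0 := by
  ext i j d
  refine IsHausdorff.haus (I := 𝔪) inferInstance _ fun N => ?_
  obtain ⟨k, hk⟩ := w.unbounded d.degree N
  rw [SModEq.zero, smul_eq_mul, Ideal.mul_top]
  exact Ideal.pow_le_pow_right (hk.trans (w.mono k _)) (h (k + 1) (by omega) i j d)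

/-! ### Gauge transformations -/

section Gauge

variable {I J : Type} [Fintype I] [Fintype J] [DecidableEq I] [DecidableEq J]

/-- An even operator together with matrices `P` and `Q` over `A`. -/
structure Gauge (A : Type u) [CommRing A] (I J : Type) where
  σ : Matrix (J ⊕ I) (J ⊕ I) (PS₂ A)
  τ : Matrix (J ⊕ I) (J ⊕ I) (PS₂ A)
  P : Matrix J I A
  Q : Matrix I J A

/-- The even operator of a gauge. -/
def Gauge.F (d : Gauge A I J) : Matrix ((J ⊕ I) ⊕ (J ⊕ I)) ((J ⊕ I) ⊕ (J ⊕ I)) (PS₂ A) :=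
  fromBlocks d.σ 0 0 d.τ

/-- The odd constant operator of a gauge. -/
noncomputable def Gauge.C (d : Gauge A I J) :
    Matrix ((J ⊕ I) ⊕ (J ⊕ I)) ((J ⊕ I) ⊕ (J ⊕ I)) (PS₂ A) :=
  perturbation d.P d.Q

/-- The sum of two gauges. -/
noncomputable def Gauge.add (d d' : Gauge A I J) : Gauge A I J :=
  ⟨d.σ + d'.σ, d.τ + d'.τ, d.P + d'.P, d.Q + d'.Q⟩

theorem Gauge.add_F (d d' : Gauge A I J) : (d.add d').F = d.F + d'.F := by
  simp [Gauge.F, Gauge.add, fromBlocks_add]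

theorem Gauge.add_C (d d' : Gauge A I J) : (d.add d').C = d.C + d'.C :=
  perturbation_add _ _ _ _

/-- The operator of `d` lies in the `n`-th step and the constants in the `(n + s)`-th. -/
structure Gauge.IsSmall (w : Weight) (𝔪 : Ideal A) (n : ℕ) (d : Gauge A I J) : Prop where
  F : d.F ∈ fil w 𝔪 _ _ n
  P : ∀ i j, d.P i j ∈ 𝔪 ^ w.e (n + w.s) 0
  Q : ∀ i j, d.Q i j ∈ 𝔪 ^ w.e (n + w.s) 0

theorem Gauge.IsSmall.C {d : Gauge A I J} {n : ℕ} (h : d.IsSmall w 𝔪 n) :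
    d.C ∈ fil w 𝔪 _ _ (n + w.s) :=
  perturbation_mem_fil h.P h.Q

/-- Successive approximation of gauges. -/
theorem Gauge.exists_limit [IsAdicComplete 𝔪 A] {Good : ℕ → Gauge A I J → Prop}
    (h₁ : ∃ d, Good 1 d)
    (hstep : ∀ n, 1 ≤ n → ∀ d, Good n d → ∃ d', d'.IsSmall w 𝔪 n ∧ Good (n + 1) (d.add d')) :
    ∃ L : Gauge A I J, ∀ n, 1 ≤ n → ∃ d d' : Gauge A I J, Good n d ∧ d'.IsSmall w 𝔪 n ∧
      L = d.add d' := by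
  obtain ⟨d₁, hd₁⟩ := h₁
  choose! next hsmall hgood using hstep
  -- The term `seq k` satisfies `Good (k + 1)`: the count starts at 1 because step 0 of the
  -- filtration is everything.
  let seq : ℕ → Gauge A I J := fun n => Nat.rec d₁ (fun k d => d.add (next (k + 1) d)) n
  have hseq : ∀ k, Good (k + 1) (seq k) := by
    intro k
    induction k with
    | zero => exact hd₁
    | succ k ih => exact hgood _ (by omega) _ ih
  have hs : ∀ k, (next (k + 1) (seq k)).IsSmall w 𝔪 (k + 1) :=
    fun k => hsmall _ (by omega) _ (hseq k)
  have hF := fun k => fromBlocks_mem_fil.1 (hs k).F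
  obtain ⟨σ, hσ⟩ := exists_fil_limit (w := w) (𝔪 := 𝔪) (F := fun k => (seq k).σ) fun k => by
    have := (hF k).1
    rwa [← add_sub_cancel_left (seq k).σ (next (k + 1) (seq k)).σ] at this
  obtain ⟨τ, hτ⟩ := exists_fil_limit (w := w) (𝔪 := 𝔪) (F := fun k => (seq k).τ) fun k => by
    have := (hF k).2.2.2
    rwa [← add_sub_cancel_left (seq k).τ (next (k + 1) (seq k)).τ] at this
  obtain ⟨P, hP⟩ := exists_matrix_limit (w := w) (𝔪 := 𝔪) (F := fun k => (seq k).P) w.s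
    fun k => by
    have := (hs k).P
    rwa [← add_sub_cancel_left (seq k).P (next (k + 1) (seq k)).P] at this
  obtain ⟨Q, hQ⟩ := exists_matrix_limit (w := w) (𝔪 := 𝔪) (F := fun k => (seq k).Q) w.s
    fun k => by
    have := (hs k).Q
    rwa [← add_sub_cancel_left (seq k).Q (next (k + 1) (seq k)).Q] at this
  -- The limit is delivered, for each n, as an approximation plus a small remainder. Exact
  -- identities follow by bounding their defect in every step, without any continuity argument.
  refine ⟨⟨σ, τ, P, Q⟩, fun n hn => ?_⟩
  obtain ⟨k, rfl⟩ : ∃ k, n = k + 1 := ⟨n - 1, by omega⟩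
  refine ⟨seq k, ⟨σ - (seq k).σ, τ - (seq k).τ, P - (seq k).P, Q - (seq k).Q⟩, hseq k,
    ⟨?_, hP k, hQ k⟩, ?_⟩
  · simp only [Gauge.F, fromBlocks_mem_fil, zero_mem, hσ k, hτ k, and_self]
  · simp [Gauge.add]

/-- Up to terms of step `n + s`, the operator of `d` transforms `D` into the operator
of `θ(P, Q)`. -/
structure Gauge.Approx (w : Weight) (𝔪 : Ideal A)
    (D : Matrix ((J ⊕ I) ⊕ (J ⊕ I)) ((J ⊕ I) ⊕ (J ⊕ I)) (PS₂ A)) (n : ℕ) (d : Gauge A I J) :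
    Prop where
  F : d.F - 1 ∈ fil w 𝔪 _ _ 1
  P : ∀ i j, d.P i j ∈ 𝔪 ^ w.e (1 + w.s) 0
  Q : ∀ i j, d.Q i j ∈ 𝔪 ^ w.e (1 + w.s) 0
  residue : d.F * D - (koszul A I J + d.C) * d.F ∈ fil w 𝔪 _ _ (n + w.s)

theorem Gauge.Approx.C {D : Matrix ((J ⊕ I) ⊕ (J ⊕ I)) ((J ⊕ I) ⊕ (J ⊕ I)) (PS₂ A)} {n : ℕ}
    {d : Gauge A I J} (h : d.Approx w 𝔪 D n) : d.C ∈ fil w 𝔪 _ _ (1 + w.s) :=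
  perturbation_mem_fil h.P h.Q

theorem Gauge.approx_one {D : Matrix ((J ⊕ I) ⊕ (J ⊕ I)) ((J ⊕ I) ⊕ (J ⊕ I)) (PS₂ A)}
    (hD : D - koszul A I J ∈ fil w 𝔪 _ _ (1 + w.s)) :
    (⟨1, 1, 0, 0⟩ : Gauge A I J).Approx w 𝔪 D 1 := by
  refine ⟨?_, by simp, by simp, ?_⟩
  · simp [Gauge.F]
  · simpa [Gauge.F, Gauge.C, perturbation_zero] using hD

/-- This is the linearisation of F D = (K + C) F at F = 1, C = 0, D = K: the residue changes by -C'
- [K, F'] up to products of two small factors, each of which falls into the next step. -/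
theorem Gauge.Approx.add {D : Matrix ((J ⊕ I) ⊕ (J ⊕ I)) ((J ⊕ I) ⊕ (J ⊕ I)) (PS₂ A)}
    (hD : D - koszul A I J ∈ fil w 𝔪 _ _ (1 + w.s)) {n : ℕ} (hn : 1 ≤ n) {d d' : Gauge A I J}
    (h : d.Approx w 𝔪 D n) (h' : d'.IsSmall w 𝔪 n)
    (hr : d.F * D - (koszul A I J + d.C) * d.F - d'.C -
      (koszul A I J * d'.F - d'.F * koszul A I J) ∈ fil w 𝔪 _ _ (n + 1 + w.s)) :
    (d.add d').Approx w 𝔪 D (n + 1) := by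
  refine ⟨?_, fun i j => ?_, fun i j => ?_, ?_⟩
  · rw [Gauge.add_F, add_sub_right_comm]
    exact add_mem h.F (fil_anti hn h'.F)
  · exact add_mem (h.P i j) (Ideal.pow_le_pow_right (w.mono_le (by omega) _) (h'.P i j))
  · exact add_mem (h.Q i j) (Ideal.pow_le_pow_right (w.mono_le (by omega) _) (h'.Q i j))
  · have e : (d.add d').F * D - (koszul A I J + (d.add d').C) * (d.add d').F =
        (d.F * D - (koszul A I J + d.C) * d.F - d'.C -
          (koszul A I J * d'.F - d'.F * koszul A I J)) + d'.F * (D - koszul A I J) - d.C * d'.F -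
          d'.C * (d.F - 1) - d'.C * d'.F := by
      rw [Gauge.add_F, Gauge.add_C]; noncomm_ring
    rw [e]
    refine sub_mem (sub_mem (sub_mem (add_mem hr ?_) ?_) ?_) ?_
    · exact fil_anti (by omega) (mul_mem_fil h'.F hD)
    · exact fil_anti (by omega) (mul_mem_fil h.C h'.F)
    · exact fil_anti (by omega) (mul_mem_fil h'.C h.F)
    · exact fil_anti (by omega) (mul_mem_fil h'.C h'.F)

end Gauge

end PS₂

/-! ### Isomorphisms with θ(P, Q), without forms -/

namespace PS₂

universe u
set_option linter.unusedSectionVars false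

variable {A : Type u} [CommRing A] {w : Weight}

theorem map_constantCoeff_map_C {m n : Type*} (Z : Matrix m n A) :
    (Z.map (MvPowerSeries.C : A →+* PS₂ A)).map (MvPowerSeries.constantCoeff : PS₂ A →+* A) = Z := by
  ext; simp

/-- Square matrices congruent to the identity modulo the maximal ideal are invertible. -/
theorem isUnit_of_sub_one_mem [IsLocalRing A] {m : Type*} [Fintype m] [DecidableEq m]
    {M : Matrix m m A} (h : ∀ i j, (M - 1) i j ∈ IsLocalRing.maximalIdeal A) : IsUnit M := by
  have hM : (IsLocalRing.residue A).mapMatrix M = 1 := by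
    ext i j
    have := (IsLocalRing.residue_eq_zero_iff _).2 (h i j)
    rw [Matrix.sub_apply, map_sub, sub_eq_zero] at this
    rw [RingHom.mapMatrix_apply, Matrix.map_apply, this, Matrix.one_apply, Matrix.one_apply]
    split_ifs <;> simp
  rw [Matrix.isUnit_iff_isUnit_det]
  apply isUnit_of_map_unit (IsLocalRing.residue A)
  rw [RingHom.map_det, hM, Matrix.det_one]
  exact isUnit_one

section Gauge

variable {I J : Type} [Fintype I] [Fintype J] [DecidableEq I] [DecidableEq J]

theorem koszul_map_constantCoeff : (koszul A I J).map (MvPowerSeries.constantCoeff : PS₂ A →+* A) = 0 := by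
  ext ((i | i) | (i | i)) ((j | j) | (j | j)) <;> simp [koszul]

theorem Gauge.odd_residue (d : Gauge A I J) (φ ψ : Matrix (J ⊕ I) (J ⊕ I) (PS₂ A)) :
    ∃ φ' ψ', d.F * fromBlocks 0 ψ φ 0 - (koszul A I J + d.C) * d.F = fromBlocks 0 ψ' φ' 0 := by
  simp only [Gauge.F, Gauge.C, koszul, perturbation, fromBlocks_multiply, fromBlocks_add,
    sub_eq_add_neg, fromBlocks_neg, Matrix.mul_zero, Matrix.zero_mul, add_zero, zero_add, neg_zero]
  exact ⟨_, _, rfl⟩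

theorem perturbation_eq_map (P : Matrix J I A) (Q : Matrix I J A) :
    perturbation P Q = (fromBlocks 0 (fromBlocks 0 (-P) Q 0) (fromBlocks 0 (-P) Q 0) 0).map
      (MvPowerSeries.C : A →+* PS₂ A) := by
  ext ((i | i) | (i | i)) ((j | j) | (j | j)) <;> simp [perturbation]

/-- The residue of an approximate gauge is constant up to homotopy. -/
theorem Gauge.Approx.exists_next [IsLocalRing A] {φ ψ : Matrix (J ⊕ I) (J ⊕ I) (PS₂ A)} {π : A}
    (hD : fromBlocks 0 ψ φ 0 - koszul A I J ∈ fil w (IsLocalRing.maximalIdeal A) _ _ (1 + w.s))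
    (hD₂ : fromBlocks 0 ψ φ 0 * fromBlocks 0 ψ φ 0 = (PS₂.xy A - MvPowerSeries.C π) •
      (1 : Matrix ((J ⊕ I) ⊕ (J ⊕ I)) ((J ⊕ I) ⊕ (J ⊕ I)) (PS₂ A)))
    {n : ℕ} {d : Gauge A I J}
    (h : d.Approx w (IsLocalRing.maximalIdeal A) (fromBlocks 0 ψ φ 0) n) :
    ∃ d' : Gauge A I J, d'.IsSmall w (IsLocalRing.maximalIdeal A) n ∧
      d.F * fromBlocks 0 ψ φ 0 - (koszul A I J + d.C) * d.F - d'.C -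
        (koszul A I J * d'.F - d'.F * koszul A I J) ∈
          fil w (IsLocalRing.maximalIdeal A) _ _ (n + 1 + w.s) := by
  set 𝔪 := IsLocalRing.maximalIdeal A
  set D : Matrix ((J ⊕ I) ⊕ (J ⊕ I)) ((J ⊕ I) ⊕ (J ⊕ I)) (PS₂ A) := fromBlocks 0 ψ φ 0 with hDdef
  obtain ⟨φ', ψ', he⟩ := d.odd_residue φ ψ
  rw [← hDdef] at he
  set E := d.F * D - (koszul A I J + d.C) * d.F with hE
  have hEmem : E ∈ fil w 𝔪 _ _ (n + w.s) := h.residue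
  -- The constant Z = π + C² measures how far the current (P, Q) is from factoring π.
  obtain ⟨Z, hZ⟩ : ∃ Z : Matrix ((J ⊕ I) ⊕ (J ⊕ I)) ((J ⊕ I) ⊕ (J ⊕ I)) A,
      Z.map (MvPowerSeries.C : A →+* PS₂ A) = (MvPowerSeries.C π : PS₂ A) • 1 + d.C * d.C := by
    refine ⟨π • 1 + fromBlocks 0 (fromBlocks 0 (-d.P) d.Q 0) (fromBlocks 0 (-d.P) d.Q 0) 0 *
      fromBlocks 0 (fromBlocks 0 (-d.P) d.Q 0) (fromBlocks 0 (-d.P) d.Q 0) 0, ?_⟩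
    rw [Matrix.map_add _ (map_add _), Matrix.map_mul, Gauge.C, perturbation_eq_map]
    congr 1
    ext i j
    by_cases hij : i = j <;> simp [hij]
  have hK := koszul_mul_koszul (A := A) (I := I) (J := J)
  have hC := koszul_mul_perturbation d.P d.Q
  -- Only D² = xy - π, K² = xy and KC + CK = 0 enter; the right-hand side consists of products of
  -- two small factors.
  have key : koszul A I J * E + E * koszul A I J + Z.map (MvPowerSeries.C : A →+* PS₂ A) * d.F =
      -(E * (D - koszul A I J) + d.C * E) := by
    have e : koszul A I J * E + E * koszul A I J + (E * (D - koszul A I J) + d.C * E) =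
        d.F * (D * D) - (koszul A I J * koszul A I J +
          (koszul A I J * perturbation d.P d.Q + perturbation d.P d.Q * koszul A I J) +
          d.C * d.C) * d.F := by
      rw [hE, Gauge.C]; noncomm_ring
    rw [hK, hC, hD₂] at e
    rw [eq_neg_iff_add_eq_zero, add_right_comm, e, hZ]
    simp only [sub_smul, Matrix.mul_sub, Matrix.mul_smul, Matrix.mul_one, Matrix.add_mul,
      Matrix.smul_mul, Matrix.one_mul, add_zero]
    abel
  have hsmall : E * (D - koszul A I J) + d.C * E ∈ fil w 𝔪 _ _ (n + 1 + w.s + w.s) :=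
    add_mem (fil_anti (by omega) (mul_mem_fil hEmem hD))
      (fil_anti (by omega) (mul_mem_fil h.C hEmem))
  -- At the origin K vanishes and `key` reduces to Z times the constant term of F. The latter is
  -- invertible, so Z is as small as the right-hand side.
  have hZmem : ∀ i j, Z i j ∈ 𝔪 ^ w.e (n + 1 + w.s + w.s) 0 := by
    have hu : IsUnit (d.F.map (MvPowerSeries.constantCoeff : PS₂ A →+* A)) := by
      apply isUnit_of_sub_one_mem
      intro i j
      have := Ideal.pow_le_self (by have := w.one; omega) (constantCoeff_mem (h.F i j))
      rw [Matrix.sub_apply, map_sub] at this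
      convert this using 1
      rcases eq_or_ne i j with rfl | hij
      · rw [Matrix.sub_apply, Matrix.one_apply_eq, Matrix.map_apply, Matrix.one_apply_eq, map_one]
      · rw [Matrix.sub_apply, Matrix.one_apply_ne hij, Matrix.map_apply, Matrix.one_apply_ne hij,
          map_zero]
    obtain ⟨⟨U, V, hUV, -⟩, rfl : U = _⟩ := hu
    have e := congrArg (fun M => M.map (MvPowerSeries.constantCoeff : PS₂ A →+* A)) key
    simp only [Matrix.map_add _ (map_add (MvPowerSeries.constantCoeff : PS₂ A →+* A)),
      Matrix.map_mul, koszul_map_constantCoeff, Matrix.zero_mul, Matrix.mul_zero, zero_add,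
      map_constantCoeff_map_C] at e
    have e' := congrArg (· * V) e
    simp only [Matrix.mul_assoc, hUV, Matrix.mul_one] at e'
    rw [e']
    intro i j
    rw [Matrix.mul_apply]
    exact sum_mem fun a _ => Ideal.mul_mem_right _ _ (constantCoeff_mem (neg_mem hsmall i a))
  rw [he] at hEmem ⊢
  obtain ⟨P, Q, σ, τ, hP, hQ, hH, hr⟩ := exists_homotopy hEmem Z (by
    rw [← he]
    -- Replacing Z F by Z costs Z (F - 1), which is harmless now that Z is known to be small.
    have e : koszul A I J * E + E * koszul A I J + Z.map (MvPowerSeries.C : A →+* PS₂ A) =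
        -(E * (D - koszul A I J) + d.C * E) - Z.map (MvPowerSeries.C : A →+* PS₂ A) * (d.F - 1) := by
      rw [← key]; noncomm_ring
    rw [e]
    exact sub_mem (neg_mem hsmall) (mul_mem_fil_right _ (map_C_mem_fil hZmem)))
  exact ⟨⟨σ, τ, P, Q⟩, ⟨hH, hP, hQ⟩, hr⟩

/-- A matrix factorization of `xy - π` close to `θ(0, 0)` is isomorphic to some `θ(P, Q)`. -/
theorem exists_gauge [IsLocalRing A] [IsAdicComplete (IsLocalRing.maximalIdeal A) A]
    {φ ψ : Matrix (J ⊕ I) (J ⊕ I) (PS₂ A)} {π : A}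
    (hD : fromBlocks 0 ψ φ 0 - koszul A I J ∈ fil w (IsLocalRing.maximalIdeal A) _ _ (1 + w.s))
    (hD₂ : fromBlocks 0 ψ φ 0 * fromBlocks 0 ψ φ 0 = (PS₂.xy A - MvPowerSeries.C π) •
      (1 : Matrix ((J ⊕ I) ⊕ (J ⊕ I)) ((J ⊕ I) ⊕ (J ⊕ I)) (PS₂ A))) :
    ∃ d : Gauge A I J, d.F - 1 ∈ fil w (IsLocalRing.maximalIdeal A) _ _ 1 ∧
      (∀ i j, d.P i j ∈ IsLocalRing.maximalIdeal A ^ w.e (1 + w.s) 0) ∧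
      (∀ i j, d.Q i j ∈ IsLocalRing.maximalIdeal A ^ w.e (1 + w.s) 0) ∧
      d.F * fromBlocks 0 ψ φ 0 = (koszul A I J + d.C) * d.F := by
  set 𝔪 := IsLocalRing.maximalIdeal A
  set D : Matrix ((J ⊕ I) ⊕ (J ⊕ I)) ((J ⊕ I) ⊕ (J ⊕ I)) (PS₂ A) := fromBlocks 0 ψ φ 0
  obtain ⟨L, hL⟩ := Gauge.exists_limit (w := w) (𝔪 := 𝔪) (Good := fun n d => d.Approx w 𝔪 D n)
    ⟨_, Gauge.approx_one hD⟩ (fun n hn d h => by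
      obtain ⟨d', hd', hr⟩ := h.exists_next hD hD₂
      exact ⟨d', hd', h.add hD hn hd' hr⟩)
  obtain ⟨d, d', h, h', rfl⟩ := hL 1 le_rfl
  refine ⟨d.add d', ?_, fun i j => add_mem (h.P i j) (h'.P i j), fun i j => add_mem (h.Q i j) (h'.Q i j),
    ?_⟩
  · rw [Gauge.add_F, add_sub_right_comm]
    exact add_mem h.F h'.F
  · rw [← sub_eq_zero]
    refine eq_zero_of_mem_fil (w := w) (𝔪 := 𝔪) fun n hn => ?_
    obtain ⟨c, c', h, h', e⟩ := hL n hn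
    rw [e, Gauge.add_F, Gauge.add_C]
    have e' : (c.F + c'.F) * D - (koszul A I J + (c.C + c'.C)) * (c.F + c'.F) =
        (c.F * D - (koszul A I J + c.C) * c.F) + c'.F * D - (koszul A I J + c.C) * c'.F -
          c'.C * (c.F + c'.F) := by noncomm_ring
    rw [e']
    exact sub_mem (sub_mem (add_mem (fil_anti (by omega) h.residue)
      (mul_mem_fil_right _ h'.F)) (mul_mem_fil_left _ h'.F))
      (mul_mem_fil_right _ (fil_anti (by omega) h'.C))

end Gauge

end PS₂

/-! ### Isomorphisms with θ(P, Q) compatible with an anti-involution -/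

namespace PS₂

universe u
set_option linter.unusedSectionVars false

variable {A : Type u} [CommRing A] {w : Weight}

section Gauge

variable {I J : Type} [Fintype I] [Fintype J] [DecidableEq I] [DecidableEq J]

/-- An anti-involution of the algebra of operators, for which the operator of `θ(0, 0)` is
self-adjoint or skew-adjoint. -/
structure AntiInvolution (w : Weight) (𝔪 : Ideal A) (I J : Type) [Fintype I] [Fintype J]
    [DecidableEq I] [DecidableEq J] (δ : A) where
  adj : Matrix ((J ⊕ I) ⊕ (J ⊕ I)) ((J ⊕ I) ⊕ (J ⊕ I)) (PS₂ A) →ₗ[A]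
    Matrix ((J ⊕ I) ⊕ (J ⊕ I)) ((J ⊕ I) ⊕ (J ⊕ I)) (PS₂ A)
  adj_one : adj 1 = 1
  adj_mul : ∀ X Y, adj (X * Y) = adj Y * adj X
  adj_adj : ∀ X, adj (adj X) = X
  adj_mem : ∀ n X, X ∈ fil w 𝔪 _ _ n → adj X ∈ fil w 𝔪 _ _ n
  adj_even : ∀ σ τ, ∃ σ' τ', adj (fromBlocks σ 0 0 τ) = fromBlocks σ' 0 0 τ'
  adj_perturbation : ∀ P Q, ∃ P' Q', adj (perturbation P Q) = perturbation P' Q'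
  -- The sign δ is -1 for forms on θ(P, Q) and 1 for twisted forms.
  adj_koszul : adj (koszul A I J) = δ • koszul A I J
  sq : δ * δ = 1

variable {𝔪 : Ideal A}

theorem Gauge.exists_even {X : Matrix ((J ⊕ I) ⊕ (J ⊕ I)) ((J ⊕ I) ⊕ (J ⊕ I)) (PS₂ A)}
    (hX : ∃ σ τ, X = fromBlocks σ 0 0 τ) {n : ℕ} (hn : X ∈ fil w 𝔪 _ _ n) :
    ∃ d : Gauge A I J, d.F = X ∧ d.C = 0 ∧ d.IsSmall w 𝔪 n := by
  obtain ⟨σ, τ, rfl⟩ := hX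
  exact ⟨⟨σ, τ, 0, 0⟩, rfl, perturbation_zero, hn, by simp, by simp⟩

theorem perturbation_smul (a : A) (P : Matrix J I A) (Q : Matrix I J A) :
    perturbation (a • P) (a • Q) = a • perturbation P Q := by
  ext ((i | i) | (i | i)) ((j | j) | (j | j)) <;>
    simp [perturbation, MvPowerSeries.smul_eq_C_mul]

theorem mem_of_perturbation_mem_fil {k : ℕ} {P : Matrix J I A} {Q : Matrix I J A}
    (h : perturbation P Q ∈ fil w 𝔪 _ _ k) :
    (∀ i j, P i j ∈ 𝔪 ^ w.e k 0) ∧ ∀ i j, Q i j ∈ 𝔪 ^ w.e k 0 := by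
  constructor
  · intro i j
    simpa [perturbation] using constantCoeff_mem (h (.inr (.inl i)) (.inl (.inr j)))
  · intro i j
    simpa [perturbation] using constantCoeff_mem (h (.inr (.inr i)) (.inl (.inl j)))

/-- Since K and D lie in step s, any correction of step n moves the residue only inside step n + s.
This serves for the unitary correction, which solves no linearised equation, and for the remainder
of the limit. -/
theorem Gauge.Approx.add_small
    {D : Matrix ((J ⊕ I) ⊕ (J ⊕ I)) ((J ⊕ I) ⊕ (J ⊕ I)) (PS₂ A)}
    (hD : D - koszul A I J ∈ fil w 𝔪 _ _ (1 + w.s)) {n : ℕ} (hn : 1 ≤ n) {d d' : Gauge A I J}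
    (h : d.Approx w 𝔪 D n) (h' : d'.IsSmall w 𝔪 n) : (d.add d').Approx w 𝔪 D n := by
  have hK : koszul A I J ∈ fil w 𝔪 _ _ w.s := koszul_mem_fil
  have hDs : D ∈ fil w 𝔪 _ _ w.s := by
    rw [← sub_add_cancel D (koszul A I J)]
    exact add_mem (fil_anti (by omega) hD) hK
  refine ⟨?_, fun i j => ?_, fun i j => ?_, ?_⟩
  · rw [Gauge.add_F, add_sub_right_comm]
    exact add_mem h.F (fil_anti hn h'.F)
  · exact add_mem (h.P i j) (Ideal.pow_le_pow_right (w.mono_le (by omega) _) (h'.P i j))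
  · exact add_mem (h.Q i j) (Ideal.pow_le_pow_right (w.mono_le (by omega) _) (h'.Q i j))
  · have e : (d.add d').F * D - (koszul A I J + (d.add d').C) * (d.add d').F =
        (d.F * D - (koszul A I J + d.C) * d.F) + d'.F * D - (koszul A I J + d.C) * d'.F -
          d'.C * (d.add d').F := by
      rw [Gauge.add_F, Gauge.add_C]; noncomm_ring
    rw [e]
    refine sub_mem (sub_mem (add_mem h.residue (mul_mem_fil h'.F hDs)) ?_)
      (mul_mem_fil_right _ h'.C)
    exact fil_anti (by omega) (mul_mem_fil (add_mem hK (fil_anti (by omega) h.C)) h'.F)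

/-- An approximate gauge which is approximately compatible with an anti-involution. -/
structure Gauge.UnitaryApprox {δ : A} (𝒜 : AntiInvolution w 𝔪 I J δ)
    (D T : Matrix ((J ⊕ I) ⊕ (J ⊕ I)) ((J ⊕ I) ⊕ (J ⊕ I)) (PS₂ A)) (n : ℕ) (d : Gauge A I J) :
    Prop where
  approx : d.Approx w 𝔪 D n
  unitary : 𝒜.adj d.F * d.F - T ∈ fil w 𝔪 _ _ n
  adj_C : 𝒜.adj d.C = δ • d.C

/-- A Newton step for F* F = T. With the self-adjoint correction H = (T - F* F) / 2 the new defect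
is (F - 1)* H + H (F - 1) + H², one step smaller. As H has no constant odd part, C is left alone. -/
theorem Gauge.UnitaryApprox.exists_unitary_add [Invertible (2 : A)] {δ : A}
    (𝒜 : AntiInvolution w 𝔪 I J δ)
    {D T : Matrix ((J ⊕ I) ⊕ (J ⊕ I)) ((J ⊕ I) ⊕ (J ⊕ I)) (PS₂ A)}
    (hD : D - koszul A I J ∈ fil w 𝔪 _ _ (1 + w.s))
    (hT : 𝒜.adj T = T) (hT' : ∃ σ τ, T = fromBlocks σ 0 0 τ)
    {n : ℕ} (hn : 1 ≤ n) {d : Gauge A I J} (h : d.UnitaryApprox 𝒜 D T n) :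
    ∃ d' : Gauge A I J, d'.IsSmall w 𝔪 n ∧ (d.add d').UnitaryApprox 𝒜 D T n ∧
      𝒜.adj (d.add d').F * (d.add d').F - T ∈ fil w 𝔪 _ _ (n + 1) := by
  have hh : ⅟(2 : A) + ⅟2 = 1 := by rw [← mul_two, invOf_mul_self]
  set H := ⅟(2 : A) • (T - 𝒜.adj d.F * d.F) with hH
  have hHn : H ∈ fil w 𝔪 _ _ n := Submodule.smul_mem _ _ (by
    rw [← neg_mem_iff, neg_sub]; exact h.unitary)
  have hHe : ∃ σ τ, H = fromBlocks σ 0 0 τ := by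
    obtain ⟨σ, τ, rfl⟩ := hT'
    obtain ⟨σ', τ', e⟩ := 𝒜.adj_even d.σ d.τ
    rw [hH, Gauge.F, e, fromBlocks_multiply, sub_eq_add_neg, fromBlocks_neg, fromBlocks_add,
      fromBlocks_smul]
    simp only [Matrix.zero_mul, Matrix.mul_zero, add_zero, neg_zero, smul_zero, zero_add]
    exact ⟨_, _, rfl⟩
  have hHa : 𝒜.adj H = H := by
    rw [hH, map_smul, map_sub, hT, 𝒜.adj_mul, 𝒜.adj_adj]
  have hHH : T - 𝒜.adj d.F * d.F = H + H := by
    rw [hH, ← add_smul, hh, one_smul]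
  obtain ⟨d', hF, hC, hs⟩ := Gauge.exists_even hHe hHn
  have hu : 𝒜.adj (d.add d').F * (d.add d').F - T ∈ fil w 𝔪 _ _ (n + 1) := by
    have e : 𝒜.adj (d.add d').F * (d.add d').F - T =
        𝒜.adj (d.F - 1) * H + H * (d.F - 1) + H * H := by
      rw [Gauge.add_F, hF, map_add, map_sub, 𝒜.adj_one, hHa]
      have e' : 𝒜.adj d.F * d.F - T = -(H + H) := by rw [← hHH, neg_sub]
      calc (𝒜.adj d.F + H) * (d.F + H) - T =
          (𝒜.adj d.F * d.F - T) + 𝒜.adj d.F * H + H * d.F + H * H := by noncomm_ring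
        _ = _ := by rw [e']; noncomm_ring
    rw [e]
    refine add_mem (add_mem ?_ ?_) ?_
    · exact fil_anti (by omega) (mul_mem_fil (𝒜.adj_mem _ _ h.approx.F) hHn)
    · exact mul_mem_fil hHn h.approx.F
    · exact fil_anti (by omega) (mul_mem_fil hHn hHn)
  refine ⟨d', hs, ⟨h.approx.add_small hD hn hs, fil_anti (by omega) hu, ?_⟩, hu⟩
  rw [Gauge.add_C, hC, add_zero, h.adj_C]

/-- The matrices E* F and δ F* E differ only through the defect of unitarity, because D satisfies D*
T = δ T D and (K + C)* = δ (K + C). Replacing F by 1 in both products costs terms of the next step.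
-/
theorem Gauge.UnitaryApprox.adj_residue_sub_mem {δ : A} (𝒜 : AntiInvolution w 𝔪 I J δ)
    {D T : Matrix ((J ⊕ I) ⊕ (J ⊕ I)) ((J ⊕ I) ⊕ (J ⊕ I)) (PS₂ A)}
    (hD : D - koszul A I J ∈ fil w 𝔪 _ _ (1 + w.s))
    (hDT : 𝒜.adj D * T = δ • (T * D)) {n : ℕ} {d : Gauge A I J}
    (h : d.UnitaryApprox 𝒜 D T n) (hu : 𝒜.adj d.F * d.F - T ∈ fil w 𝔪 _ _ (n + 1)) :
    𝒜.adj (d.F * D - (koszul A I J + d.C) * d.F) -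
      δ • (d.F * D - (koszul A I J + d.C) * d.F) ∈ fil w 𝔪 _ _ (n + 1 + w.s) := by
  have hDs : D ∈ fil w 𝔪 _ _ w.s := by
    rw [← sub_add_cancel D (koszul A I J)]
    exact add_mem (fil_anti (by omega) hD) koszul_mem_fil
  set E := d.F * D - (koszul A I J + d.C) * d.F with hE
  have hEn : E ∈ fil w 𝔪 _ _ (n + w.s) := h.approx.residue
  have hEa : 𝒜.adj E = 𝒜.adj D * 𝒜.adj d.F - δ • (𝒜.adj d.F * (koszul A I J + d.C)) := by
    rw [hE, map_sub, 𝒜.adj_mul, 𝒜.adj_mul, map_add, 𝒜.adj_koszul, h.adj_C, ← smul_add,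
      Matrix.mul_smul]
  set U := 𝒜.adj d.F * d.F - T with hU
  have e : 𝒜.adj E - δ • E = (𝒜.adj D * U - δ • (U * D)) - 𝒜.adj E * (d.F - 1) +
      δ • (𝒜.adj (d.F - 1) * E) := by
    have e₁ : 𝒜.adj E * d.F = 𝒜.adj D * U + 𝒜.adj D * T -
        δ • (𝒜.adj d.F * (koszul A I J + d.C) * d.F) := by
      rw [hEa, hU, Matrix.sub_mul, Matrix.smul_mul]; noncomm_ring
    have e₂ : 𝒜.adj d.F * E = U * D + T * D - 𝒜.adj d.F * (koszul A I J + d.C) * d.F := by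
      rw [hU, hE]; noncomm_ring
    have e₃ : 𝒜.adj (d.F - 1) = 𝒜.adj d.F - 1 := by rw [map_sub, 𝒜.adj_one]
    clear_value U E
    rw [e₃, Matrix.mul_sub, Matrix.sub_mul, e₁, e₂, hDT, Matrix.mul_one, Matrix.one_mul]
    module
  rw [e]
  refine add_mem (sub_mem (sub_mem ?_ (Submodule.smul_mem _ _ ?_)) ?_) (Submodule.smul_mem _ _ ?_)
  · exact fil_anti (by omega) (mul_mem_fil (𝒜.adj_mem _ _ hDs) hu)
  · exact mul_mem_fil hu hDs
  · exact fil_anti (by omega) (mul_mem_fil (𝒜.adj_mem _ _ hEn) h.approx.F)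
  · exact fil_anti (by omega) (mul_mem_fil (𝒜.adj_mem _ _ h.approx.F) hEn)

/-- The approximate equation E = C' + [K, F'] persists when E, C', F' are replaced by δ E*, δ C'*,
-F'*, and E is nearly δ E*. The average of the two solutions therefore still works; its even part is
skew-adjoint, hence does not disturb F* F to first order, and its constant part satisfies C'* = δ
C'. -/
theorem Gauge.UnitaryApprox.exists_residue_add [Invertible (2 : A)] {δ : A}
    (𝒜 : AntiInvolution w 𝔪 I J δ)
    {D T : Matrix ((J ⊕ I) ⊕ (J ⊕ I)) ((J ⊕ I) ⊕ (J ⊕ I)) (PS₂ A)}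
    (hD : D - koszul A I J ∈ fil w 𝔪 _ _ (1 + w.s))
    (hDT : 𝒜.adj D * T = δ • (T * D)) {n : ℕ} (hn : 1 ≤ n) {d : Gauge A I J}
    (h : d.UnitaryApprox 𝒜 D T n) (hu : 𝒜.adj d.F * d.F - T ∈ fil w 𝔪 _ _ (n + 1))
    {d' : Gauge A I J} (hs : d'.IsSmall w 𝔪 n)
    (hr : d.F * D - (koszul A I J + d.C) * d.F - d'.C -
      (koszul A I J * d'.F - d'.F * koszul A I J) ∈ fil w 𝔪 _ _ (n + 1 + w.s)) :
    ∃ d' : Gauge A I J, d'.IsSmall w 𝔪 n ∧ (d.add d').UnitaryApprox 𝒜 D T (n + 1) := by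
  have hh : ⅟(2 : A) + ⅟2 = 1 := by rw [← mul_two, invOf_mul_self]
  have hE := h.adj_residue_sub_mem 𝒜 hD hDT hu
  obtain ⟨σ', τ', eF⟩ := 𝒜.adj_even d'.σ d'.τ
  obtain ⟨P', Q', eC⟩ := 𝒜.adj_perturbation d'.P d'.Q
  obtain ⟨hP', hQ'⟩ := mem_of_perturbation_mem_fil (eC ▸ 𝒜.adj_mem _ _ hs.C)
  let c : Gauge A I J := ⟨⅟(2 : A) • (d'.σ - σ'), ⅟(2 : A) • (d'.τ - τ'),
    ⅟(2 : A) • (d'.P + δ • P'), ⅟(2 : A) • (d'.Q + δ • Q')⟩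
  have hcF : c.F = ⅟(2 : A) • (d'.F - 𝒜.adj d'.F) := by
    rw [Gauge.F, Gauge.F, eF, sub_eq_add_neg, fromBlocks_neg, fromBlocks_add, fromBlocks_smul]
    simp [c, sub_eq_add_neg]
  have hcC : c.C = ⅟(2 : A) • (d'.C + δ • 𝒜.adj d'.C) := by
    rw [Gauge.C, Gauge.C, eC, ← perturbation_smul, ← perturbation_add, ← perturbation_smul]
  have hcs : c.IsSmall w 𝔪 n := by
    refine ⟨?_, fun i j => ?_, fun i j => ?_⟩
    · rw [hcF]
      exact Submodule.smul_mem _ _ (sub_mem hs.F (𝒜.adj_mem _ _ hs.F))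
    · exact Ideal.mul_mem_left _ _ (add_mem (hs.P i j) (Ideal.mul_mem_left _ _ (hP' i j)))
    · exact Ideal.mul_mem_left _ _ (add_mem (hs.Q i j) (Ideal.mul_mem_left _ _ (hQ' i j)))
  have hcFa : 𝒜.adj c.F = -c.F := by
    rw [hcF, map_smul, map_sub, 𝒜.adj_adj, ← smul_neg, neg_sub]
  have hcCa : 𝒜.adj c.C = δ • c.C := by
    rw [hcC, map_smul, map_add, map_smul, 𝒜.adj_adj, smul_comm δ, smul_add δ, smul_smul δ δ,
      𝒜.sq, one_smul, add_comm]
  refine ⟨c, hcs, h.approx.add hD hn hcs ?_, ?_, ?_⟩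
  · generalize d.F * D - (koszul A I J + d.C) * d.F = E at hr hE ⊢
    set R := E - d'.C - (koszul A I J * d'.F - d'.F * koszul A I J) with hR
    have hRa : δ • 𝒜.adj R = δ • 𝒜.adj E - δ • 𝒜.adj d'.C +
        (koszul A I J * 𝒜.adj d'.F - 𝒜.adj d'.F * koszul A I J) := by
      rw [hR, map_sub, map_sub, map_sub, 𝒜.adj_mul, 𝒜.adj_mul, 𝒜.adj_koszul, Matrix.mul_smul,
        Matrix.smul_mul, ← smul_sub, smul_sub, smul_sub, smul_smul, 𝒜.sq, one_smul]
      abel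
    have e : E - c.C - (koszul A I J * c.F - c.F * koszul A I J) =
        ⅟(2 : A) • (R + δ • 𝒜.adj R) - ⅟(2 : A) • δ • (𝒜.adj E - δ • E) := by
      rw [hRa, smul_sub δ, smul_smul δ δ, 𝒜.sq, one_smul, hR, hcF, hcC, Matrix.mul_smul,
        Matrix.smul_mul, Matrix.mul_sub, Matrix.sub_mul]
      have : E = ⅟(2 : A) • E + ⅟(2 : A) • E := by rw [← add_smul, hh, one_smul]
      nth_rewrite 1 [this]
      module
    rw [e]
    exact sub_mem (Submodule.smul_mem _ _ (add_mem hr (Submodule.smul_mem _ _ (𝒜.adj_mem _ _ hr))))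
      (Submodule.smul_mem _ _ (Submodule.smul_mem _ _ hE))
  · have e : 𝒜.adj (d.add c).F * (d.add c).F - T = (𝒜.adj d.F * d.F - T) +
        𝒜.adj (d.F - 1) * c.F - c.F * (d.F - 1) - c.F * c.F := by
      rw [Gauge.add_F, map_add, map_sub, 𝒜.adj_one, hcFa]; noncomm_ring
    rw [e]
    refine sub_mem (sub_mem (add_mem hu ?_) ?_) ?_
    · exact fil_anti (by omega) (mul_mem_fil (𝒜.adj_mem _ _ h.approx.F) hcs.F)
    · exact mul_mem_fil hcs.F h.approx.F
    · exact fil_anti (by omega) (mul_mem_fil hcs.F hcs.F)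
  · rw [Gauge.add_C, map_add, h.adj_C, hcCa, smul_add]

theorem Gauge.add_assoc (d d' d'' : Gauge A I J) : (d.add d').add d'' = d.add (d'.add d'') := by
  simp [Gauge.add, _root_.add_assoc]

theorem Gauge.IsSmall.add {d d' : Gauge A I J} {n : ℕ} (h : d.IsSmall w 𝔪 n)
    (h' : d'.IsSmall w 𝔪 n) : (d.add d').IsSmall w 𝔪 n :=
  ⟨by rw [Gauge.add_F]; exact add_mem h.F h'.F, fun i j => add_mem (h.P i j) (h'.P i j),
    fun i j => add_mem (h.Q i j) (h'.Q i j)⟩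

/-- A matrix factorization of `xy - π` with a form, close to `θ(0, 0)` with a constant form, is
isomorphic to some `θ(P, Q)` with this constant form. -/
theorem exists_unitary_gauge [IsLocalRing A] [IsAdicComplete (IsLocalRing.maximalIdeal A) A]
    [Invertible (2 : A)] {δ : A} (𝒜 : AntiInvolution w (IsLocalRing.maximalIdeal A) I J δ)
    {φ ψ : Matrix (J ⊕ I) (J ⊕ I) (PS₂ A)} {π : A}
    (hD : fromBlocks 0 ψ φ 0 - koszul A I J ∈ fil w (IsLocalRing.maximalIdeal A) _ _ (1 + w.s))
    (hD₂ : fromBlocks 0 ψ φ 0 * fromBlocks 0 ψ φ 0 = (PS₂.xy A - MvPowerSeries.C π) •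
      (1 : Matrix ((J ⊕ I) ⊕ (J ⊕ I)) ((J ⊕ I) ⊕ (J ⊕ I)) (PS₂ A)))
    {T : Matrix ((J ⊕ I) ⊕ (J ⊕ I)) ((J ⊕ I) ⊕ (J ⊕ I)) (PS₂ A)}
    (hT : 𝒜.adj T = T) (hT' : ∃ σ τ, T = fromBlocks σ 0 0 τ)
    (hT₁ : T - 1 ∈ fil w (IsLocalRing.maximalIdeal A) _ _ 1)
    (hDT : 𝒜.adj (fromBlocks 0 ψ φ 0) * T = δ • (T * fromBlocks 0 ψ φ 0)) :
    ∃ d : Gauge A I J, d.F - 1 ∈ fil w (IsLocalRing.maximalIdeal A) _ _ 1 ∧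
      (∀ i j, d.P i j ∈ IsLocalRing.maximalIdeal A ^ w.e (1 + w.s) 0) ∧
      (∀ i j, d.Q i j ∈ IsLocalRing.maximalIdeal A ^ w.e (1 + w.s) 0) ∧
      d.F * fromBlocks 0 ψ φ 0 = (koszul A I J + d.C) * d.F ∧
      𝒜.adj d.F * d.F = T ∧ 𝒜.adj d.C = δ • d.C := by
  set D : Matrix ((J ⊕ I) ⊕ (J ⊕ I)) ((J ⊕ I) ⊕ (J ⊕ I)) (PS₂ A) := fromBlocks 0 ψ φ 0
  obtain ⟨L, hL⟩ := Gauge.exists_limit (w := w) (𝔪 := IsLocalRing.maximalIdeal A)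
    (Good := fun n d => d.UnitaryApprox 𝒜 D T n)
    ⟨⟨1, 1, 0, 0⟩, Gauge.approx_one hD, by
      rw [Gauge.F, fromBlocks_one, 𝒜.adj_one, one_mul, ← neg_mem_iff, neg_sub]; exact hT₁,
      by simp [Gauge.C, perturbation_zero]⟩ (fun n hn d h => by
      -- Unitarity is improved before the residue: the symmetry of the residue requires F* F = T to
      -- step n + 1, and the skew-adjoint correction that follows keeps this precision.
      obtain ⟨d', hd', h', hu⟩ := h.exists_unitary_add 𝒜 hD hT hT' hn
      obtain ⟨d'', hd'', hr⟩ := h'.approx.exists_next hD hD₂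
      obtain ⟨c, hc, hc'⟩ := h'.exists_residue_add 𝒜 hD hDT hn hu hd'' hr
      exact ⟨d'.add c, hd'.add hc, by rw [← Gauge.add_assoc]; exact hc'⟩)
  obtain ⟨d, d', h, h', rfl⟩ := hL 1 le_rfl
  refine ⟨d.add d', ?_, fun i j => add_mem (h.approx.P i j) (h'.P i j),
    fun i j => add_mem (h.approx.Q i j) (h'.Q i j), ?_, ?_, ?_⟩
  · rw [Gauge.add_F, add_sub_right_comm]
    exact add_mem h.approx.F h'.F
  · rw [← sub_eq_zero]
    refine eq_zero_of_mem_fil (w := w) (𝔪 := IsLocalRing.maximalIdeal A) fun n hn => ?_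
    obtain ⟨c, c', h, h', e⟩ := hL n hn
    rw [e]
    exact fil_anti (by omega) (h.approx.add_small hD hn h').residue
  · rw [← sub_eq_zero]
    refine eq_zero_of_mem_fil (w := w) (𝔪 := IsLocalRing.maximalIdeal A) fun n hn => ?_
    obtain ⟨c, c', h, h', e⟩ := hL n hn
    have e' : 𝒜.adj (c.add c').F * (c.add c').F - T = (𝒜.adj c.F * c.F - T) +
        𝒜.adj c.F * c'.F + 𝒜.adj c'.F * (c.F + c'.F) := by
      rw [Gauge.add_F, map_add]; noncomm_ring
    rw [e, e']
    exact add_mem (add_mem h.unitary (mul_mem_fil_left _ h'.F))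
      (mul_mem_fil_right _ (𝒜.adj_mem _ _ h'.F))
  · rw [← sub_eq_zero]
    refine eq_zero_of_mem_fil (w := w) (𝔪 := IsLocalRing.maximalIdeal A) fun n hn => ?_
    obtain ⟨c, c', h, h', e⟩ := hL n hn
    rw [e, Gauge.add_C, map_add, h.adj_C, smul_add, add_sub_add_left_eq_sub]
    exact fil_anti (by omega) (sub_mem (𝒜.adj_mem _ _ h'.C) (Submodule.smul_mem _ _ h'.C))

end Gauge

end PS₂

namespace PS₂

universe u
set_option linter.unusedSectionVars false

variable {A : Type u} [CommRing A] {𝔪 : Ideal A}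

/-! ### Normal forms of functions and infinitesimal changes of variables -/

theorem exists_level_limit [IsAdicComplete 𝔪 A] {f : ℕ → PS₂ A}
    (hf : ∀ k, f (k + 1) - f k ∈ level 𝔪 fun _ => k + 1) :
    ∃ L, ∀ k, L - f k ∈ level 𝔪 fun _ => k + 1 := by
  obtain ⟨L, hL⟩ := exists_fil_limit (w := .adic) (𝔪 := 𝔪)
    (F := fun k => (fun _ _ => f k : Matrix Unit Unit (PS₂ A))) fun k _ _ => hf k
  exact ⟨L () (), fun k => hL k () ()⟩

theorem eq_zero_of_mem_level [IsHausdorff 𝔪 A] {f : PS₂ A}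
    (h : ∀ k, 1 ≤ k → f ∈ level 𝔪 fun _ => k) : f = 0 :=
  congrFun (congrFun (eq_zero_of_mem_fil (w := .adic) (𝔪 := 𝔪)
    (M := (fun _ _ => f : Matrix Unit Unit (PS₂ A))) fun k hk _ _ => h k hk) ()) ()

theorem mul_mem_level_left {n : ℕ} (f : PS₂ A) {g : PS₂ A} (hg : g ∈ level 𝔪 fun _ => n) :
    f * g ∈ level 𝔪 fun _ => n :=
  mul_mem_level (E := fun _ => 0) (fun _ _ => by simp) (fun d => by simp) hg

theorem mul_mem_level_add {n n' : ℕ} {f g : PS₂ A} (hf : f ∈ level 𝔪 fun _ => n)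
    (hg : g ∈ level 𝔪 fun _ => n') : f * g ∈ level 𝔪 fun _ => n + n' :=
  mul_mem_level (fun _ _ => le_rfl) hf hg

theorem level_anti {n n' : ℕ} (h : n ≤ n') {f : PS₂ A} (hf : f ∈ level 𝔪 fun _ => n') :
    f ∈ level 𝔪 fun _ => n := level_mono (fun _ => h) hf

/-- Every deformation of `xy` is of the form `uv - π`. -/
theorem exists_eq_mul_sub_C [IsAdicComplete 𝔪 A] {ω : PS₂ A}
    (hω : xy A - ω ∈ level 𝔪 fun _ => 1) :
    ∃ (u : Fin 2 → PS₂ A) (π : A), (∀ s, u s - MvPowerSeries.X s ∈ level 𝔪 fun _ => 1) ∧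
      π ∈ 𝔪 ∧ ω = u 0 * u 1 - MvPowerSeries.C π := by
  let e : PS₂ A × PS₂ A → PS₂ A := fun p => p.1 * p.2 - ω -
    MvPowerSeries.C (MvPowerSeries.constantCoeff (p.1 * p.2 - ω))
  -- Newton iteration: the error e has no constant term, so e = x e₁ + y e₂. As u and v are close to
  -- x and y, subtracting e₂ from u and e₁ from v removes e up to products of small terms and a
  -- constant, which is left for π.
  let next : PS₂ A × PS₂ A → PS₂ A × PS₂ A := fun p =>
    (p.1 - shiftY A (e p), p.2 - shiftX A (e p))
  let p : ℕ → PS₂ A × PS₂ A := fun k => next^[k] (MvPowerSeries.X 0, MvPowerSeries.X 1)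
  have hp : ∀ k, p (k + 1) = next (p k) := fun k => Function.iterate_succ_apply' _ _ _
  have hC {n : ℕ} {f : PS₂ A} (hf : f ∈ level 𝔪 fun _ => n) :
      f - MvPowerSeries.C (MvPowerSeries.constantCoeff f) ∈ level 𝔪 fun _ => n :=
    sub_mem hf (C_mem_level (E := fun _ => n) (constantCoeff_mem hf))
  have key : ∀ k, (p k).1 - MvPowerSeries.X 0 ∈ level 𝔪 (fun _ => 1) ∧
      (p k).2 - MvPowerSeries.X 1 ∈ level 𝔪 (fun _ => 1) ∧ e (p k) ∈ level 𝔪 fun _ => k + 1 := by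
    intro k
    induction k with
    | zero => exact ⟨by simp [p], by simp [p], hC hω⟩
    | succ k ih =>
      obtain ⟨h0, h1, he⟩ := ih
      have hX : shiftX A (e (p k)) ∈ level 𝔪 fun _ => k + 1 := shiftX_mem_level he fun _ => le_rfl
      have hY : shiftY A (e (p k)) ∈ level 𝔪 fun _ => k + 1 := shiftY_mem_level he fun _ => le_rfl
      rw [hp]
      refine ⟨?_, ?_, ?_⟩
      · rw [show (next (p k)).1 = (p k).1 - shiftY A (e (p k)) from rfl, sub_right_comm]
        exact sub_mem h0 (level_anti (by omega) hY)
      · rw [show (next (p k)).2 = (p k).2 - shiftX A (e (p k)) from rfl, sub_right_comm]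
        exact sub_mem h1 (level_anti (by omega) hX)
      · have e₁ := eq_C_add_shift (e (p k))
        have e₂ : MvPowerSeries.constantCoeff (e (p k)) = 0 := by simp [e]
        rw [e₂, map_zero, zero_add] at e₁
        have e₃ : (next (p k)).1 * (next (p k)).2 - ω =
            MvPowerSeries.C (MvPowerSeries.constantCoeff ((p k).1 * (p k).2 - ω)) +
            (shiftY A (e (p k)) * shiftX A (e (p k)) - shiftX A (e (p k)) * ((p k).1 -
              MvPowerSeries.X 0) - shiftY A (e (p k)) * ((p k).2 - MvPowerSeries.X 1)) := by
          have : e (p k) = (p k).1 * (p k).2 - ω -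
            MvPowerSeries.C (MvPowerSeries.constantCoeff ((p k).1 * (p k).2 - ω)) := rfl
          rw [show (next (p k)).1 = (p k).1 - shiftY A (e (p k)) from rfl,
            show (next (p k)).2 = (p k).2 - shiftX A (e (p k)) from rfl]
          linear_combination e₁ - this
        have e₄ := hC (sub_mem (sub_mem (level_anti (n := k + 1 + 1) (by omega)
          (mul_mem_level_add hY hX)) (mul_mem_level_add hX h0)) (mul_mem_level_add hY h1))
        convert e₄ using 1
        change (next (p k)).1 * (next (p k)).2 - ω - _ = _
        rw [e₃]
        simp
  obtain ⟨u, hu⟩ := exists_level_limit (𝔪 := 𝔪) (f := fun k => (p k).1) fun k => by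
    rw [hp, show (next (p k)).1 = (p k).1 - shiftY A (e (p k)) from rfl, sub_sub_cancel_left]
    exact neg_mem (shiftY_mem_level (key k).2.2 fun _ => le_rfl)
  obtain ⟨v, hv⟩ := exists_level_limit (𝔪 := 𝔪) (f := fun k => (p k).2) fun k => by
    rw [hp, show (next (p k)).2 = (p k).2 - shiftX A (e (p k)) from rfl, sub_sub_cancel_left]
    exact neg_mem (shiftX_mem_level (key k).2.2 fun _ => le_rfl)
  have hu0 : u - MvPowerSeries.X 0 ∈ level 𝔪 fun _ => 1 := hu 0
  have hv0 : v - MvPowerSeries.X 1 ∈ level 𝔪 fun _ => 1 := hv 0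
  have h : u * v - ω - MvPowerSeries.C (MvPowerSeries.constantCoeff (u * v - ω)) = 0 := by
    refine eq_zero_of_mem_level (𝔪 := 𝔪) fun k hk => ?_
    have h' : u * v - (p k).1 * (p k).2 ∈ level 𝔪 fun _ => k := by
      rw [show u * v - (p k).1 * (p k).2 = v * (u - (p k).1) + (p k).1 * (v - (p k).2) by ring]
      exact add_mem (mul_mem_level_left _ (level_anti (by omega) (hu k)))
        (mul_mem_level_left _ (level_anti (by omega) (hv k)))
    convert add_mem (hC h') (level_anti (by omega) (key k).2.2) using 1
    simp [e]; ring
  refine ⟨![u, v], MvPowerSeries.constantCoeff (u * v - ω), ?_, ?_, ?_⟩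
  · rw [Fin.forall_fin_two]; exact ⟨hu0, hv0⟩
  · have : u * v - ω ∈ level 𝔪 fun _ => 1 := by
      rw [show u * v - ω = v * (u - MvPowerSeries.X 0) +
        MvPowerSeries.X 0 * (v - MvPowerSeries.X 1) + (xy A - ω) by ring]
      exact add_mem (add_mem (mul_mem_level_left _ hu0) (mul_mem_level_left _ hv0)) hω
    simpa using constantCoeff_mem this
  · simp only [Matrix.cons_val_zero, Matrix.cons_val_one]
    linear_combination -h

/-- Substitution of power series whose constant coefficients lie in `𝔪`. -/
theorem exists_algHom [IsAdicComplete 𝔪 A] (u : Fin 2 → PS₂ A)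
    (hu : ∀ s, MvPowerSeries.constantCoeff (u s) ∈ 𝔪) :
    ∃ h : PS₂ A →ₐ[A] PS₂ A, ∀ s, h (MvPowerSeries.X s) = u s := by
  -- In the 𝔪-adic topology A is complete and separated, and a power series with constant term in 𝔪
  -- is topologically nilpotent; substitution therefore converges.
  let : WithIdeal A := ⟨𝔪⟩
  obtain ⟨_, _⟩ := (IsAdic.isAdicComplete_iff (R := A) (I := 𝔪) rfl).1 inferInstance
  open scoped MvPowerSeries.WithPiTopology in
  have ha : MvPowerSeries.HasEval u := by
    refine ⟨fun s => ?_, ?_⟩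
    · refine MvPowerSeries.LinearTopology.isTopologicallyNilpotent_of_constantCoeff ?_
      rw [IsTopologicallyNilpotent, (𝔪.hasBasis_nhds_zero_adic).tendsto_right_iff]
      intro n _
      filter_upwards [Filter.eventually_ge_atTop n] with k hk
      exact Ideal.pow_le_pow_right hk (Ideal.pow_mem_pow (hu s) k)
    · rw [Filter.cofinite_eq_bot]; exact Filter.tendsto_bot
  open scoped MvPowerSeries.WithPiTopology in
  refine ⟨MvPowerSeries.aeval ha, fun s => ?_⟩
  rw [← MvPolynomial.coe_X, MvPowerSeries.aeval_coe, MvPolynomial.aeval_X]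

/-- No continuity of h is needed. Writing f = f(0) + x f₁ + y f₂ reduces coefficients of degree
below N + 1 to those of h f₁ - f₁ and h f₂ - f₂ of degree below N, since h moves x and y only by
elements of 𝔪[[x, y]]. -/
theorem algHom_sub_mem {h : PS₂ A →ₐ[A] PS₂ A}
    (hu : ∀ s, h (MvPowerSeries.X s) - MvPowerSeries.X s ∈ level 𝔪 fun _ => 1) (f : PS₂ A) :
    h f - f ∈ level 𝔪 fun _ => 1 := by
  have key : ∀ (N : ℕ) (f : PS₂ A), h f - f ∈ level 𝔪 fun d => if d < N then 1 else 0 := by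
    intro N
    induction N with
    | zero => intro f d; simp
    | succ N ih =>
      intro f
      have hX (s : Fin 2) : (MvPowerSeries.X s : PS₂ A) ∈
          level 𝔪 fun d => if d = 0 then 1 else 0 := X_mem_level s (by simp)
      have hXm (s : Fin 2) {g : PS₂ A} (hg : g ∈ level 𝔪 fun d => if d < N then 1 else 0) :
          MvPowerSeries.X s * g ∈ level 𝔪 fun d => if d < N + 1 then 1 else 0 :=
        mul_mem_level (fun i j => by split_ifs <;> omega) (hX s) hg
      have hum (s : Fin 2) (g : PS₂ A) : g * (h (MvPowerSeries.X s) - MvPowerSeries.X s) ∈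
          level 𝔪 fun d => if d < N + 1 then 1 else 0 :=
        level_mono (fun d => by split_ifs <;> omega) (mul_mem_level_left g (hu s))
      have e : h f - f = h (shiftX A f) * (h (MvPowerSeries.X 0) - MvPowerSeries.X 0) +
          MvPowerSeries.X 0 * (h (shiftX A f) - shiftX A f) +
          h (shiftY A f) * (h (MvPowerSeries.X 1) - MvPowerSeries.X 1) +
          MvPowerSeries.X 1 * (h (shiftY A f) - shiftY A f) := by
        have hC : h (MvPowerSeries.C (MvPowerSeries.constantCoeff f)) =
          MvPowerSeries.C (MvPowerSeries.constantCoeff f) := h.commutes _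
        have e₁ := eq_C_add_shift f
        have e₂ := congrArg h e₁
        rw [map_add, map_add, map_mul, map_mul, hC] at e₂
        linear_combination e₂ - e₁
      rw [e]
      exact add_mem (add_mem (add_mem (hum _ _) (hXm _ (ih _))) (hum _ _)) (hXm _ (ih _))
  intro d
  simpa using key (d.degree + 1) f d

/-- Finitely many generators of 𝔪^n serve all coefficients at once, so a map which is merely
A-linear can be applied term by term. -/
theorem exists_sum_smul_of_mem_level [IsNoetherianRing A] {n : ℕ} {f : PS₂ A}
    (hf : f ∈ level 𝔪 fun _ => n) : ∃ (s : Finset A) (g : A → PS₂ A), (∀ a ∈ s, a ∈ 𝔪 ^ n) ∧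
      f = ∑ a ∈ s, a • g a := by
  obtain ⟨s, hs⟩ := IsNoetherian.noetherian (𝔪 ^ n)
  have (d : Fin 2 →₀ ℕ) : ∃ c : A → A, ∑ a ∈ s, c a • a = MvPowerSeries.coeff d f := by
    have := hf d
    rw [← hs, Submodule.mem_span_finset] at this
    obtain ⟨c, -, hc⟩ := this
    exact ⟨c, hc⟩
  choose c hc using this
  refine ⟨s, fun a d => c d a, fun a ha => hs ▸ Submodule.subset_span ha, ?_⟩
  ext d
  rw [← hc d, map_sum]
  refine Finset.sum_congr rfl fun a _ => ?_
  exact mul_comm (c d a) a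

/-- The map h - id is A-linear with values in 𝔪[[x, y]], so it gains one power of 𝔪 on each term of
a finite sum with coefficients in 𝔪^n. -/
theorem algHom_sub_mem_succ [IsNoetherianRing A] {h : PS₂ A →ₐ[A] PS₂ A}
    (hu : ∀ s, h (MvPowerSeries.X s) - MvPowerSeries.X s ∈ level 𝔪 fun _ => 1) {n : ℕ} {f : PS₂ A}
    (hf : f ∈ level 𝔪 fun _ => n) : h f - f ∈ level 𝔪 fun _ => n + 1 := by
  obtain ⟨s, g, hs, rfl⟩ := exists_sum_smul_of_mem_level hf
  rw [map_sum, ← Finset.sum_sub_distrib]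
  refine sum_mem fun a ha => ?_
  rw [map_smul, ← smul_sub, MvPowerSeries.smul_eq_C_mul]
  exact mul_mem_level_add (C_mem_level (E := fun _ => n) (hs a ha)) (algHom_sub_mem hu _)

/-- Changes of variables which are the identity modulo `𝔪` are bijective. -/
theorem algHom_bijective [IsNoetherianRing A] [IsAdicComplete 𝔪 A] {h : PS₂ A →ₐ[A] PS₂ A}
    (hu : ∀ s, h (MvPowerSeries.X s) - MvPowerSeries.X s ∈ level 𝔪 fun _ => 1) :
    Function.Bijective h := by
  have hpres {n : ℕ} {f : PS₂ A} (hf : f ∈ level 𝔪 fun _ => n) : h f ∈ level 𝔪 fun _ => n := by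
    rw [← sub_add_cancel (h f) f]
    exact add_mem (level_anti (by omega) (algHom_sub_mem_succ hu hf)) hf
  constructor
  · rw [injective_iff_map_eq_zero]
    intro f hf
    have key : ∀ n, f ∈ level 𝔪 fun _ => n := by
      intro n
      induction n with
      | zero => intro d; simp
      | succ n ih => simpa [hf] using algHom_sub_mem_succ hu ih
    exact eq_zero_of_mem_level fun k _ => key k
  · intro y
    -- Adding the error y - h g to an approximate preimage g replaces that error by its image under
    -- id - h, which is one power of 𝔪 smaller.
    let f : ℕ → PS₂ A := fun k => (fun g => g + (y - h g))^[k] y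
    have hf : ∀ k, f (k + 1) = f k + (y - h (f k)) := fun k => Function.iterate_succ_apply' _ _ _
    have key : ∀ k, y - h (f k) ∈ level 𝔪 fun _ => k + 1 := by
      intro k
      induction k with
      | zero => rw [← neg_mem_iff, neg_sub]; exact algHom_sub_mem hu y
      | succ k ih =>
        rw [hf, map_add, ← sub_sub, ← neg_mem_iff, neg_sub]
        exact algHom_sub_mem_succ hu ih
    obtain ⟨L, hL⟩ := exists_level_limit (𝔪 := 𝔪) (f := f) fun k => by
      rw [hf, add_sub_cancel_left]; exact key k
    refine ⟨L, ?_⟩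
    rw [← sub_eq_zero]
    refine eq_zero_of_mem_level (𝔪 := 𝔪) fun k _ => ?_
    rw [show h L - y = h (L - f k) - (y - h (f k)) by rw [map_sub]; ring]
    exact level_anti (by omega) (sub_mem (hpres (hL k)) (key k))

/-- Every deformation of `xy` becomes `xy - π` after an infinitesimal change of variables. -/
theorem exists_algEquiv_eq_sub_C [IsNoetherianRing A] [IsAdicComplete 𝔪 A] {ω : PS₂ A}
    (hω : xy A - ω ∈ level 𝔪 fun _ => 1) :
    ∃ (g : PS₂ A ≃ₐ[A] PS₂ A) (π : A), π ∈ 𝔪 ∧ g ω = xy A - MvPowerSeries.C π ∧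
      ∀ f, g f - f ∈ level 𝔪 fun _ => 1 := by
  obtain ⟨u, π, hu, hπ, rfl⟩ := exists_eq_mul_sub_C hω
  obtain ⟨h, hh⟩ := exists_algHom (𝔪 := 𝔪) u fun s => by
    simpa using constantCoeff_mem (hu s)
  have hu' : ∀ s, h (MvPowerSeries.X s) - MvPowerSeries.X s ∈ level 𝔪 fun _ => 1 :=
    fun s => by rw [hh]; exact hu s
  -- The substitution h carries xy - π to uv - π = ω, so the change of variables wanted is its
  -- inverse.
  let g := AlgEquiv.ofBijective h (algHom_bijective hu')
  have hg : ∀ f, h (g.symm f) = f := fun f => g.apply_symm_apply f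
  refine ⟨g.symm, π, hπ, ?_, fun f => ?_⟩
  · rw [AlgEquiv.symm_apply_eq]
    change _ = h _
    rw [map_sub, map_mul, hh, hh]
    congr 1
    exact (h.commutes π).symm
  · have := neg_mem (algHom_sub_mem hu' (g.symm f))
    rwa [hg, neg_sub] at this

end PS₂

/-! ### Full faithfulness of `θ` -/

namespace PS₂

universe u
set_option linter.unusedSectionVars false

variable {A : Type u} [CommRing A] {l m n : Type*}

/-- Entrywise division by `x`. -/
noncomputable def matShiftX (A : Type u) [CommRing A] (m n : Type*) :
    Matrix m n (PS₂ A) →ₗ[A] Matrix m n (PS₂ A) := (shiftX A).mapMatrix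

/-- Entrywise division by `y`. -/
noncomputable def matShiftY (A : Type u) [CommRing A] (m n : Type*) :
    Matrix m n (PS₂ A) →ₗ[A] Matrix m n (PS₂ A) := (shiftY A).mapMatrix

theorem matShiftX_apply (M : Matrix m n (PS₂ A)) (i : m) (j : n) :
    matShiftX A m n M i j = shiftX A (M i j) := rfl

theorem matShiftY_apply (M : Matrix m n (PS₂ A)) (i : m) (j : n) :
    matShiftY A m n M i j = shiftY A (M i j) := rfl

@[simp] theorem matShiftX_C_mul [Fintype m] (P : Matrix l m A) (M : Matrix m n (PS₂ A)) :
    matShiftX A l n (P.map (MvPowerSeries.C : A →+* PS₂ A) * M) =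
      P.map (MvPowerSeries.C : A →+* PS₂ A) * matShiftX A m n M := by
  ext1 i j; simp [matShiftX_apply, Matrix.mul_apply]

@[simp] theorem matShiftY_C_mul [Fintype m] (P : Matrix l m A) (M : Matrix m n (PS₂ A)) :
    matShiftY A l n (P.map (MvPowerSeries.C : A →+* PS₂ A) * M) =
      P.map (MvPowerSeries.C : A →+* PS₂ A) * matShiftY A m n M := by
  ext1 i j; simp [matShiftY_apply, Matrix.mul_apply]

@[simp] theorem matShiftX_mul_C [Fintype m] (P : Matrix m n A) (M : Matrix l m (PS₂ A)) :
    matShiftX A l n (M * P.map (MvPowerSeries.C : A →+* PS₂ A)) =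
      matShiftX A l m M * P.map (MvPowerSeries.C : A →+* PS₂ A) := by
  ext1 i j; simp [matShiftX_apply, Matrix.mul_apply]

@[simp] theorem matShiftY_mul_C [Fintype m] (P : Matrix m n A) (M : Matrix l m (PS₂ A)) :
    matShiftY A l n (M * P.map (MvPowerSeries.C : A →+* PS₂ A)) =
      matShiftY A l m M * P.map (MvPowerSeries.C : A →+* PS₂ A) := by
  ext1 i j; simp [matShiftY_apply, Matrix.mul_apply]

@[simp] theorem matShiftX_X_zero_smul (M : Matrix m n (PS₂ A)) :
    matShiftX A m n ((MvPowerSeries.X 0 : PS₂ A) • M) = M := by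
  ext1 i j; simp [matShiftX_apply]

@[simp] theorem matShiftX_X_one_smul (M : Matrix m n (PS₂ A)) :
    matShiftX A m n ((MvPowerSeries.X 1 : PS₂ A) • M) =
      (MvPowerSeries.X 1 : PS₂ A) • matShiftX A m n M := by
  ext1 i j; simp [matShiftX_apply]

@[simp] theorem matShiftY_X_zero_smul (M : Matrix m n (PS₂ A)) :
    matShiftY A m n ((MvPowerSeries.X 0 : PS₂ A) • M) = 0 := by
  ext1 i j; simp [matShiftY_apply]

@[simp] theorem matShiftY_X_one_smul (M : Matrix m n (PS₂ A)) :
    matShiftY A m n ((MvPowerSeries.X 1 : PS₂ A) • M) =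
      M - (MvPowerSeries.X 0 : PS₂ A) • matShiftX A m n M := by
  ext1 i j; simp [matShiftY_apply, matShiftX_apply]

/-- Entrywise constant coefficient. -/
noncomputable def matCoeff (A : Type u) [CommRing A] (m n : Type*) :
    Matrix m n (PS₂ A) →+ Matrix m n A :=
  (MvPowerSeries.constantCoeff : PS₂ A →+* A).toAddMonoidHom.mapMatrix

theorem matCoeff_apply (M : Matrix m n (PS₂ A)) (i : m) (j : n) :
    matCoeff A m n M i j = MvPowerSeries.constantCoeff (M i j) := rfl

@[simp] theorem matCoeff_C (P : Matrix m n A) :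
    matCoeff A m n (P.map (MvPowerSeries.C : A →+* PS₂ A)) = P := by
  ext1 i j; simp [matCoeff_apply]

@[simp] theorem matCoeff_C_mul [Fintype m] (P : Matrix l m A) (M : Matrix m n (PS₂ A)) :
    matCoeff A l n (P.map (MvPowerSeries.C : A →+* PS₂ A) * M) = P * matCoeff A m n M := by
  ext1 i j; simp [matCoeff_apply, Matrix.mul_apply]

@[simp] theorem matCoeff_mul_C [Fintype m] (P : Matrix m n A) (M : Matrix l m (PS₂ A)) :
    matCoeff A l n (M * P.map (MvPowerSeries.C : A →+* PS₂ A)) = matCoeff A l m M * P := by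
  ext1 i j; simp [matCoeff_apply, Matrix.mul_apply]

@[simp] theorem matCoeff_X_smul (s : Fin 2) (M : Matrix m n (PS₂ A)) :
    matCoeff A m n ((MvPowerSeries.X s : PS₂ A) • M) = 0 := by
  ext1 i j; simp [matCoeff_apply]

theorem matrix_eq_C_add_shift (M : Matrix m n (PS₂ A)) :
    M = (matCoeff A m n M).map (MvPowerSeries.C : A →+* PS₂ A) +
      (MvPowerSeries.X 0 : PS₂ A) • matShiftX A m n M +
      (MvPowerSeries.X 1 : PS₂ A) • matShiftY A m n M := by
  ext1 i j; exact eq_C_add_shift (M i j)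

end PS₂

namespace MatFac

universe u
variable {A : Type u} [CommRing A]
variable {I J : Type} [Fintype I] [Fintype J] [DecidableEq I] [DecidableEq J]
variable {I' J' : Type} [Fintype I'] [Fintype J'] [DecidableEq I'] [DecidableEq J']
variable {π : A}

open PS₂

/-- At x = y = 0 the operators of θ(P, Q) retain only the entries of P and Q. The constant terms of
one block of each component of the homotopy then form, up to sign, a homotopy between f and g. -/
theorem Hom.Homotopic.of_theta {N : MatFac A I J π} {N' : MatFac A I' J' π} {f g : Hom N N'}
    (h : f.theta.Homotopic g.theta) : f.Homotopic g := by
  obtain ⟨h₀, h₁, e, e'⟩ := h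
  obtain ⟨a, b, c, d, rfl⟩ : ∃ a b c d, h₀ = fromBlocks a b c d :=
    ⟨_, _, _, _, (fromBlocks_toBlocks h₀).symm⟩
  obtain ⟨a', b', c', d', rfl⟩ : ∃ a b c d, h₁ = fromBlocks a b c d :=
    ⟨_, _, _, _, (fromBlocks_toBlocks h₁).symm⟩
  rw [Hom.theta_σ, Hom.theta_σ, theta_φ, theta_ψ] at e
  rw [Hom.theta_τ, Hom.theta_τ, theta_φ, theta_ψ] at e'
  simp only [fromBlocks_multiply, sub_eq_add_neg, fromBlocks_neg, fromBlocks_add, fromBlocks_inj]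
    at e e'
  obtain ⟨-, -, -, e₂⟩ := e
  obtain ⟨e₁, -, -, -⟩ := e'
  replace e₁ := congrArg (matCoeff A _ _) e₁
  replace e₂ := congrArg (matCoeff A _ _) e₂
  simp only [Matrix.smul_mul, Matrix.mul_smul, Matrix.one_mul, Matrix.mul_one, Matrix.neg_mul,
    Matrix.mul_neg, map_add, map_neg, matCoeff_C, matCoeff_C_mul, matCoeff_mul_C,
    matCoeff_X_smul, add_zero, zero_add, neg_zero] at e₁ e₂
  refine ⟨matCoeff A _ _ b, -matCoeff A _ _ c', ?_, ?_⟩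
  · rw [sub_eq_add_neg, e₂, Matrix.neg_mul]
  · rw [sub_eq_add_neg, e₁, Matrix.mul_neg]

/-- Every morphism between matrix factorizations `θ(P, Q)` and `θ(P', Q')` is homotopic to the
image of a morphism. -/
theorem exists_theta_homotopic {N : MatFac A I J π} {N' : MatFac A I' J' π}
    (F : Hom N.theta N'.theta) : ∃ f : Hom N N', F.Homotopic f.theta := by
  obtain ⟨σ, τ, hφ, hψ⟩ := F
  obtain ⟨s₁, s₂, s₃, s₄, rfl⟩ : ∃ a b c d, σ = fromBlocks a b c d :=
    ⟨_, _, _, _, (fromBlocks_toBlocks σ).symm⟩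
  obtain ⟨t₁, t₂, t₃, t₄, rfl⟩ : ∃ a b c d, τ = fromBlocks a b c d :=
    ⟨_, _, _, _, (fromBlocks_toBlocks τ).symm⟩
  rw [theta_φ, theta_φ] at hφ
  rw [theta_ψ, theta_ψ] at hψ
  simp only [fromBlocks_multiply, fromBlocks_inj, Matrix.smul_mul, Matrix.mul_smul, Matrix.one_mul,
    Matrix.mul_one, Matrix.neg_mul, Matrix.mul_neg] at hφ hψ
  obtain ⟨e₁, e₂, e₃, e₄⟩ := hφ
  obtain ⟨e₅, e₆, e₇, e₈⟩ := hψ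
  have x₁ := congrArg (matShiftX A _ _) e₁
  have x₂ := congrArg (matShiftX A _ _) e₂
  have x₇ := congrArg (matShiftX A _ _) e₇
  have x₈ := congrArg (matShiftX A _ _) e₈
  have y₂ := congrArg (matShiftY A _ _) e₂
  have y₇ := congrArg (matShiftY A _ _) e₇
  have c₂ := congrArg (matCoeff A _ _) e₂
  have c₇ := congrArg (matCoeff A _ _) e₇
  have ht₁ := matrix_eq_C_add_shift t₁
  have hs₄ := matrix_eq_C_add_shift s₄
  simp only [map_add, map_neg, matShiftX_C_mul, matShiftX_mul_C, matShiftX_X_zero_smul,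
    matShiftX_X_one_smul, matShiftY_C_mul, matShiftY_mul_C, matShiftY_X_zero_smul,
    matShiftY_X_one_smul, matCoeff_C_mul, matCoeff_mul_C, matCoeff_X_smul, add_zero, zero_add,
    neg_zero, neg_inj] at x₁ x₂ x₇ x₈ y₂ y₇ c₂ c₇
  -- As θ(f) is block diagonal with τ first and σ second, f is read off at the origin from t₁ and
  -- s₄; `c₂` and `c₇` are its commutation relations. The homotopy consists of quotients by x or y,
  -- and the remaining block relations follow by dividing the commutation relations of F.
  refine ⟨⟨matCoeff A _ _ s₄, matCoeff A _ _ t₁, c₂, c₇⟩,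
    fromBlocks (matShiftY A _ _ t₁) 0 (-matShiftX A _ _ s₃) (-matShiftX A _ _ s₄),
    fromBlocks (matShiftX A _ _ t₁) (matShiftX A _ _ t₂) 0 (-matShiftY A _ _ s₄), ?_, ?_⟩
  · rw [Hom.theta_σ, theta_φ, theta_ψ]
    simp only [fromBlocks_multiply, sub_eq_add_neg, fromBlocks_neg, fromBlocks_add, fromBlocks_inj,
      Matrix.smul_mul, Matrix.mul_smul, Matrix.one_mul, Matrix.mul_one, Matrix.neg_mul,
      Matrix.mul_neg, Matrix.mul_zero, Matrix.zero_mul]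
    refine ⟨?_, ?_, ?_, ?_⟩
    · linear_combination (norm := abel) x₁ + ht₁
    · linear_combination (norm := abel) x₂
    · linear_combination (norm := (simp only [smul_zero]; abel)) -y₇
    · linear_combination (norm := (simp only [smul_neg]; abel)) hs₄
  · rw [Hom.theta_τ, theta_φ, theta_ψ]
    simp only [fromBlocks_multiply, sub_eq_add_neg, fromBlocks_neg, fromBlocks_add, fromBlocks_inj,
      Matrix.smul_mul, Matrix.mul_smul, Matrix.one_mul, Matrix.mul_one, Matrix.neg_mul,
      Matrix.mul_neg, Matrix.mul_zero, Matrix.zero_mul]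
    refine ⟨?_, ?_, ?_, ?_⟩
    · linear_combination (norm := abel) ht₁
    · linear_combination (norm := (simp only [smul_zero]; abel)) y₂
    · linear_combination (norm := (simp only [smul_neg]; abel)) -x₇
    · linear_combination (norm := (simp only [smul_neg]; abel)) -x₈ + hs₄

end MatFac

instance thetaFunctor_faithful {A : Type*} [CommRing A] (π : A) : (thetaFunctor π).Faithful where
  map_injective {X Y} f g h := by
    obtain ⟨f, rfl⟩ := (CategoryTheory.Quotient.functor (MFCat.homotopy A π)).map_surjective f
    obtain ⟨g, rfl⟩ := (CategoryTheory.Quotient.functor (MFCat.homotopy A π)).map_surjective g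
    refine CategoryTheory.Quotient.sound _ (MatFac.Hom.Homotopic.of_theta ?_)
    exact (CategoryTheory.Quotient.functor_map_eq_iff (MFCat.homotopy (PS₂ A) _) _ _).1 h

instance thetaFunctor_full {A : Type*} [CommRing A] (π : A) : (thetaFunctor π).Full where
  map_surjective {X Y} F := by
    obtain ⟨F, rfl⟩ := (CategoryTheory.Quotient.functor (MFCat.homotopy (PS₂ A) _)).map_surjective F
    obtain ⟨f, hf⟩ := MatFac.exists_theta_homotopic F
    exact ⟨(CategoryTheory.Quotient.functor _).map f, (CategoryTheory.Quotient.sound _ hf).symm⟩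

/-! ### Homotopy equivalences and reduced matrix factorizations -/

namespace MatFac

universe u
set_option linter.unusedSectionVars false

variable {S : Type u} [CommRing S]
variable {I J : Type} [Fintype I] [Fintype J] [DecidableEq I] [DecidableEq J]
variable {I' J' : Type} [Fintype I'] [Fintype J'] [DecidableEq I'] [DecidableEq J']
variable {I'' J'' : Type} [Fintype I''] [Fintype J''] [DecidableEq I''] [DecidableEq J'']
variable {w : S}

/-- The object of the homotopy category given by a matrix factorization. -/
def toHMF (M : MatFac S I J w) : HMF S w :=
  (CategoryTheory.Quotient.functor (MFCat.homotopy S w)).obj ⟨M⟩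

/-- Two matrix factorizations are homotopy equivalent. -/
def HEquiv (M : MatFac S I J w) (N : MatFac S I' J' w) : Prop :=
  ∃ (f : Hom M N) (g : Hom N M), (f.comp g).Homotopic (Hom.id M) ∧ (g.comp f).Homotopic (Hom.id N)

/-- Passing to isomorphisms of the homotopy category gives reflexivity and transitivity for free. -/
theorem hEquiv_iff {M : MatFac S I J w} {N : MatFac S I' J' w} :
    M.HEquiv N ↔ Nonempty (M.toHMF ≅ N.toHMF) := by
  constructor
  · rintro ⟨f, g, h, h'⟩
    exact ⟨⟨(CategoryTheory.Quotient.functor (MFCat.homotopy S w)).map (X := (⟨M⟩ : MFCat S w)) (Y := (⟨N⟩ : MFCat S w)) f,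
      (CategoryTheory.Quotient.functor (MFCat.homotopy S w)).map (X := (⟨N⟩ : MFCat S w)) (Y := (⟨M⟩ : MFCat S w)) g,
      CategoryTheory.Quotient.sound _ h, CategoryTheory.Quotient.sound _ h'⟩⟩
  · rintro ⟨e⟩
    obtain ⟨f, hf⟩ := (CategoryTheory.Quotient.functor (MFCat.homotopy S w)).map_surjective
      (X := (⟨M⟩ : MFCat S w)) (Y := (⟨N⟩ : MFCat S w)) e.hom
    obtain ⟨g, hg⟩ := (CategoryTheory.Quotient.functor (MFCat.homotopy S w)).map_surjective
      (X := (⟨N⟩ : MFCat S w)) (Y := (⟨M⟩ : MFCat S w)) e.inv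
    refine ⟨f, g, ?_, ?_⟩
    · refine (CategoryTheory.Quotient.functor_map_eq_iff (MFCat.homotopy S w) (X := (⟨M⟩ : MFCat S w))
        (Y := (⟨M⟩ : MFCat S w)) _ _).1 (((CategoryTheory.Quotient.functor _).map_comp (X := (⟨M⟩ : MFCat S w)) (Y := (⟨N⟩ : MFCat S w))
        (Z := (⟨M⟩ : MFCat S w)) f g).trans ?_)
      rw [hf, hg]
      exact e.hom_inv_id
    · refine (CategoryTheory.Quotient.functor_map_eq_iff (MFCat.homotopy S w) (X := (⟨N⟩ : MFCat S w))
        (Y := (⟨N⟩ : MFCat S w)) _ _).1 (((CategoryTheory.Quotient.functor _).map_comp (X := (⟨N⟩ : MFCat S w)) (Y := (⟨M⟩ : MFCat S w))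
        (Z := (⟨N⟩ : MFCat S w)) g f).trans ?_)
      rw [hf, hg]
      exact e.inv_hom_id

theorem HEquiv.trans {M : MatFac S I J w} {N : MatFac S I' J' w} {L : MatFac S I'' J'' w}
    (h : M.HEquiv N) (h' : N.HEquiv L) : M.HEquiv L := by
  rw [hEquiv_iff] at *
  exact ⟨h.some ≪≫ h'.some⟩

theorem HEquiv.refl (M : MatFac S I J w) : M.HEquiv M := hEquiv_iff.2 ⟨Iso.refl _⟩

theorem Hom.IsIso.hEquiv {M : MatFac S I J w} {N : MatFac S I' J' w} {f : Hom M N}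
    (h : f.IsIso) : M.HEquiv N := by
  obtain ⟨⟨σ, h₁, h₂⟩, τ, h₃, h₄⟩ := h
  refine ⟨f, ⟨σ, τ, ?_, ?_⟩, ⟨0, 0, ?_, ?_⟩, 0, 0, ?_, ?_⟩
  · rw [← Matrix.one_mul (M.φ * σ), ← h₄, Matrix.mul_assoc, ← Matrix.mul_assoc f.τ, ← f.comm_φ,
      Matrix.mul_assoc, h₁, Matrix.mul_one]
  · rw [← Matrix.one_mul (M.ψ * τ), ← h₂, Matrix.mul_assoc, ← Matrix.mul_assoc f.σ, ← f.comm_ψ,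
      Matrix.mul_assoc, h₃, Matrix.mul_one]
  all_goals simp [Hom.comp, Hom.id, h₁, h₂, h₃, h₄]

/-- Exchange of the even and the odd part. -/
def swap (M : MatFac S I J w) : MatFac S J I w :=
  ⟨M.ψ, M.φ, M.ψ_mul_φ, M.φ_mul_ψ⟩

theorem HEquiv.swap {M : MatFac S I J w} {N : MatFac S I' J' w} (h : M.HEquiv N) :
    M.swap.HEquiv N.swap := by
  obtain ⟨f, g, ⟨h₀, h₁, e₀, e₁⟩, k₀, k₁, e₂, e₃⟩ := h
  exact ⟨⟨f.τ, f.σ, f.comm_ψ, f.comm_φ⟩, ⟨g.τ, g.σ, g.comm_ψ, g.comm_φ⟩,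
    ⟨h₁, h₀, e₁, e₀⟩, k₁, k₀, e₃, e₂⟩

theorem hEquiv_reindex (M : MatFac S I J w) (e : I ≃ I') (f : J ≃ J') :
    M.HEquiv (M.reindex e f) := by
  have h : (⟨(1 : Matrix I I S).submatrix e.symm id, (1 : Matrix J J S).submatrix f.symm id, by
      change M.φ.submatrix f.symm e.symm * (1 : Matrix I I S).submatrix e.symm id = _
      rw [Matrix.submatrix_mul_equiv, Matrix.mul_one]
      ext; simp [Matrix.mul_apply, Matrix.one_apply], by
      change M.ψ.submatrix e.symm f.symm * (1 : Matrix J J S).submatrix f.symm id = _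
      rw [Matrix.submatrix_mul_equiv, Matrix.mul_one]
      ext; simp [Matrix.mul_apply, Matrix.one_apply]⟩ :
      Hom M (M.reindex e f)).IsIso := by
    constructor
    · exact Matrix.IsInvertible.submatrix (m := I) (n := I) ⟨1, by simp, by simp⟩ e.symm (.refl _)
    · exact Matrix.IsInvertible.submatrix (m := J) (n := J) ⟨1, by simp, by simp⟩ f.symm (.refl _)
  exact h.hEquiv

/-- A matrix factorization with an invertible block of `φ` is homotopy equivalent to the
Schur complement. -/
theorem exists_hEquiv_of_block (M : MatFac S (I' ⊕ I) (J' ⊕ J) w) {e : Matrix I' J' S}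
    (h : M.φ.toBlocks₁₁ * e = 1) (h' : e * M.φ.toBlocks₁₁ = 1) :
    ∃ N : MatFac S I J w, M.HEquiv N := by
  obtain ⟨φ, ψ, hφ, hψ⟩ := M
  obtain ⟨d, c, b, a, rfl⟩ : ∃ a b c d, φ = fromBlocks a b c d :=
    ⟨_, _, _, _, (fromBlocks_toBlocks φ).symm⟩
  obtain ⟨s, r, q, p, rfl⟩ : ∃ a b c d, ψ = fromBlocks a b c d :=
    ⟨_, _, _, _, (fromBlocks_toBlocks ψ).symm⟩
  have hφ' := hφ
  have hψ' := hψ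
  simp only [toBlocks_fromBlocks₁₁] at h h'
  rw [fromBlocks_multiply, ← fromBlocks_one, fromBlocks_smul, fromBlocks_inj] at hφ' hψ'
  simp only [smul_zero] at hφ' hψ'
  obtain ⟨a₁, a₂, a₃, a₄⟩ := hφ'
  obtain ⟨b₁, b₂, b₃, b₄⟩ := hψ'
  have k₁ : e * (c * p) = -r := by
    rw [eq_neg_of_add_eq_zero_right a₂, Matrix.mul_neg, ← Matrix.mul_assoc, h', Matrix.one_mul]
  have k₂ : p * (b * e) = -q := by
    rw [← Matrix.mul_assoc, eq_neg_of_add_eq_zero_right b₃, Matrix.neg_mul, Matrix.mul_assoc, h,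
      Matrix.mul_one]
  -- Gaussian elimination with the invertible block d, whose inverse is e: φ is replaced by its
  -- Schur complement and ψ by its complementary block. The discarded summand is contractible, and
  -- the homotopy -e kills it.
  let N : MatFac S I J w := ⟨a - b * e * c, p, by
    rw [Matrix.sub_mul, Matrix.mul_assoc, Matrix.mul_assoc, k₁, Matrix.mul_neg, sub_neg_eq_add,
      add_comm, a₄], by
    rw [Matrix.mul_sub, ← Matrix.mul_assoc, k₂, Matrix.neg_mul, sub_neg_eq_add, add_comm, b₄]⟩
  refine ⟨N, ⟨fromCols 0 1, fromCols (-(b * e)) 1, ?_, ?_⟩,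
    ⟨fromRows (-(e * c)) 1, fromRows 0 1, ?_, ?_⟩,
    ⟨0, fromBlocks (-e) 0 0 0, ?_, ?_⟩, ⟨0, 0, ?_, ?_⟩⟩
  · simp [N, Matrix.mul_fromCols, fromCols_mul_fromBlocks, Matrix.mul_assoc, h', sub_eq_add_neg,
      add_comm]
  · simp [N, Matrix.mul_fromCols, fromCols_mul_fromBlocks, k₂]
  · simp [N, Matrix.fromRows_mul, fromBlocks_mul_fromRows, ← Matrix.mul_assoc, h, sub_eq_add_neg, add_comm]
  · simp [N, Matrix.fromRows_mul, fromBlocks_mul_fromRows, k₁, Matrix.mul_assoc]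
  · simp only [Hom.comp, Hom.id, fromRows_mul_fromCols, fromBlocks_multiply, ← fromBlocks_one,
      sub_eq_add_neg, fromBlocks_neg, fromBlocks_add]
    simp [h']
  · simp only [Hom.comp, Hom.id, fromRows_mul_fromCols, fromBlocks_multiply, ← fromBlocks_one,
      sub_eq_add_neg, fromBlocks_neg, fromBlocks_add]
    simp [h]
  · simp [Hom.comp, Hom.id, fromCols_mul_fromRows]
  · simp [Hom.comp, Hom.id, fromCols_mul_fromRows]

/-- A unit entry becomes an invertible block of size one once its row and column are moved to the
front. -/
theorem exists_hEquiv_of_isUnit (M : MatFac S I J w) {i : I} {j : J} (h : IsUnit (M.φ j i)) :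
    ∃ N : MatFac S {i' // ¬i' = i} {j' // ¬j' = j} w, M.HEquiv N := by
  obtain ⟨v, hv⟩ := h
  let M' := M.reindex (Equiv.sumCompl (· = i)).symm (Equiv.sumCompl (· = j)).symm
  obtain ⟨N, hN⟩ := M'.exists_hEquiv_of_block (e := Matrix.of fun _ _ => (v⁻¹ : Sˣ)) (by
      ext ⟨a, rfl⟩ ⟨b, rfl⟩
      rw [Matrix.mul_apply, Fintype.sum_unique]
      simp only [M', reindex, toBlocks₁₁, of_apply, submatrix_apply, Equiv.symm_symm,
        Equiv.sumCompl_apply_inl, Units.mul_inv_eq_one, one_apply_eq]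
      exact hv.symm)
    (by
      ext ⟨a, rfl⟩ ⟨b, rfl⟩
      rw [Matrix.mul_apply, Fintype.sum_unique]
      simp only [M', reindex, toBlocks₁₁, of_apply, submatrix_apply, Equiv.symm_symm,
        Equiv.sumCompl_apply_inl, Units.inv_mul_eq_one, one_apply_eq]
      exact hv)
  exact ⟨N, (M.hEquiv_reindex _ _).trans hN⟩

/-- Over a local ring, every matrix factorization is homotopy equivalent to a reduced one. -/
theorem exists_hEquiv_isReduced [IsLocalRing S] (M : MatFac S I J w) :
    ∃ (I' J' : Type) (_ : Fintype I') (_ : Fintype J') (_ : DecidableEq I') (_ : DecidableEq J')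
      (N : MatFac S I' J' w), N.IsReduced ∧ M.HEquiv N := by
  -- Induction on the total rank: every unit entry lowers both ranks by one, and a unit entry of ψ
  -- becomes one of φ after `swap`.
  obtain ⟨n, hn⟩ : ∃ n, Fintype.card I + Fintype.card J ≤ n := ⟨_, le_rfl⟩
  induction n generalizing I J with
  | zero =>
    have : IsEmpty I := Fintype.card_eq_zero_iff.1 (by omega)
    exact ⟨I, J, _, _, _, _, M, ⟨fun _ i => isEmptyElim i, fun i => isEmptyElim i⟩, .refl M⟩
  | succ n ih =>
    by_cases h : M.IsReduced
    · exact ⟨I, J, _, _, _, _, M, h, .refl M⟩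
    · rw [IsReduced, not_and_or] at h
      push Not at h
      have hc {K : Type} [Fintype K] [DecidableEq K] (a : K) :
          Fintype.card {b // ¬b = a} < Fintype.card K := Fintype.card_subtype_lt (x := a) (by simp)
      rcases h with ⟨j, i, h⟩ | ⟨i, j, h⟩
      · rw [IsLocalRing.mem_maximalIdeal, mem_nonunits_iff, not_not] at h
        obtain ⟨N, hN⟩ := M.exists_hEquiv_of_isUnit h
        obtain ⟨I', J', _, _, _, _, L, hL, hL'⟩ := ih N (by have := hc i; have := hc j; omega)
        exact ⟨I', J', _, _, _, _, L, hL, hN.trans hL'⟩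
      · rw [IsLocalRing.mem_maximalIdeal, mem_nonunits_iff, not_not] at h
        obtain ⟨N, hN⟩ := M.swap.exists_hEquiv_of_isUnit h
        obtain ⟨I', J', _, _, _, _, L, hL, hL'⟩ := ih N.swap (by
          have := hc i; have := hc j; omega)
        exact ⟨I', J', _, _, _, _, L, hL, hN.swap.trans hL'⟩

/-- The transport of a matrix factorization along invertible matrices. -/
theorem exists_transport (M : MatFac S I J w) {σ : Matrix I' I S} {σ' : Matrix I I' S}
    {τ : Matrix J' J S} {τ' : Matrix J J' S} (h₁ : σ * σ' = 1) (h₂ : σ' * σ = 1)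
    (h₃ : τ * τ' = 1) (h₄ : τ' * τ = 1) :
    ∃ N : MatFac S I' J' w, N.φ = τ * M.φ * σ' ∧ N.ψ = σ * M.ψ * τ' ∧
      ∃ f : Hom M N, f.σ = σ ∧ f.τ = τ := by
  refine ⟨⟨τ * M.φ * σ', σ * M.ψ * τ', ?_, ?_⟩, rfl, rfl, ⟨σ, τ, ?_, ?_⟩, rfl, rfl⟩
  · rw [Matrix.mul_assoc, Matrix.mul_assoc σ, ← Matrix.mul_assoc σ', h₂, Matrix.one_mul,
      Matrix.mul_assoc, ← Matrix.mul_assoc M.φ, M.φ_mul_ψ, Matrix.smul_mul, Matrix.one_mul,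
      Matrix.mul_smul, h₃]
  · rw [Matrix.mul_assoc, Matrix.mul_assoc τ, ← Matrix.mul_assoc τ', h₄, Matrix.one_mul,
      Matrix.mul_assoc, ← Matrix.mul_assoc M.ψ, M.ψ_mul_φ, Matrix.smul_mul, Matrix.one_mul,
      Matrix.mul_smul, h₁]
  · rw [Matrix.mul_assoc, h₂, Matrix.mul_one]
  · rw [Matrix.mul_assoc, h₄, Matrix.mul_one]

end MatFac

/-! ### From gauge transformations to isomorphisms -/

namespace PS₂

universe u
set_option linter.unusedSectionVars false

variable {A : Type u} [CommRing A] {w : Weight}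
variable {I J : Type} [Fintype I] [Fintype J] [DecidableEq I] [DecidableEq J]

theorem mem_maximalIdeal_iff [IsLocalRing A] {f : PS₂ A} :
    f ∈ IsLocalRing.maximalIdeal (PS₂ A) ↔
      MvPowerSeries.constantCoeff f ∈ IsLocalRing.maximalIdeal A := by
  rw [IsLocalRing.mem_maximalIdeal, IsLocalRing.mem_maximalIdeal, mem_nonunits_iff,
    mem_nonunits_iff, MvPowerSeries.isUnit_iff_constantCoeff]

theorem isUnit_of_sub_one_mem_fil [IsLocalRing A] {m : Type*} [Fintype m] [DecidableEq m]
    {M : Matrix m m (PS₂ A)} (h : M - 1 ∈ fil w (IsLocalRing.maximalIdeal A) _ _ 1) :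
    IsUnit M :=
  isUnit_of_sub_one_mem fun i j => mem_maximalIdeal_iff.2 <|
    Ideal.pow_le_self (by have := w.one; omega) (constantCoeff_mem (h i j))

theorem Gauge.isUnit [IsLocalRing A] {d : Gauge A I J}
    (h : d.F - 1 ∈ fil w (IsLocalRing.maximalIdeal A) _ _ 1) : IsUnit d.σ ∧ IsUnit d.τ := by
  rw [Gauge.F, ← fromBlocks_one, sub_eq_add_neg, fromBlocks_neg, fromBlocks_add,
    fromBlocks_mem_fil] at h
  simp only [← sub_eq_add_neg] at h
  exact ⟨isUnit_of_sub_one_mem_fil h.1, isUnit_of_sub_one_mem_fil h.2.2.2⟩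

theorem koszul_add_perturbation {π : A} (N : MatFac A I J π) :
    koszul A I J + perturbation N.φ N.ψ = fromBlocks 0 N.theta.ψ N.theta.φ 0 := by
  simp [koszul, perturbation, MatFac.theta_φ, MatFac.theta_ψ, fromBlocks_add]

end PS₂

theorem IsUnit.isInvertible {S m : Type*} [CommRing S] [Fintype m] [DecidableEq m]
    {M : Matrix m m S} (h : IsUnit M) : M.IsInvertible := by
  obtain ⟨u, rfl⟩ := h
  exact ⟨_, u.mul_inv, u.inv_mul⟩

namespace MatFac

universe u
set_option linter.unusedSectionVars false

open PS₂

variable {A : Type u} [CommRing A] {w : Weight}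
variable {I J : Type} [Fintype I] [Fintype J] [DecidableEq I] [DecidableEq J]

theorem fromBlocks_mul_fromBlocks_self {S : Type*} [CommRing S] {w : S} (M : MatFac S I J w) :
    fromBlocks 0 M.ψ M.φ 0 * fromBlocks 0 M.ψ M.φ 0 = w • 1 := by
  simp [fromBlocks_multiply, M.φ_mul_ψ, M.ψ_mul_φ, ← fromBlocks_one, fromBlocks_smul]

/-- A gauge transformation of a matrix factorization into an operator of the form `θ(P, Q)` is an
isomorphism with `θ(P, Q)`. -/
theorem exists_hom_theta {π : A} {M : MatFac (PS₂ A) (J ⊕ I) (J ⊕ I) (PS₂.xy A - MvPowerSeries.C π)}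
    {d : Gauge A I J} (hσ : IsUnit d.σ) (hτ : IsUnit d.τ)
    (h : d.F * fromBlocks 0 M.ψ M.φ 0 = (koszul A I J + d.C) * d.F) :
    ∃ N : MatFac A I J π, N.φ = d.P ∧ N.ψ = d.Q ∧ ∃ F : Hom M N.theta, F.σ = d.σ ∧ F.τ = d.τ := by
  obtain ⟨σ', h₁, h₂⟩ := hσ.isInvertible
  obtain ⟨τ', h₃, h₄⟩ := hτ.isInvertible
  obtain ⟨V, hV⟩ : ∃ V, d.F * V = 1 := ⟨fromBlocks σ' 0 0 τ', by
    simp [Gauge.F, fromBlocks_multiply, h₁, h₃]⟩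
  -- Conjugation by F carries D² = xy - π to (K + C)² = xy - π. Subtracting K² = xy and the
  -- vanishing cross terms leaves C² = -π, which says that PQ and QP equal π.
  have hC : (koszul A I J + d.C) * (koszul A I J + d.C) =
      (PS₂.xy A - MvPowerSeries.C π) • 1 := by
    have e : (koszul A I J + d.C) * (koszul A I J + d.C) * d.F =
        (PS₂.xy A - MvPowerSeries.C π) • d.F := by
      rw [Matrix.mul_assoc, ← h, ← Matrix.mul_assoc, ← h, Matrix.mul_assoc,
        M.fromBlocks_mul_fromBlocks_self, Matrix.mul_smul, Matrix.mul_one]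
    have := congrArg (· * V) e
    simpa only [Matrix.mul_assoc, Matrix.smul_mul, hV, Matrix.mul_one] using this
  have hC' : d.C * d.C = -(MvPowerSeries.C π : PS₂ A) •
      (1 : Matrix ((J ⊕ I) ⊕ (J ⊕ I)) ((J ⊕ I) ⊕ (J ⊕ I)) (PS₂ A)) := by
    have e : (koszul A I J + d.C) * (koszul A I J + d.C) = koszul A I J * koszul A I J +
        (koszul A I J * d.C + d.C * koszul A I J) + d.C * d.C := by noncomm_ring
    rw [e, koszul_mul_koszul, Gauge.C, koszul_mul_perturbation, add_zero, sub_eq_add_neg,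
      add_smul, add_right_inj] at hC
    exact hC
  have hPQ : ∀ {m : Type} [DecidableEq m] {X : Matrix m m A},
      -(X.map (MvPowerSeries.C : A →+* PS₂ A)) = -((MvPowerSeries.C π : PS₂ A) • 1) →
        X = π • 1 := by
    intro m _ X hX
    rw [neg_inj] at hX
    ext1 i j
    have := congrArg (MvPowerSeries.constantCoeff : PS₂ A →+* A) (congrFun (congrFun hX i) j)
    simpa [Matrix.one_apply, apply_ite] using this
  simp only [Gauge.C, perturbation, fromBlocks_multiply, ← fromBlocks_one, fromBlocks_smul,
    fromBlocks_inj, Matrix.mul_zero, Matrix.zero_mul, zero_add, add_zero, Matrix.neg_mul,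
    Matrix.mul_neg, ← Matrix.map_mul] at hC'
  simp only [neg_smul] at hC'
  obtain ⟨⟨e₁, -, -, e₂⟩, -⟩ := hC'
  refine ⟨⟨d.P, d.Q, hPQ e₁, hPQ e₂⟩, rfl, rfl, ⟨d.σ, d.τ, ?_, ?_⟩, rfl, rfl⟩
  all_goals
    have e := koszul_add_perturbation (⟨d.P, d.Q, hPQ e₁, hPQ e₂⟩ : MatFac A I J π)
    rw [Gauge.C, e, Gauge.F, fromBlocks_multiply, fromBlocks_multiply, fromBlocks_inj] at h
    simp only [Matrix.mul_zero, Matrix.zero_mul, zero_add, add_zero, true_and, and_true] at h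
  exacts [h.2.symm, h.1.symm]

end MatFac

/-! ### Reduced matrix factorizations of `xy - π` -/

/-- Idempotent matrices over a field split. -/
theorem Matrix.exists_idempotent_splitting {k : Type*} [Field k] {J : Type} [Fintype J]
    [DecidableEq J] {e : Matrix J J k} (he : e * e = e) :
    ∃ (a : ℕ) (u : Matrix J (Fin a) k) (v : Matrix (Fin a) J k), u * v = e ∧ v * u = 1 := by
  set f := Matrix.toLin' e
  have hf : f ∘ₗ f = f := by rw [← Matrix.toLin'_mul, he]
  let B := Pi.basisFun k J
  let C := Module.finBasis k (LinearMap.range f)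
  refine ⟨_, LinearMap.toMatrix C B (LinearMap.range f).subtype,
    LinearMap.toMatrix B C f.rangeRestrict, ?_, ?_⟩
  · rw [← LinearMap.toMatrix_comp]
    change LinearMap.toMatrix B B f = e
    exact LinearMap.toMatrix'_toLin' e
  · rw [← LinearMap.toMatrix_comp, ← LinearMap.toMatrix_id C]
    congr 1
    ext ⟨_, x, rfl⟩ : 2
    exact LinearMap.congr_fun hf x

/-! ### Linear parts and the Clifford relations -/

namespace PS₂

universe u
set_option linter.unusedSectionVars false

variable {A : Type u} [CommRing A] {m n l : Type*}

theorem matCoeff_mul [Fintype n] (M : Matrix m n (PS₂ A)) (N : Matrix n l (PS₂ A)) :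
    matCoeff A m l (M * N) = matCoeff A m n M * matCoeff A n l N :=
  Matrix.map_mul (f := (MvPowerSeries.constantCoeff : PS₂ A →+* A))

theorem matCoeff_one [DecidableEq m] : matCoeff A m m 1 = 1 :=
  Matrix.map_one (MvPowerSeries.constantCoeff : PS₂ A →+* A) (map_zero _) (map_one _)

/-- The linear parts of matrices `M`, `N` without constant terms and with product `xy` satisfy the
Clifford relations. -/
theorem clifford_relations [Fintype n] [DecidableEq m] {M : Matrix m n (PS₂ A)}
    {N : Matrix n m (PS₂ A)} (hM : matCoeff A _ _ M = 0) (hN : matCoeff A _ _ N = 0)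
    (h : M * N = PS₂.xy A • 1) :
    matCoeff A _ _ (matShiftX A _ _ M) * matCoeff A _ _ (matShiftX A _ _ N) = 0 ∧
    matCoeff A _ _ (matShiftY A _ _ M) * matCoeff A _ _ (matShiftY A _ _ N) = 0 ∧
    matCoeff A _ _ (matShiftX A _ _ M) * matCoeff A _ _ (matShiftY A _ _ N) +
      matCoeff A _ _ (matShiftY A _ _ M) * matCoeff A _ _ (matShiftX A _ _ N) = 1 := by
  have eM := matrix_eq_C_add_shift M
  have eN := matrix_eq_C_add_shift N
  rw [hM, Matrix.map_zero _ (map_zero _), zero_add] at eM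
  rw [hN, Matrix.map_zero _ (map_zero _), zero_add] at eN
  rw [← matCoeff_mul, ← matCoeff_mul, ← matCoeff_mul, ← matCoeff_mul, ← map_add]
  set M₁ := matShiftX A _ _ M
  set M₂ := matShiftY A _ _ M
  set N₁ := matShiftX A _ _ N
  set N₂ := matShiftY A _ _ N
  -- The coefficients of x², xy and y² are still power series here; two successive divisions
  -- followed by evaluation at the origin isolate their constant terms.
  have e : (MvPowerSeries.X 0 : PS₂ A) • (MvPowerSeries.X 0 : PS₂ A) • (M₁ * N₁) +
      (MvPowerSeries.X 0 : PS₂ A) • (MvPowerSeries.X 1 : PS₂ A) • (M₁ * N₂ + M₂ * N₁) +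
      (MvPowerSeries.X 1 : PS₂ A) • (MvPowerSeries.X 1 : PS₂ A) • (M₂ * N₂) =
      (MvPowerSeries.X 0 : PS₂ A) • (MvPowerSeries.X 1 : PS₂ A) • 1 := by
    rw [smul_smul (MvPowerSeries.X 0 : PS₂ A) (MvPowerSeries.X 1) (1 : Matrix m m (PS₂ A)), ← h,
      eM, eN]
    simp only [Matrix.add_mul, Matrix.mul_add, Matrix.smul_mul, Matrix.mul_smul, smul_add]
    rw [smul_comm (MvPowerSeries.X 1 : PS₂ A) (MvPowerSeries.X 0 : PS₂ A)]
    abel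
  have e₁ := congrArg (matShiftX A _ _) e
  have e₂ := congrArg (matCoeff A _ _) (congrArg (matShiftX A _ _) e₁)
  have e₃ := congrArg (matCoeff A _ _) (congrArg (matShiftY A _ _) e₁)
  have e₄ := congrArg (matCoeff A _ _) (congrArg (matShiftY A _ _) (congrArg (matShiftY A _ _) e))
  simp only [map_add, map_sub, matShiftX_X_zero_smul, matShiftX_X_one_smul, matShiftY_X_zero_smul,
    matShiftY_X_one_smul, matCoeff_X_smul, add_zero, zero_add, sub_zero, map_zero, matCoeff_one]
    at e₂ e₃ e₄
  exact ⟨e₂, e₄, by rw [map_add]; exact e₃⟩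

end PS₂

/-! ### From a standard linear part to θ(P, Q) -/

namespace PS₂

universe u
set_option linter.unusedSectionVars false

variable {A : Type u} [CommRing A] {𝔪 : Ideal A}

/-- Step 1 of the doubled filtration restricts the constant term only: multiples of x and y already
have weight 1. -/
theorem mem_level_double_one {f : PS₂ A} (h : MvPowerSeries.constantCoeff f ∈ 𝔪) :
    f ∈ level 𝔪 (Weight.double.e 1) := by
  have hX (s : Fin 2) : (MvPowerSeries.X s : PS₂ A) ∈ level 𝔪 (Weight.double.e 1) :=
    X_mem_level s rfl
  have h0 (f : PS₂ A) : f ∈ level 𝔪 (Weight.double.e 0) := fun d => by simp [Weight.zero]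
  rw [eq_C_add_shift f]
  exact add_mem (add_mem (C_mem_level (by simpa [Weight.double] using h))
    (mul_mem_level (Weight.double.add_le 1 0) (hX 0) (h0 _)))
    (mul_mem_level (Weight.double.add_le 1 0) (hX 1) (h0 _))

/-- Step 2 restricts exactly the coefficients of degree at most one, since x², xy and y² have weight
2. -/
theorem mem_level_double_two {f : PS₂ A} (h₀ : MvPowerSeries.constantCoeff f ∈ 𝔪)
    (h₁ : MvPowerSeries.constantCoeff (shiftX A f) ∈ 𝔪)
    (h₂ : MvPowerSeries.constantCoeff (shiftY A f) ∈ 𝔪) : f ∈ level 𝔪 (Weight.double.e 2) := by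
  have hX (s : Fin 2) : (MvPowerSeries.X s : PS₂ A) ∈ level 𝔪 (Weight.double.e 1) :=
    X_mem_level s rfl
  rw [eq_C_add_shift f]
  exact add_mem (add_mem (C_mem_level (by simpa [Weight.double] using h₀))
    (mul_mem_level (Weight.double.add_le 1 1) (hX 0) (mem_level_double_one h₁)))
    (mul_mem_level (Weight.double.add_le 1 1) (hX 1) (mem_level_double_one h₂))

theorem shiftX_map {B : Type*} [CommRing B] (r : A →+* B) (f : PS₂ A) :
    shiftX B (MvPowerSeries.map r f) = MvPowerSeries.map r (shiftX A f) := by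
  ext d
  rw [coeff_shiftX, MvPowerSeries.coeff_map, MvPowerSeries.coeff_map, coeff_shiftX]

theorem shiftY_map {B : Type*} [CommRing B] (r : A →+* B) (f : PS₂ A) :
    shiftY B (MvPowerSeries.map r f) = MvPowerSeries.map r (shiftY A f) := by
  ext d
  rw [coeff_shiftY, MvPowerSeries.coeff_map, MvPowerSeries.coeff_map, coeff_shiftY]
  split_ifs <;> simp

@[simp] theorem matShiftX_C {m n : Type*} (P : Matrix m n A) :
    matShiftX A m n (P.map (MvPowerSeries.C : A →+* PS₂ A)) = 0 := by
  ext1 i j; simp [matShiftX_apply]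

/-- A matrix whose reduction has no terms of degree at most one is small. -/
theorem mem_fil_double_two [IsLocalRing A] {m n : Type*} {M : Matrix m n (PS₂ A)}
    {N : Matrix m n (PS₂ (IsLocalRing.ResidueField A))}
    (h : M.map (MvPowerSeries.map (IsLocalRing.residue A)) = N) (h₀ : matCoeff _ _ _ N = 0)
    (h₁ : matCoeff _ _ _ (matShiftX _ _ _ N) = 0) (h₂ : matCoeff _ _ _ (matShiftY _ _ _ N) = 0) :
    M ∈ fil Weight.double (IsLocalRing.maximalIdeal A) m n 2 := by
  subst h
  intro i j
  refine mem_level_double_two ?_ ?_ ?_ <;> rw [← IsLocalRing.residue_eq_zero_iff]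
  · simpa [matCoeff_apply] using congrFun (congrFun h₀ i) j
  · simpa [matCoeff_apply, matShiftX_apply, shiftX_map] using congrFun (congrFun h₁ i) j
  · simpa [matCoeff_apply, matShiftY_apply, shiftY_map] using congrFun (congrFun h₂ i) j

end PS₂

namespace MatFac

universe u
set_option linter.unusedSectionVars false

open PS₂

/-- The normal form of the Clifford relations. -/
theorem exists_clifford_basis {k : Type*} [Field k] {I J : Type} [Fintype I] [Fintype J]
    [DecidableEq I] [DecidableEq J] {φx φy : Matrix J I k} {ψx ψy : Matrix I J k}
    (h₁ : φx * ψx = 0) (h₂ : φy * ψy = 0) (h₃ : φx * ψy + φy * ψx = 1)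
    (h₄ : ψx * φx = 0) (h₅ : ψy * φy = 0) (h₆ : ψx * φy + ψy * φx = 1) :
    ∃ (a b : ℕ) (σ : Matrix (Fin a ⊕ Fin b) I k) (σ' : Matrix I (Fin a ⊕ Fin b) k)
      (τ : Matrix (Fin a ⊕ Fin b) J k) (τ' : Matrix J (Fin a ⊕ Fin b) k),
      σ * σ' = 1 ∧ σ' * σ = 1 ∧ τ * τ' = 1 ∧ τ' * τ = 1 ∧
      τ * φx * σ' = fromBlocks 1 0 0 0 ∧ τ * φy * σ' = fromBlocks 0 0 0 (-1) ∧
      σ * ψx * τ' = fromBlocks 0 0 0 (-1) ∧ σ * ψy * τ' = fromBlocks 1 0 0 0 := by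
  -- The Clifford relations make φx ψy and φy ψx complementary idempotents of k^J. Their ranges, of
  -- dimensions a and b, are the two isotypic blocks.
  have e₁ : φx * ψy * (φx * ψy) = φx * ψy := by
    rw [Matrix.mul_assoc, ← Matrix.mul_assoc ψy, eq_sub_of_add_eq' h₆, Matrix.sub_mul,
      Matrix.one_mul, Matrix.mul_assoc, h₂, Matrix.mul_zero, sub_zero]
  have e₂ : φy * ψx * (φy * ψx) = φy * ψx := by
    rw [Matrix.mul_assoc, ← Matrix.mul_assoc ψx, eq_sub_of_add_eq h₆, Matrix.sub_mul,
      Matrix.one_mul, Matrix.mul_assoc, h₁, Matrix.mul_zero, sub_zero]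
  obtain ⟨a, u, v, huv, hvu⟩ := Matrix.exists_idempotent_splitting e₁
  obtain ⟨b, u', v', huv', hvu'⟩ := Matrix.exists_idempotent_splitting e₂
  have k₁ : φx * (ψy * u) = u := by
    rw [← Matrix.mul_assoc, ← huv, Matrix.mul_assoc, hvu, Matrix.mul_one]
  have k₂ : φy * (ψx * u') = u' := by
    rw [← Matrix.mul_assoc, ← huv', Matrix.mul_assoc, hvu', Matrix.mul_one]
  have k₃ : φx * (ψx * u') = 0 := by rw [← Matrix.mul_assoc, h₁, Matrix.zero_mul]
  have k₄ : φy * (ψy * u) = 0 := by rw [← Matrix.mul_assoc, h₂, Matrix.zero_mul]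
  have k₅ : ψx * u = 0 := by rw [← k₁, ← Matrix.mul_assoc, h₄, Matrix.zero_mul]
  have k₆ : ψy * u' = 0 := by rw [← k₂, ← Matrix.mul_assoc, h₅, Matrix.zero_mul]
  have k₇ : v * u' = 0 := by
    rw [← Matrix.one_mul (v * u'), ← hvu, Matrix.mul_assoc, ← Matrix.mul_assoc u, huv,
      Matrix.mul_assoc φx, k₆, Matrix.mul_zero, Matrix.mul_zero]
  have k₈ : v' * u = 0 := by
    rw [← Matrix.one_mul (v' * u), ← hvu', Matrix.mul_assoc, ← Matrix.mul_assoc u', huv',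
      Matrix.mul_assoc φy, k₅, Matrix.mul_zero, Matrix.mul_zero]
  have k₉ : ψy * (u * (v * φx)) + ψx * (u' * (v' * φy)) = 1 := by
    have i₁ : φx * (ψy * φx) = φx := by
      rw [eq_sub_of_add_eq' h₆, Matrix.mul_sub, ← Matrix.mul_assoc, h₁, Matrix.zero_mul, sub_zero,
        Matrix.mul_one]
    have i₂ : φy * (ψx * φy) = φy := by
      rw [eq_sub_of_add_eq h₆, Matrix.mul_sub, ← Matrix.mul_assoc, h₂, Matrix.zero_mul, sub_zero,
        Matrix.mul_one]
    rw [← Matrix.mul_assoc u, huv, ← Matrix.mul_assoc u', huv', Matrix.mul_assoc φx, i₁,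
      Matrix.mul_assoc φy, i₂, add_comm, h₆]
  -- Bases of the two ranges are carried to k^I by ψy and by -ψx; the sign in the second produces
  -- the entries -1 of K.
  refine ⟨a, b, fromRows (v * φx) (-(v' * φy)), fromCols (ψy * u) (-(ψx * u')), fromRows v v',
    fromCols u u', ?_, ?_, ?_, ?_, ?_, ?_, ?_, ?_⟩
  · simp [Matrix.mul_assoc, k₁, k₂, k₃, k₄, hvu, hvu']
  · simp [fromCols_mul_fromRows, Matrix.mul_assoc, k₉]
  · simp [hvu, hvu', k₇, k₈]
  · rw [fromCols_mul_fromRows, huv, huv', h₃]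
  all_goals
    rw [← fromCols_fromRows_eq_fromBlocks]
    simp [fromRows_mul, Matrix.mul_assoc, k₁, k₂, k₃, k₄, k₅, k₆, k₇, k₈,
      hvu, hvu']

variable {A : Type u} [CommRing A] [IsLocalRing A]
  [IsAdicComplete (IsLocalRing.maximalIdeal A) A]
variable {I J : Type} [Fintype I] [Fintype J] [DecidableEq I] [DecidableEq J]

/-- Every reduced matrix factorization of `xy - π` is isomorphic to some `θ(P, Q)`. -/
theorem exists_hEquiv_theta (s : IsLocalRing.ResidueField A →+* A)
    (hs : ∀ a, IsLocalRing.residue A (s a) = a) {π : A} (hπ : π ∈ IsLocalRing.maximalIdeal A)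
    (M : MatFac (PS₂ A) I J (PS₂.xy A - MvPowerSeries.C π)) (hM : M.IsReduced) :
    ∃ (a b : ℕ) (N : MatFac A (Fin b) (Fin a) π), M.HEquiv N.theta := by
  set R : PS₂ A →+* PS₂ (IsLocalRing.ResidueField A) :=
    MvPowerSeries.map (IsLocalRing.residue A) with hR
  have hw : R (PS₂.xy A - MvPowerSeries.C π) = PS₂.xy _ := by
    simp [hR, (IsLocalRing.residue_eq_zero_iff π).2 hπ]
  have hφ : matCoeff _ _ _ (M.φ.map R) = 0 := by
    ext1 i j
    simpa [matCoeff_apply, hR] using mem_maximalIdeal_iff.1 (hM.1 i j)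
  have hψ : matCoeff _ _ _ (M.ψ.map R) = 0 := by
    ext1 i j
    simpa [matCoeff_apply, hR] using mem_maximalIdeal_iff.1 (hM.2 i j)
  obtain ⟨h₁, h₂, h₃⟩ := clifford_relations hφ hψ ((M.map R).φ_mul_ψ.trans (by rw [hw]))
  obtain ⟨h₄, h₅, h₆⟩ := clifford_relations hψ hφ ((M.map R).ψ_mul_φ.trans (by rw [hw]))
  obtain ⟨a, b, σ, σ', τ, τ', i₁, i₂, i₃, i₄, j₁, j₂, j₃, j₄⟩ :=
    exists_clifford_basis h₁ h₂ h₃ h₄ h₅ h₆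
  set c : IsLocalRing.ResidueField A →+* PS₂ A := (MvPowerSeries.C : A →+* PS₂ A).comp s with hc
  have hRc (x : IsLocalRing.ResidueField A) : R (c x) = MvPowerSeries.C x := by
    simp [hR, hc, hs]
  have hmap {m n : Type} [Fintype m] [Fintype n] [DecidableEq m]
      {x : Matrix m n (IsLocalRing.ResidueField A)} {y : Matrix n m (IsLocalRing.ResidueField A)}
      (h : x * y = 1) : x.map c * y.map c = 1 := by
    rw [← Matrix.map_mul, h, Matrix.map_one _ (map_zero _) (map_one _)]
  obtain ⟨M', e, e', f, hσ, hτ⟩ := M.exists_transport (hmap i₁) (hmap i₂) (hmap i₃) (hmap i₄)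
  have hf : f.IsIso := ⟨hσ ▸ ⟨_, hmap i₁, hmap i₂⟩, hτ ▸ ⟨_, hmap i₃, hmap i₄⟩⟩
  -- For the doubled filtration 1 + s is 2. Modulo 𝔪 the operators agree in degrees 0 and 1, which
  -- is all that step 2 requires; in higher degrees the difference need not lie in 𝔪, so the 𝔪-adic
  -- filtration would not do.
  have hD : fromBlocks 0 M'.ψ M'.φ 0 - koszul A (Fin b) (Fin a) ∈
      fil Weight.double (IsLocalRing.maximalIdeal A) _ _ (1 + 1) := by
    have hc₁ {m : Type} {n : Type} (x : Matrix m n (IsLocalRing.ResidueField A)) :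
        (x.map c).map R = x.map MvPowerSeries.C := by ext1 i j; exact hRc _
    have hsub {m n : Type} (x y : Matrix m n (PS₂ A)) : (x - y).map R = x.map R - y.map R :=
      Matrix.map_sub _ (map_sub R) _ _
    have hkφ : (fromBlocks ((MvPowerSeries.X 0 : PS₂ A) • 1) 0 0
        (-((MvPowerSeries.X 1 : PS₂ A) • 1)) : Matrix (Fin a ⊕ Fin b) (Fin a ⊕ Fin b) (PS₂ A)).map R =
        (MvPowerSeries.X 0 : PS₂ (IsLocalRing.ResidueField A)) • (fromBlocks 1 0 0 0 : Matrix (Fin a ⊕ Fin b) (Fin a ⊕ Fin b) (IsLocalRing.ResidueField A)).map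
          MvPowerSeries.C + (MvPowerSeries.X 1 : PS₂ (IsLocalRing.ResidueField A)) • (fromBlocks 0 0 0 (-1) :
          Matrix (Fin a ⊕ Fin b) (Fin a ⊕ Fin b) (IsLocalRing.ResidueField A)).map MvPowerSeries.C := by
      ext1 (i | i) (j | j) <;> simp [hR, Matrix.one_apply] <;> split_ifs <;> simp
    have hkψ : (fromBlocks ((MvPowerSeries.X 1 : PS₂ A) • 1) 0 0
        (-((MvPowerSeries.X 0 : PS₂ A) • 1)) : Matrix (Fin a ⊕ Fin b) (Fin a ⊕ Fin b) (PS₂ A)).map R =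
        (MvPowerSeries.X 0 : PS₂ (IsLocalRing.ResidueField A)) • (fromBlocks 0 0 0 (-1) : Matrix (Fin a ⊕ Fin b) (Fin a ⊕ Fin b) (IsLocalRing.ResidueField A)).map
          MvPowerSeries.C + (MvPowerSeries.X 1 : PS₂ (IsLocalRing.ResidueField A)) • (fromBlocks 1 0 0 0 :
          Matrix (Fin a ⊕ Fin b) (Fin a ⊕ Fin b) (IsLocalRing.ResidueField A)).map MvPowerSeries.C := by
      ext1 (i | i) (j | j) <;> simp [hR, Matrix.one_apply] <;> split_ifs <;> simp
    rw [koszul, sub_eq_add_neg, fromBlocks_neg, fromBlocks_add, fromBlocks_mem_fil]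
    simp only [← sub_eq_add_neg]
    refine ⟨by simp, ?_, ?_, by simp⟩
    · refine mem_fil_double_two (by rw [hsub, e', hkψ, Matrix.map_mul, Matrix.map_mul, hc₁, hc₁])
        ?_ ?_ ?_
      · simp [hψ]
      · simp [j₃]
      · simp [j₄]
    · refine mem_fil_double_two (by rw [hsub, e, hkφ, Matrix.map_mul, Matrix.map_mul, hc₁, hc₁])
        ?_ ?_ ?_
      · simp [hφ]
      · simp [j₁]
      · simp [j₂]
  obtain ⟨d, hd, -, -, h⟩ := exists_gauge (w := Weight.double) hD M'.fromBlocks_mul_fromBlocks_self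
  obtain ⟨hσ', hτ'⟩ := Gauge.isUnit hd
  obtain ⟨N, -, -, F, hF, hF'⟩ := exists_hom_theta hσ' hτ' h
  exact ⟨a, b, N, hf.hEquiv.trans (Hom.IsIso.hEquiv (f := F)
    ⟨hF ▸ hσ'.isInvertible, hF' ▸ hτ'.isInvertible⟩)⟩

end MatFac

/-- `θ` is an equivalence of categories. -/
theorem thetaFunctor_isEquivalence {A : Type*} [CommRing A] [IsLocalRing A]
    [IsAdicComplete (IsLocalRing.maximalIdeal A) A] (s : IsLocalRing.ResidueField A →+* A)
    (hs : ∀ a, IsLocalRing.residue A (s a) = a) {π : A} (hπ : π ∈ IsLocalRing.maximalIdeal A) :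
    (thetaFunctor π).IsEquivalence where
  essSurj := by
    refine ⟨fun Y => ?_⟩
    obtain ⟨I, J, _, _, _, _, M', hM', h⟩ := Y.as.mf.exists_hEquiv_isReduced
    obtain ⟨a, b, N, h'⟩ := MatFac.exists_hEquiv_theta s hs hπ M' hM'
    obtain ⟨e⟩ := MatFac.hEquiv_iff.1 (h.trans h')
    exact ⟨N.toHMF, ⟨e.symm⟩⟩

/-! ### Constant forms -/

namespace PS₂

universe u
set_option linter.unusedSectionVars false

variable {A : Type u} [CommRing A]
variable {I J : Type} [Fintype I] [Fintype J] [DecidableEq I] [DecidableEq J]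

/-- A constant form for which the operator of `θ(0, 0)` is self-adjoint or skew-adjoint. -/
structure ConstForm (A : Type u) [CommRing A] (I J : Type) [Fintype I] [Fintype J]
    [DecidableEq I] [DecidableEq J] (η : ℤˣ) (δ : A) where
  B : Matrix ((J ⊕ I) ⊕ (J ⊕ I)) ((J ⊕ I) ⊕ (J ⊕ I)) (PS₂ A)
  B' : Matrix ((J ⊕ I) ⊕ (J ⊕ I)) ((J ⊕ I) ⊕ (J ⊕ I)) (PS₂ A)
  mul_inv : B * B' = 1
  inv_mul : B' * B = 1
  transpose_eq : Bᵀ = η • B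
  comm_koszul : (koszul A I J)ᵀ * B = δ • (B * koszul A I J)
  sq : δ * δ = 1
  map_even : ∀ σ τ, ∃ σ' τ', B' * (fromBlocks σ 0 0 τ)ᵀ * B = fromBlocks σ' 0 0 τ'
  map_perturbation : ∀ P Q, ∃ P' Q', B' * (perturbation P Q)ᵀ * B = perturbation P' Q'

variable {η : ℤˣ} {δ : A}

theorem units_smul_smul {G : Type*} [AddCommGroup G] (η : ℤˣ) (x : G) : η • η • x = x := by
  rw [smul_smul, Int.units_mul_self, one_smul]

theorem map_C_neg {m n : Type*} (M : Matrix m n A) :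
    (-M).map (MvPowerSeries.C : A →+* PS₂ A) = -M.map (MvPowerSeries.C : A →+* PS₂ A) :=
  Matrix.map_neg _ (map_neg _) M

theorem ConstForm.transpose_inv (b : ConstForm A I J η δ) : b.B'ᵀ = η • b.B' := by
  have h := congrArg Matrix.transpose b.mul_inv
  rw [transpose_mul, b.transpose_eq, transpose_one] at h
  calc b.B'ᵀ = b.B'ᵀ * (η • η • b.B) * b.B' := by
        rw [units_smul_smul, Matrix.mul_assoc, b.mul_inv, Matrix.mul_one]
    _ = η • (b.B'ᵀ * (η • b.B)) * b.B' := by rw [Matrix.mul_smul _ η]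
    _ = η • b.B' := by rw [h, Matrix.smul_mul, Matrix.one_mul]

/-- The anti-involution defined by a constant form. -/
noncomputable def ConstForm.antiInvolution (b : ConstForm A I J η δ) (w : Weight) (𝔪 : Ideal A) :
    AntiInvolution w 𝔪 I J δ where
  adj :=
    { toFun := fun X => b.B' * Xᵀ * b.B
      map_add' := fun X Y => by rw [transpose_add, Matrix.mul_add, Matrix.add_mul]
      map_smul' := fun a X => by
        rw [transpose_smul, Matrix.mul_smul, Matrix.smul_mul, RingHom.id_apply] }
  adj_one := by simp [b.inv_mul]
  adj_mul X Y := by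
    change b.B' * (X * Y)ᵀ * b.B = b.B' * Yᵀ * b.B * (b.B' * Xᵀ * b.B)
    rw [transpose_mul]
    simp only [Matrix.mul_assoc]
    rw [← Matrix.mul_assoc b.B b.B', b.mul_inv, Matrix.one_mul]
  adj_adj X := by
    change b.B' * (b.B' * Xᵀ * b.B)ᵀ * b.B = X
    rw [transpose_mul, transpose_mul, transpose_transpose, b.transpose_eq, b.transpose_inv]
    simp only [Matrix.smul_mul, Matrix.mul_smul, units_smul_smul]
    rw [← Matrix.mul_assoc, b.inv_mul, Matrix.one_mul, Matrix.mul_assoc, b.inv_mul, Matrix.mul_one]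
  adj_mem n X hX := mul_mem_fil_right _ (mul_mem_fil_left _ (transpose_mem_fil hX))
  adj_even := b.map_even
  adj_perturbation := b.map_perturbation
  adj_koszul := by
    change b.B' * _ * b.B = _
    rw [Matrix.mul_assoc, b.comm_koszul, Matrix.mul_smul, ← Matrix.mul_assoc, b.inv_mul,
      Matrix.one_mul]
  sq := b.sq

/-- A gauge transformation compatible with forms. -/
theorem exists_isometric_gauge [IsLocalRing A] [IsAdicComplete (IsLocalRing.maximalIdeal A) A]
    [Invertible (2 : A)] {w : Weight} (b : ConstForm A I J η δ)
    {φ ψ : Matrix (J ⊕ I) (J ⊕ I) (PS₂ A)} {π : A}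
    (hD : fromBlocks 0 ψ φ 0 - koszul A I J ∈ fil w (IsLocalRing.maximalIdeal A) _ _ (1 + w.s))
    (hD₂ : fromBlocks 0 ψ φ 0 * fromBlocks 0 ψ φ 0 = (PS₂.xy A - MvPowerSeries.C π) •
      (1 : Matrix ((J ⊕ I) ⊕ (J ⊕ I)) ((J ⊕ I) ⊕ (J ⊕ I)) (PS₂ A)))
    {B : Matrix ((J ⊕ I) ⊕ (J ⊕ I)) ((J ⊕ I) ⊕ (J ⊕ I)) (PS₂ A)}
    (hB : Bᵀ = η • B) (hB' : ∃ σ τ, b.B' * B = fromBlocks σ 0 0 τ)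
    (hBb : B - b.B ∈ fil w (IsLocalRing.maximalIdeal A) _ _ 1)
    (hDB : (fromBlocks 0 ψ φ 0)ᵀ * B = δ • (B * fromBlocks 0 ψ φ 0)) :
    ∃ d : Gauge A I J, d.F - 1 ∈ fil w (IsLocalRing.maximalIdeal A) _ _ 1 ∧
      (∀ i j, d.P i j ∈ IsLocalRing.maximalIdeal A ^ w.e (1 + w.s) 0) ∧
      (∀ i j, d.Q i j ∈ IsLocalRing.maximalIdeal A ^ w.e (1 + w.s) 0) ∧
      d.F * fromBlocks 0 ψ φ 0 = (koszul A I J + d.C) * d.F ∧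
      d.Fᵀ * b.B * d.F = B ∧ d.Cᵀ * b.B = δ • (b.B * d.C) := by
  have cancel {X Y : Matrix ((J ⊕ I) ⊕ (J ⊕ I)) ((J ⊕ I) ⊕ (J ⊕ I)) (PS₂ A)}
      (h : b.B' * X = Y) : X = b.B * Y := by
    rw [← h, ← Matrix.mul_assoc, b.mul_inv, Matrix.one_mul]
  -- With X* = b⁻¹ Xᵀ b, the isometry condition Fᵀ b F = B reads F* F = b⁻¹ B, and compatibility of
  -- B with D becomes D* T = δ T D for T = b⁻¹ B.
  obtain ⟨d, h₁, h₂, h₃, h₄, h₅, h₆⟩ := exists_unitary_gauge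
    (b.antiInvolution w (IsLocalRing.maximalIdeal A)) hD hD₂ (T := b.B' * B) (by
      change b.B' * (b.B' * B)ᵀ * b.B = b.B' * B
      rw [transpose_mul, hB, b.transpose_inv]
      simp only [Matrix.smul_mul, Matrix.mul_smul, units_smul_smul]
      rw [Matrix.mul_assoc, Matrix.mul_assoc, b.inv_mul, Matrix.mul_one]) hB' (by
      rw [← b.inv_mul, ← Matrix.mul_sub]
      exact mul_mem_fil_left _ hBb) (by
      change b.B' * _ * b.B * (b.B' * B) = _
      rw [Matrix.mul_assoc, ← Matrix.mul_assoc b.B, b.mul_inv, Matrix.one_mul, Matrix.mul_assoc,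
        hDB, Matrix.mul_smul, Matrix.mul_assoc])
  refine ⟨d, h₁, h₂, h₃, h₄, ?_, ?_⟩
  · have h := cancel (X := d.Fᵀ * b.B * d.F) (Y := b.B' * B) (by
      rw [← h₅]
      change _ = b.B' * d.Fᵀ * b.B * d.F
      simp only [Matrix.mul_assoc])
    rwa [← Matrix.mul_assoc, b.mul_inv, Matrix.one_mul] at h
  · have h := cancel (X := d.Cᵀ * b.B) (Y := δ • d.C) (by
      rw [← h₆]
      change _ = b.B' * d.Cᵀ * b.B
      simp only [Matrix.mul_assoc])
    rwa [Matrix.mul_smul] at h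

/-- The constant form given by forms `α` and `κ` of the same sign. -/
noncomputable def ConstForm.bilin {ε : ℤˣ} {α α' : Matrix J J A} {κ κ' : Matrix I I A}
    (hα : α * α' = 1) (hα' : α' * α = 1) (hκ : κ * κ' = 1) (hκ' : κ' * κ = 1)
    (hαt : αᵀ = ε • α) (hκt : κᵀ = ε • κ) : ConstForm A I J (-ε) (-1) where
  B := fromBlocks 0 (-(fromBlocks α 0 0 κ).map MvPowerSeries.C)
    ((fromBlocks α 0 0 κ).map MvPowerSeries.C) 0
  B' := fromBlocks 0 ((fromBlocks α' 0 0 κ').map MvPowerSeries.C)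
    (-(fromBlocks α' 0 0 κ').map MvPowerSeries.C) 0
  mul_inv := by
    simp [fromBlocks_map, fromBlocks_multiply, ← Matrix.map_mul, hα, hκ]
  inv_mul := by
    simp [fromBlocks_map, fromBlocks_multiply, ← Matrix.map_mul, hα', hκ']
  transpose_eq := by
    rcases Int.units_eq_one_or ε with rfl | rfl <;>
      simp [fromBlocks_transpose, fromBlocks_map, ← transpose_map, hαt, hκt, fromBlocks_neg, map_C_neg]
  comm_koszul := by
    simp [koszul, fromBlocks_transpose, fromBlocks_map, fromBlocks_multiply, fromBlocks_neg]
  sq := by simp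
  map_even σ τ := by
    simp only [fromBlocks_transpose, fromBlocks_multiply, Matrix.mul_zero, Matrix.zero_mul,
      transpose_zero, add_zero, zero_add]
    exact ⟨_, _, rfl⟩
  map_perturbation P Q := by
    refine ⟨α' * Qᵀ * κ, κ' * Pᵀ * α, ?_⟩
    simp [perturbation, fromBlocks_transpose, fromBlocks_map, fromBlocks_multiply, fromBlocks_neg,
      Matrix.map_mul, transpose_map]

/-- The constant form given by two matrices `μ` and `ν` transposed to each other. -/
noncomputable def ConstForm.twisted {η : ℤˣ} {μ : Matrix J I A} {μ' : Matrix I J A}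
    {ν : Matrix I J A} {ν' : Matrix J I A}
    (hμ : μ * μ' = 1) (hμ' : μ' * μ = 1) (hν : ν * ν' = 1) (hν' : ν' * ν = 1)
    (hμt : μᵀ = η • ν) (hνt : νᵀ = η • μ) : ConstForm A I J η 1 where
  B := fromBlocks ((fromBlocks 0 μ ν 0).map MvPowerSeries.C) 0 0
    (-(fromBlocks 0 μ ν 0).map MvPowerSeries.C)
  B' := fromBlocks ((fromBlocks 0 ν' μ' 0).map MvPowerSeries.C) 0 0
    (-(fromBlocks 0 ν' μ' 0).map MvPowerSeries.C)
  mul_inv := by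
    simp [fromBlocks_map, fromBlocks_multiply, ← Matrix.map_mul, hμ, hν]
  inv_mul := by
    simp [fromBlocks_map, fromBlocks_multiply, ← Matrix.map_mul, hμ', hν']
  transpose_eq := by
    rcases Int.units_eq_one_or η with rfl | rfl <;>
      simp [fromBlocks_transpose, fromBlocks_map, ← transpose_map, hμt, hνt, fromBlocks_neg, map_C_neg]
  comm_koszul := by
    simp [koszul, fromBlocks_transpose, fromBlocks_map, fromBlocks_multiply, fromBlocks_neg]
  sq := by simp
  map_even σ τ := by
    simp only [fromBlocks_transpose, fromBlocks_multiply, Matrix.mul_zero, Matrix.zero_mul,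
      transpose_zero, add_zero, zero_add]
    exact ⟨_, _, rfl⟩
  map_perturbation P Q := by
    refine ⟨-(ν' * Pᵀ * μ), -(μ' * Qᵀ * ν), ?_⟩
    simp [perturbation, fromBlocks_transpose, fromBlocks_map, fromBlocks_multiply, fromBlocks_neg,
      Matrix.map_mul, transpose_map, map_C_neg]

end PS₂

/-! ### Forms as matrices -/

namespace MatFac

universe u
set_option linter.unusedSectionVars false

open PS₂

section

variable {S : Type u} [CommRing S]
variable {I J : Type} [Fintype I] [Fintype J] [DecidableEq I] [DecidableEq J]
variable {I' J' : Type} [Fintype I'] [Fintype J'] [DecidableEq I'] [DecidableEq J']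
variable {I'' J'' : Type} [Fintype I''] [Fintype J''] [DecidableEq I''] [DecidableEq J'']
variable {w w' w'' : S} {ε : ℤˣ}

theorem Hom.IsIso.comp {M : MatFac S I J w} {M' : MatFac S I' J' w'} {M'' : MatFac S I'' J'' w''}
    {f : Hom M M'} {g : Hom M' M''} (hf : f.IsIso) (hg : g.IsIso) : (f.comp g).IsIso := by
  have key {l m n : Type} [Fintype l] [Fintype m] [Fintype n] [DecidableEq l] [DecidableEq m]
      [DecidableEq n] {x : Matrix l m S} {y : Matrix m n S} (hx : x.IsInvertible)
      (hy : y.IsInvertible) : (x * y).IsInvertible := by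
    obtain ⟨x', h₁, h₂⟩ := hx
    obtain ⟨y', h₃, h₄⟩ := hy
    refine ⟨y' * x', ?_, ?_⟩
    · rw [Matrix.mul_assoc, ← Matrix.mul_assoc y, h₃, Matrix.one_mul, h₁]
    · rw [Matrix.mul_assoc, ← Matrix.mul_assoc x', h₂, Matrix.one_mul, h₄]
  exact ⟨key hg.1 hf.1, key hg.2 hf.2⟩

theorem Hom.PreservesBilin.comp {M : MatFac S I J w} {M' : MatFac S I' J' w'}
    {M'' : MatFac S I'' J'' w''} {f : Hom M M'} {g : Hom M' M''} {b : BilinForm M ε}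
    {b' : BilinForm M' ε} {b'' : BilinForm M'' ε} (hf : f.PreservesBilin b b')
    (hg : g.PreservesBilin b' b'') : (f.comp g).PreservesBilin b b'' := by
  constructor
  · rw [← hf.1, ← hg.1]; simp only [Hom.comp, transpose_mul, Matrix.mul_assoc]
  · rw [← hf.2, ← hg.2]; simp only [Hom.comp, transpose_mul, Matrix.mul_assoc]

theorem Hom.PreservesTwisted.comp {M : MatFac S I J w} {M' : MatFac S I' J' w'}
    {M'' : MatFac S I'' J'' w''} {f : Hom M M'} {g : Hom M' M''} {q : TwistedForm M ε}
    {q' : TwistedForm M' ε} {q'' : TwistedForm M'' ε} (hf : f.PreservesTwisted q q')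
    (hg : g.PreservesTwisted q' q'') : (f.comp g).PreservesTwisted q q'' := by
  constructor
  · rw [← hf.1, ← hg.1]; simp only [Hom.comp, transpose_mul, Matrix.mul_assoc]
  · rw [← hf.2, ← hg.2]; simp only [Hom.comp, transpose_mul, Matrix.mul_assoc]

theorem isInvertible_congr {l m n o : Type} [Fintype l] [Fintype m] [Fintype n] [Fintype o]
    [DecidableEq l] [DecidableEq m] [DecidableEq n] [DecidableEq o] {x : Matrix l m S}
    {x' : Matrix m l S} {y : Matrix n o S} {y' : Matrix o n S} (hx : x * x' = 1) (hx' : x' * x = 1)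
    (hy : y * y' = 1) (hy' : y' * y = 1) {b : Matrix m n S} (hb : b.IsInvertible) :
    (x * b * y).IsInvertible := by
  obtain ⟨c, h₁, h₂⟩ := hb
  refine ⟨y' * c * x', ?_, ?_⟩
  · simp only [Matrix.mul_assoc]
    rw [← Matrix.mul_assoc y, hy, Matrix.one_mul, ← Matrix.mul_assoc b, h₁, Matrix.one_mul, hx]
  · simp only [Matrix.mul_assoc]
    rw [← Matrix.mul_assoc x', hx', Matrix.one_mul, ← Matrix.mul_assoc c, h₂, Matrix.one_mul, hy']

/-- The form on the target is the congruence of b by the inverse of f. -/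
theorem BilinForm.exists_transport {M : MatFac S I J w} {M' : MatFac S I' J' w'}
    (b : BilinForm M ε) {f : Hom M M'} (hf : f.IsIso) :
    ∃ b' : BilinForm M' ε, f.PreservesBilin b b' := by
  obtain ⟨σ, τ, hφ, hψ⟩ := f
  obtain ⟨⟨σ', h₁, h₂⟩, τ', h₃, h₄⟩ := hf
  dsimp only at h₁ h₂ h₃ h₄
  have e₁ : τ' * M'.φ = M.φ * σ' := by
    rw [← Matrix.mul_one (τ' * M'.φ), ← h₁, Matrix.mul_assoc, ← Matrix.mul_assoc M'.φ, hφ,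
      Matrix.mul_assoc, ← Matrix.mul_assoc, h₄, Matrix.one_mul]
  have e₂ : σ' * M'.ψ = M.ψ * τ' := by
    rw [← Matrix.mul_one (σ' * M'.ψ), ← h₃, Matrix.mul_assoc, ← Matrix.mul_assoc M'.ψ, hψ,
      Matrix.mul_assoc, ← Matrix.mul_assoc, h₂, Matrix.one_mul]
  have f₁ := congrArg Matrix.transpose e₁
  have f₂ := congrArg Matrix.transpose e₂
  rw [transpose_mul, transpose_mul] at f₁ f₂
  have t₁ : σᵀ * σ'ᵀ = 1 := by rw [← transpose_mul, h₂, transpose_one]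
  have t₂ : σ'ᵀ * σᵀ = 1 := by rw [← transpose_mul, h₁, transpose_one]
  have t₃ : τᵀ * τ'ᵀ = 1 := by rw [← transpose_mul, h₄, transpose_one]
  have t₄ : τ'ᵀ * τᵀ = 1 := by rw [← transpose_mul, h₃, transpose_one]
  refine ⟨⟨τ'ᵀ * b.b₀ * σ', σ'ᵀ * b.b₁ * τ', ?_, ?_, ?_, ?_, isInvertible_congr t₄ t₃ h₂ h₁ b.inv_b₀,
    isInvertible_congr t₂ t₁ h₄ h₃ b.inv_b₁⟩, ?_, ?_⟩
  · simp only [Matrix.mul_assoc]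
    rw [← Matrix.mul_assoc M'.φᵀ, f₁, e₁, ← Matrix.mul_assoc b.b₁, ← b.comm_φ]
    simp only [Matrix.mul_assoc, Matrix.neg_mul, Matrix.mul_neg]
  · simp only [Matrix.mul_assoc]
    rw [← Matrix.mul_assoc M'.ψᵀ, f₂, e₂, ← Matrix.mul_assoc b.b₀, ← b.comm_ψ]
    simp only [Matrix.mul_assoc, Matrix.neg_mul, Matrix.mul_neg]
  · rw [transpose_mul, transpose_mul, b.transpose_b₀, transpose_transpose]
    simp only [Matrix.mul_assoc, Matrix.neg_mul, Matrix.mul_neg, Matrix.smul_mul, Matrix.mul_smul]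
  · rw [transpose_mul, transpose_mul, b.transpose_b₁, transpose_transpose]
    simp only [Matrix.mul_assoc, Matrix.neg_mul, Matrix.mul_neg, Matrix.smul_mul, Matrix.mul_smul]
  · simp only [Matrix.mul_assoc]
    rw [h₂, Matrix.mul_one, ← Matrix.mul_assoc, t₃, Matrix.one_mul]
  · simp only [Matrix.mul_assoc]
    rw [h₄, Matrix.mul_one, ← Matrix.mul_assoc, t₁, Matrix.one_mul]

theorem TwistedForm.exists_transport {M : MatFac S I J w} {M' : MatFac S I' J' w'}
    (q : TwistedForm M ε) {f : Hom M M'} (hf : f.IsIso) :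
    ∃ q' : TwistedForm M' ε, f.PreservesTwisted q q' := by
  obtain ⟨σ, τ, hφ, hψ⟩ := f
  obtain ⟨⟨σ', h₁, h₂⟩, τ', h₃, h₄⟩ := hf
  dsimp only at h₁ h₂ h₃ h₄
  have e₁ : τ' * M'.φ = M.φ * σ' := by
    rw [← Matrix.mul_one (τ' * M'.φ), ← h₁, Matrix.mul_assoc, ← Matrix.mul_assoc M'.φ, hφ,
      Matrix.mul_assoc, ← Matrix.mul_assoc, h₄, Matrix.one_mul]
  have e₂ : σ' * M'.ψ = M.ψ * τ' := by
    rw [← Matrix.mul_one (σ' * M'.ψ), ← h₃, Matrix.mul_assoc, ← Matrix.mul_assoc M'.ψ, hψ,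
      Matrix.mul_assoc, ← Matrix.mul_assoc, h₂, Matrix.one_mul]
  have f₁ := congrArg Matrix.transpose e₁
  have f₂ := congrArg Matrix.transpose e₂
  rw [transpose_mul, transpose_mul] at f₁ f₂
  have t₁ : σᵀ * σ'ᵀ = 1 := by rw [← transpose_mul, h₂, transpose_one]
  have t₂ : σ'ᵀ * σᵀ = 1 := by rw [← transpose_mul, h₁, transpose_one]
  have t₃ : τᵀ * τ'ᵀ = 1 := by rw [← transpose_mul, h₄, transpose_one]
  have t₄ : τ'ᵀ * τᵀ = 1 := by rw [← transpose_mul, h₃, transpose_one]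
  refine ⟨⟨σ'ᵀ * q.q₀ * σ', τ'ᵀ * q.q₁ * τ', ?_, ?_, ?_, ?_, isInvertible_congr t₂ t₁ h₂ h₁ q.inv_q₀,
    isInvertible_congr t₄ t₃ h₄ h₃ q.inv_q₁⟩, ?_, ?_⟩
  · simp only [Matrix.mul_assoc]
    rw [← Matrix.mul_assoc M'.ψᵀ, f₂, e₁, ← Matrix.mul_assoc q.q₁, ← q.comm_φ]
    simp only [Matrix.mul_assoc]
  · simp only [Matrix.mul_assoc]
    rw [← Matrix.mul_assoc M'.φᵀ, f₁, e₂, ← Matrix.mul_assoc q.q₀, ← q.comm_ψ]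
    simp only [Matrix.mul_assoc]
  · rw [transpose_mul, transpose_mul, q.transpose_q₀, transpose_transpose]
    simp only [Matrix.mul_assoc, Matrix.smul_mul, Matrix.mul_smul]
  · rw [transpose_mul, transpose_mul, q.transpose_q₁, transpose_transpose]
    simp only [Matrix.mul_assoc, Matrix.smul_mul, Matrix.mul_smul]
  · simp only [Matrix.mul_assoc]
    rw [h₂, Matrix.mul_one, ← Matrix.mul_assoc, t₁, Matrix.one_mul]
  · simp only [Matrix.mul_assoc]
    rw [h₄, Matrix.mul_one, ← Matrix.mul_assoc, t₃, Matrix.one_mul]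

/-- The matrix of a form on `M₀ ⊕ M₁`. -/
def BilinForm.full {M : MatFac S I J w} (b : BilinForm M ε) : Matrix (I ⊕ J) (I ⊕ J) S :=
  fromBlocks 0 b.b₁ b.b₀ 0

/-- The matrix of a twisted form on `M₀ ⊕ M₁`. -/
def TwistedForm.full {M : MatFac S I J w} (q : TwistedForm M ε) : Matrix (I ⊕ J) (I ⊕ J) S :=
  fromBlocks q.q₀ 0 0 q.q₁

theorem BilinForm.full_transpose {M : MatFac S I J w} (b : BilinForm M ε) :
    b.fullᵀ = (-ε) • b.full := by
  rcases Int.units_eq_one_or ε with rfl | rfl <;>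
    simp [full, fromBlocks_transpose, b.transpose_b₀, b.transpose_b₁, fromBlocks_neg]

theorem TwistedForm.full_transpose {M : MatFac S I J w} (q : TwistedForm M ε) :
    q.fullᵀ = ε • q.full := by
  rcases Int.units_eq_one_or ε with rfl | rfl <;>
    simp [full, fromBlocks_transpose, q.transpose_q₀, q.transpose_q₁, fromBlocks_neg]

/-- The odd operator is skew-adjoint for a form and, below, self-adjoint for a twisted form; this is
the origin of the two values of δ. -/
theorem BilinForm.full_comm {M : MatFac S I J w} (b : BilinForm M ε) :
    (fromBlocks 0 M.ψ M.φ 0)ᵀ * b.full = -(b.full * fromBlocks 0 M.ψ M.φ 0) := by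
  simp [full, fromBlocks_transpose, fromBlocks_multiply, ← b.comm_φ, ← b.comm_ψ, fromBlocks_neg]

theorem TwistedForm.full_comm {M : MatFac S I J w} (q : TwistedForm M ε) :
    (fromBlocks 0 M.ψ M.φ 0)ᵀ * q.full = q.full * fromBlocks 0 M.ψ M.φ 0 := by
  simp [full, fromBlocks_transpose, fromBlocks_multiply, q.comm_φ, q.comm_ψ]

theorem Hom.preservesBilin_iff {M : MatFac S I J w} {M' : MatFac S I' J' w'} {f : Hom M M'}
    {b : BilinForm M ε} {b' : BilinForm M' ε} : f.PreservesBilin b b' ↔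
      (fromBlocks f.σ 0 0 f.τ)ᵀ * b'.full * fromBlocks f.σ 0 0 f.τ = b.full := by
  simp [PreservesBilin, BilinForm.full, fromBlocks_transpose, fromBlocks_multiply, and_comm]

theorem Hom.preservesTwisted_iff {M : MatFac S I J w} {M' : MatFac S I' J' w'} {f : Hom M M'}
    {q : TwistedForm M ε} {q' : TwistedForm M' ε} : f.PreservesTwisted q q' ↔
      (fromBlocks f.σ 0 0 f.τ)ᵀ * q'.full * fromBlocks f.σ 0 0 f.τ = q.full := by
  simp [PreservesTwisted, TwistedForm.full, fromBlocks_transpose, fromBlocks_multiply]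

end

variable {A : Type u} [CommRing A]
variable {I J : Type} [Fintype I] [Fintype J] [DecidableEq I] [DecidableEq J]
variable {π π' : A} {ε : ℤˣ}

theorem TwistedForm.full_theta {N : MatFac A I J π} (q : TwistedForm N ε) :
    q.theta.full = fromBlocks 0 (-(fromBlocks q.q₁ 0 0 (-q.q₀)).map MvPowerSeries.C)
      ((fromBlocks q.q₁ 0 0 (-q.q₀)).map MvPowerSeries.C) 0 := by
  ext ((i | i) | (i | i)) ((j | j) | (j | j)) <;>
    simp [BilinForm.full, theta, thetaTensor, BilinForm.copySign, BilinForm.copy,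
      BilinForm.reindex, tensorBilin, TwistedForm.twist, TwistedForm.map, xyForm]

theorem BilinForm.full_theta {N : MatFac A I J π} (b : BilinForm N ε) :
    b.theta.full = fromBlocks ((fromBlocks 0 b.b₀ b.b₁ 0).map MvPowerSeries.C) 0 0
      (-(fromBlocks 0 b.b₀ b.b₁ 0).map MvPowerSeries.C) := by
  ext ((i | i) | (i | i)) ((j | j) | (j | j)) <;>
    simp [TwistedForm.full, theta, thetaTensor, TwistedForm.copySign, TwistedForm.copy,
      TwistedForm.reindex, tensorBilin, BilinForm.twist, BilinForm.map, xyForm]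

/-- The off-diagonal shape of the inverse is recorded because its product with the matrix of any
other form is then block diagonal, as `exists_isometric_gauge` requires. -/
theorem TwistedForm.exists_constForm {N : MatFac A I J π} (q : TwistedForm N ε) :
    ∃ b : ConstForm A I J (-ε) (-1), b.B = q.theta.full ∧ ∃ X Y, b.B' = fromBlocks 0 X Y 0 := by
  obtain ⟨c₀, h₁, h₂⟩ := q.inv_q₀
  obtain ⟨c₁, h₃, h₄⟩ := q.inv_q₁
  refine ⟨.bilin (α := q.q₁) (κ := -q.q₀) h₃ h₄ (κ' := -c₀) (by simp [h₁]) (by simp [h₂])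
    q.transpose_q₁ (by rw [transpose_neg, q.transpose_q₀, smul_neg]), ?_, _, _, rfl⟩
  rw [q.full_theta]
  rfl

theorem BilinForm.exists_constForm {N : MatFac A I J π} (b : BilinForm N ε) :
    ∃ c : ConstForm A I J (-ε) 1, c.B = b.theta.full ∧ ∃ X Y, c.B' = fromBlocks X 0 0 Y := by
  obtain ⟨c₀, h₁, h₂⟩ := b.inv_b₀
  obtain ⟨c₁, h₃, h₄⟩ := b.inv_b₁
  refine ⟨.twisted (μ := b.b₀) (ν := b.b₁) h₁ h₂ h₃ h₄ (by rw [b.transpose_b₀, Units.neg_smul])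
    (by rw [b.transpose_b₁, Units.neg_smul]), ?_, _, _, rfl⟩
  rw [b.full_theta]
  rfl

theorem map_C_injective {m n : Type*} :
    Function.Injective fun M : Matrix m n A => M.map (MvPowerSeries.C : A →+* PS₂ A) :=
  Function.LeftInverse.injective (g := fun M : Matrix m n (PS₂ A) => M.map (MvPowerSeries.constantCoeff : PS₂ A →+* A))
    map_constantCoeff_map_C

/-- A twisted form whose image under `θ` is compatible with `θ(P, Q)` is a twisted form
on `(P, Q)`. -/
theorem TwistedForm.exists_of_comm {N : MatFac A I J π} (q : TwistedForm N ε)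
    (N' : MatFac A I J π')
    (h : (perturbation N'.φ N'.ψ)ᵀ * q.theta.full = -(q.theta.full * perturbation N'.φ N'.ψ)) :
    ∃ q' : TwistedForm N' ε, q'.q₀ = q.q₀ ∧ q'.q₁ = q.q₁ := by
  rw [q.full_theta] at h
  simp only [perturbation, fromBlocks_transpose, fromBlocks_map, fromBlocks_multiply,
    fromBlocks_neg, fromBlocks_inj, transpose_zero, Matrix.mul_zero, Matrix.zero_mul, add_zero,
    zero_add, Matrix.map_zero _ (map_zero _), Matrix.neg_mul, Matrix.mul_neg, transpose_neg,
    map_C_neg, neg_neg, ← transpose_map, ← Matrix.map_mul] at h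
  obtain ⟨⟨-, h₁, h₂, -⟩, -⟩ := h
  exact ⟨⟨q.q₀, q.q₁, map_C_injective (by simpa [Matrix.map_mul] using h₁),
    map_C_injective (by simpa [Matrix.map_mul] using h₂),
    q.transpose_q₀, q.transpose_q₁, q.inv_q₀, q.inv_q₁⟩, rfl, rfl⟩

/-- A form whose image under `θ` is compatible with `θ(P, Q)` is a form on `(P, Q)`. -/
theorem BilinForm.exists_of_comm {N : MatFac A I J π} (b : BilinForm N ε)
    (N' : MatFac A I J π')
    (h : (perturbation N'.φ N'.ψ)ᵀ * b.theta.full = b.theta.full * perturbation N'.φ N'.ψ) :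
    ∃ b' : BilinForm N' ε, b'.b₀ = b.b₀ ∧ b'.b₁ = b.b₁ := by
  rw [b.full_theta] at h
  simp only [perturbation, fromBlocks_transpose, fromBlocks_map, fromBlocks_multiply,
    fromBlocks_neg, fromBlocks_inj, transpose_zero, Matrix.mul_zero, Matrix.zero_mul, add_zero,
    zero_add, Matrix.map_zero _ (map_zero _), Matrix.neg_mul, Matrix.mul_neg, transpose_neg,
    neg_neg, ← transpose_map, ← Matrix.map_mul] at h
  obtain ⟨-, ⟨h₁, -, -, h₂⟩, -⟩ := h
  rw [neg_zero, zero_add, ← map_C_neg] at h₁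
  rw [neg_zero, add_zero, ← map_C_neg] at h₂
  exact ⟨⟨b.b₀, b.b₁, by rw [map_C_injective h₂, neg_neg], map_C_injective h₁,
    b.transpose_b₀, b.transpose_b₁, b.inv_b₀, b.inv_b₁⟩, rfl, rfl⟩

end MatFac

/-! ### Deformations of `M̄_r` -/

namespace MatFac

universe u v
set_option linter.unusedSectionVars false

open PS₂

variable {k : Type u} [Field k] {A : Type v} [CommRing A] [IsLocalRing A] [Algebra k A]
variable (hk : Function.Bijective (algebraMap k (IsLocalRing.ResidueField A)))

theorem residueMap_algebraMap (c : k) : residueMap hk (algebraMap k A c) = c :=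
  (RingEquiv.symm_apply_eq (RingEquiv.ofBijective _ hk)).2 rfl

theorem residueMap_eq_zero_iff {a : A} :
    residueMap hk a = 0 ↔ a ∈ IsLocalRing.maximalIdeal A := by
  rw [← IsLocalRing.residue_eq_zero_iff]
  exact EmbeddingLike.map_eq_zero_iff (f := (RingEquiv.ofBijective _ hk).symm)

theorem reduction_eq_zero_iff {f : PS₂ A} :
    reduction hk f = 0 ↔ f ∈ level (IsLocalRing.maximalIdeal A) fun _ => 1 := by
  rw [mem_level, MvPowerSeries.ext_iff]
  refine forall_congr' fun d => ?_
  rw [pow_one, ← residueMap_eq_zero_iff hk]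
  rfl

theorem mem_fil_adic_one_iff {m n : Type*} {M : Matrix m n (PS₂ A)} :
    M ∈ fil .adic (IsLocalRing.maximalIdeal A) m n 1 ↔ M.map (reduction hk) = 0 := by
  rw [← Matrix.ext_iff]
  exact forall₂_congr fun i j => (reduction_eq_zero_iff hk).symm

theorem map_reduction_sub {m n : Type*} (M N : Matrix m n (PS₂ A)) :
    (M - N).map (reduction hk) = M.map (reduction hk) - N.map (reduction hk) :=
  Matrix.map_sub _ (map_sub _) _ _

theorem reduction_map_algebraMap (f : PS₂ k) :
    reduction hk (MvPowerSeries.map (algebraMap k A) f) = f := by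
  ext d
  exact residueMap_algebraMap hk _

theorem map_reduction_map_algebraMap {m n : Type*} (M : Matrix m n (PS₂ k)) :
    (M.map (MvPowerSeries.map (algebraMap k A))).map (reduction hk) = M := by
  ext1 i j
  exact reduction_map_algebraMap hk _

theorem reduction_C (a : A) :
    reduction hk (MvPowerSeries.C a) = MvPowerSeries.C (residueMap hk a) :=
  MvPowerSeries.map_C _ _

theorem map_reduction_C {m n : Type*} (M : Matrix m n k) :
    ((M.map (algebraMap k A)).map (MvPowerSeries.C : A →+* PS₂ A)).map (reduction hk) =
      M.map MvPowerSeries.C := by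
  ext1 i j
  simp only [Matrix.map_apply, reduction_C, residueMap_algebraMap]

theorem map_koszul {R S : Type*} [CommRing R] [CommRing S] (f : R →+* S) (I J : Type)
    [DecidableEq I] [DecidableEq J] :
    (koszul R I J).map (MvPowerSeries.map f) = koszul S I J := by
  ext1 ((i | i) | (i | i)) ((j | j) | (j | j)) <;>
    simp [koszul, Matrix.one_apply] <;> split_ifs <;> simp

theorem fromBlocks_theta_zeroMF (k : Type u) [CommRing k] (r : ℕ) :
    fromBlocks 0 (zeroMF k r).theta.ψ (zeroMF k r).theta.φ 0 = koszul k (Fin r) (Fin r) := by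
  rw [← koszul_add_perturbation]
  change _ + perturbation 0 0 = _
  rw [perturbation_zero, add_zero]

theorem map_reduction_eq_one {I J : Type} [Fintype I] [Fintype J] [DecidableEq I] [DecidableEq J]
    {d : Gauge A I J} (h : d.F - 1 ∈ fil .adic (IsLocalRing.maximalIdeal A) _ _ 1) :
    d.σ.map (reduction hk) = 1 ∧ d.τ.map (reduction hk) = 1 := by
  rw [mem_fil_adic_one_iff hk, map_reduction_sub, Matrix.map_one _ (map_zero _) (map_one _),
    sub_eq_zero, Gauge.F, fromBlocks_map, ← fromBlocks_one, fromBlocks_inj] at h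
  exact ⟨h.1, h.2.2.2⟩

variable {hk} in
theorem IsInfinitesimal.map_map {g : PS₂ A ≃ₐ[A] PS₂ A} (hg : IsInfinitesimal hk g)
    {m n : Type*} (M : Matrix m n (PS₂ A)) :
    (M.map (g : PS₂ A →+* PS₂ A)).map (reduction hk) = M.map (reduction hk) := by
  ext1 i j
  exact hg _

/-- After a change of variables and a change of bases, a deformation of `M̄_r` is a deformation
of `θ(0, 0)` of potential `xy - π`. -/
theorem exists_normalized [IsNoetherianRing A] [IsAdicComplete (IsLocalRing.maximalIdeal A) A]
    {r : ℕ} {ω : PS₂ A} {M : MatFac (PS₂ A) (Fin r ⊕ Fin r) (Fin r ⊕ Fin r) ω}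
    (hM : IsDeformation hk (Mbar k r) M) {F₀ : Hom (Mbar k r) (zeroMF k r).theta}
    (hF₀ : F₀.IsIso) :
    ∃ (g : PS₂ A ≃ₐ[A] PS₂ A) (π : A)
      (M' : MatFac (PS₂ A) (Fin r ⊕ Fin r) (Fin r ⊕ Fin r) (PS₂.xy A - MvPowerSeries.C π))
      (f : Hom (M.map (g : PS₂ A →+* PS₂ A)) M'),
      π ∈ IsLocalRing.maximalIdeal A ∧ IsInfinitesimal hk g ∧
      g ω = PS₂.xy A - MvPowerSeries.C π ∧ f.IsIso ∧ f.ReducesTo hk F₀ ∧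
      fromBlocks 0 M'.ψ M'.φ 0 - koszul A (Fin r) (Fin r) ∈
        fil .adic (IsLocalRing.maximalIdeal A) _ _ 1 := by
  obtain ⟨hω, hφ, hψ⟩ := hM
  obtain ⟨g, π, hπ, hg, hg'⟩ := exists_algEquiv_eq_sub_C (ω := ω)
    (𝔪 := IsLocalRing.maximalIdeal A) ((reduction_eq_zero_iff hk).1 (by
      rw [map_sub, hω, sub_eq_zero]
      simp [reduction]))
  have hgi : IsInfinitesimal hk g := fun f => by
    rw [← sub_eq_zero, ← map_sub, reduction_eq_zero_iff]; exact hg' f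
  obtain ⟨⟨σ', h₁, h₂⟩, τ', h₃, h₄⟩ := hF₀
  -- The isomorphism F₀ is lifted coefficient by coefficient along k → A. Conjugation by this lift
  -- makes the deformation reduce to the operator K of θ(0, 0).
  have hl {m n : Type} [Fintype m] [Fintype n] [DecidableEq m] {x : Matrix m n (PS₂ k)}
      {y : Matrix n m (PS₂ k)} (h : x * y = 1) : x.map (MvPowerSeries.map (algebraMap k A)) *
        y.map (MvPowerSeries.map (algebraMap k A)) = 1 := by
    rw [← Matrix.map_mul, h, Matrix.map_one _ (map_zero _) (map_one _)]
  obtain ⟨M', e, e', f, hσ, hτ⟩ := ((M.map (g : PS₂ A →+* PS₂ A)).copy hg).exists_transport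
    (hl h₁) (hl h₂) (hl h₃) (hl h₄)
  refine ⟨g, π, M', ⟨f.σ, f.τ, f.comm_φ, f.comm_ψ⟩, hπ, hgi, hg, ?_, ?_, ?_⟩
  · exact ⟨hσ ▸ ⟨_, hl h₁, hl h₂⟩, hτ ▸ ⟨_, hl h₃, hl h₄⟩⟩
  · exact ⟨(congrArg (fun X => X.map (reduction hk)) hσ).trans (map_reduction_map_algebraMap hk _),
      (congrArg (fun X => X.map (reduction hk)) hτ).trans (map_reduction_map_algebraMap hk _)⟩
  · have eφ : M'.φ.map (reduction hk) = (zeroMF k r).theta.φ := by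
      rw [e, Matrix.map_mul, Matrix.map_mul, map_reduction_map_algebraMap,
        map_reduction_map_algebraMap]
      change _ * (M.φ.map (g : PS₂ A →+* PS₂ A)).map _ * _ = _
      rw [hgi.map_map, hφ, ← F₀.comm_φ, Matrix.mul_assoc, h₁, Matrix.mul_one]
    have eψ : M'.ψ.map (reduction hk) = (zeroMF k r).theta.ψ := by
      rw [e', Matrix.map_mul, Matrix.map_mul, map_reduction_map_algebraMap,
        map_reduction_map_algebraMap]
      change _ * (M.ψ.map (g : PS₂ A →+* PS₂ A)).map _ * _ = _
      rw [hgi.map_map, hψ, ← F₀.comm_ψ, Matrix.mul_assoc, h₃, Matrix.mul_one]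
    rw [mem_fil_adic_one_iff hk, map_reduction_sub, fromBlocks_map, eφ, eψ, reduction, map_koszul,
      Matrix.map_zero _ (map_zero _), fromBlocks_theta_zeroMF, sub_self]

variable {hk} in
theorem Hom.ReducesTo.comp_gauge {I J : Type} [Fintype I] [Fintype J] [DecidableEq I]
    [DecidableEq J] {w w' w'' : PS₂ A} {w₀ w₀' : PS₂ k} {M : MatFac (PS₂ A) (J ⊕ I) (J ⊕ I) w}
    {M' : MatFac (PS₂ A) (J ⊕ I) (J ⊕ I) w'} {M'' : MatFac (PS₂ A) (J ⊕ I) (J ⊕ I) w''}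
    {M₀ : MatFac (PS₂ k) (J ⊕ I) (J ⊕ I) w₀} {M₀' : MatFac (PS₂ k) (J ⊕ I) (J ⊕ I) w₀'}
    {f : Hom M M'} {F : Hom M' M''} {F₀ : Hom M₀ M₀'} (hf : f.ReducesTo hk F₀) {d : Gauge A I J}
    (hσ : F.σ = d.σ) (hτ : F.τ = d.τ)
    (h : d.F - 1 ∈ fil .adic (IsLocalRing.maximalIdeal A) _ _ 1) :
    (f.comp F).ReducesTo hk F₀ := by
  obtain ⟨h₁, h₂⟩ := map_reduction_eq_one hk h
  constructor
  · change (F.σ * f.σ).map _ = _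
    rw [Matrix.map_mul, hσ, h₁, hf.1, Matrix.one_mul]
  · change (F.τ * f.τ).map _ = _
    rw [Matrix.map_mul, hτ, h₂, hf.2, Matrix.one_mul]

theorem MbarIso_isIso (k : Type u) [CommRing k] (r : ℕ) : (MbarIso k r).IsIso :=
  ⟨⟨fromBlocks 1 0 0 (-1), by simp [MbarIso, fromBlocks_multiply],
    by simp [MbarIso, fromBlocks_multiply]⟩, 1, by simp [MbarIso], by simp [MbarIso]⟩

/-- Deformations of `M̄_r` without additional structure. -/
theorem exists_theta_of_isDeformation [IsNoetherianRing A]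
    [IsAdicComplete (IsLocalRing.maximalIdeal A) A] {r : ℕ} {ω : PS₂ A}
    {M : MatFac (PS₂ A) (Fin r ⊕ Fin r) (Fin r ⊕ Fin r) ω} (hM : IsDeformation hk (Mbar k r) M) :
    ∃ (π : A) (N : MatFac A (Fin r) (Fin r) π) (g : PS₂ A ≃ₐ[A] PS₂ A)
      (F : Hom (M.map (g : PS₂ A →+* PS₂ A)) N.theta),
      π ∈ IsLocalRing.maximalIdeal A ∧ N.IsReduced ∧ IsInfinitesimal hk g ∧
      g ω = PS₂.xy A - MvPowerSeries.C π ∧ F.IsIso ∧ F.ReducesTo hk (MbarIso k r) := by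
  obtain ⟨g, π, M', f, hπ, hg, hgω, hf, hf', hD⟩ := exists_normalized hk hM (MbarIso_isIso k r)
  obtain ⟨d, hd, hP, hQ, h⟩ := exists_gauge (w := .adic) hD M'.fromBlocks_mul_fromBlocks_self
  obtain ⟨hσ, hτ⟩ := Gauge.isUnit hd
  obtain ⟨N, hNφ, hNψ, F, hF, hF'⟩ := exists_hom_theta hσ hτ h
  refine ⟨π, N, g, f.comp F, hπ, ⟨fun i j => ?_, fun i j => ?_⟩, hg, hgω,
    hf.comp ⟨hF ▸ hσ.isInvertible, hF' ▸ hτ.isInvertible⟩, hf'.comp_gauge hF hF' hd⟩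
  · rw [hNφ]; exact Ideal.pow_le_self one_ne_zero (hP i j)
  · rw [hNψ]; exact Ideal.pow_le_self one_ne_zero (hQ i j)

end MatFac

/-! ### Deformations of `M̄_r` with forms -/

namespace MatFac

universe u v
set_option linter.unusedSectionVars false

open PS₂

theorem eq_of_congruence {S : Type*} [CommRing S] {m n m' n' : Type} [Fintype m] [Fintype n]
    [Fintype m'] [Fintype n'] [DecidableEq m] [DecidableEq n] [DecidableEq m'] [DecidableEq n']
    {σ : Matrix m' m S} {τ : Matrix n' n S} (hσ : σ.IsInvertible) (hτ : τ.IsInvertible)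
    {X Y : Matrix (m' ⊕ n') (m' ⊕ n') S}
    (h : (fromBlocks σ 0 0 τ)ᵀ * X * fromBlocks σ 0 0 τ =
      (fromBlocks σ 0 0 τ)ᵀ * Y * fromBlocks σ 0 0 τ) : X = Y := by
  obtain ⟨V, hV, -⟩ := hσ.diagBlocks hτ
  have hV' : Vᵀ * (fromBlocks σ 0 0 τ)ᵀ = 1 := by rw [← transpose_mul, hV, transpose_one]
  have := congrArg (fun Z => Vᵀ * (Z * V)) h
  simpa only [Matrix.mul_assoc, hV, Matrix.mul_one, ← Matrix.mul_assoc Vᵀ, hV', Matrix.one_mul]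
    using this

variable {k : Type u} [Field k] {A : Type v} [CommRing A] [IsLocalRing A] [Algebra k A]
variable (hk : Function.Bijective (algebraMap k (IsLocalRing.ResidueField A)))
variable {I J : Type} [Fintype I] [Fintype J] [DecidableEq I] [DecidableEq J]

theorem TwistedForm.full_theta_map {w : k} {N : MatFac k I J w} {ε : ℤˣ} (q : TwistedForm N ε) :
    (q.map (algebraMap k A)).theta.full.map (reduction hk) = q.theta.full := by
  have e : fromBlocks (q.map (algebraMap k A)).q₁ 0 0 (-(q.map (algebraMap k A)).q₀) =
      (fromBlocks q.q₁ 0 0 (-q.q₀)).map (algebraMap k A) := by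
    simp [fromBlocks_map, TwistedForm.map, Matrix.map_neg]
  rw [full_theta, full_theta, e, fromBlocks_map, Matrix.map_neg _ (map_neg _), map_reduction_C,
    Matrix.map_zero _ (map_zero _)]

theorem BilinForm.full_theta_map {w : k} {N : MatFac k I J w} {ε : ℤˣ} (b : BilinForm N ε) :
    (b.map (algebraMap k A)).theta.full.map (reduction hk) = b.theta.full := by
  have e : fromBlocks 0 (b.map (algebraMap k A)).b₀ (b.map (algebraMap k A)).b₁ 0 =
      (fromBlocks 0 b.b₀ b.b₁ 0).map (algebraMap k A) := by
    simp [fromBlocks_map, BilinForm.map]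
  rw [full_theta, full_theta, e, fromBlocks_map, Matrix.map_neg _ (map_neg _), map_reduction_C,
    Matrix.map_zero _ (map_zero _)]

variable {hk} in
theorem Hom.ReducesTo.full {I' J' : Type} [Fintype I'] [Fintype J'] [DecidableEq I']
    [DecidableEq J'] {w w' : PS₂ A} {w₀ w₀' : PS₂ k} {M : MatFac (PS₂ A) I J w}
    {M' : MatFac (PS₂ A) I' J' w'} {M₀ : MatFac (PS₂ k) I J w₀} {M₀' : MatFac (PS₂ k) I' J' w₀'}
    {f : Hom M M'} {F₀ : Hom M₀ M₀'} (hf : f.ReducesTo hk F₀) :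
    (fromBlocks f.σ 0 0 f.τ).map (reduction hk) = fromBlocks F₀.σ 0 0 F₀.τ := by
  rw [fromBlocks_map, hf.1, hf.2, Matrix.map_zero _ (map_zero _), Matrix.map_zero _ (map_zero _)]

/-- Deformations of `M̄_r` with a quadratic or symplectic form. -/
theorem exists_theta_of_bilinForm [IsNoetherianRing A] [Invertible (2 : A)]
    [IsAdicComplete (IsLocalRing.maximalIdeal A) A] {r : ℕ} {ε : ℤˣ} {b₀ : BilinForm (Mbar k r) ε}
    (q₀ : TwistedForm (zeroMF k r) ε) {F₀ : Hom (Mbar k r) (zeroMF k r).theta} (hF₀ : F₀.IsIso)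
    (hb₀ : F₀.PreservesBilin b₀ q₀.theta) {ω : PS₂ A}
    {M : MatFac (PS₂ A) (Fin r ⊕ Fin r) (Fin r ⊕ Fin r) ω} {b : BilinForm M ε}
    (hM : IsDeformation hk (Mbar k r) M) (hb : b.ReducesTo hk b₀) :
    ∃ (π : A) (N : MatFac A (Fin r) (Fin r) π) (q : TwistedForm N ε) (g : PS₂ A ≃ₐ[A] PS₂ A)
      (F : Hom (M.map (g : PS₂ A →+* PS₂ A)) N.theta),
      π ∈ IsLocalRing.maximalIdeal A ∧ N.IsReduced ∧ q.IsConst q₀ ∧ IsInfinitesimal hk g ∧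
      g ω = PS₂.xy A - MvPowerSeries.C π ∧ F.IsIso ∧ F.ReducesTo hk F₀ ∧
      F.PreservesBilin (b.map (g : PS₂ A →+* PS₂ A)) q.theta := by
  obtain ⟨g, π, M', f, hπ, hg, hgω, hf, hf', hD⟩ := exists_normalized hk hM hF₀
  obtain ⟨b', hb'⟩ := (b.map (g : PS₂ A →+* PS₂ A)).exists_transport hf
  obtain ⟨c, hc, X, Y, hc'⟩ := (q₀.map (algebraMap k A)).exists_constForm
  -- Both matrices pull back along F₀ to the given form on `Mbar`, and congruence by an invertible
  -- matrix is injective.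
  have hr : b'.full.map (reduction hk) = q₀.theta.full := by
    refine eq_of_congruence hF₀.1 hF₀.2 ?_
    rw [Hom.preservesBilin_iff.1 hb₀, ← hf'.full, ← transpose_map, ← Matrix.map_mul,
      ← Matrix.map_mul, Hom.preservesBilin_iff.1 hb', BilinForm.full, BilinForm.full, fromBlocks_map,
      Matrix.map_zero _ (map_zero _)]
    change fromBlocks 0 ((b.b₁.map (g : PS₂ A →+* PS₂ A)).map _)
      ((b.b₀.map (g : PS₂ A →+* PS₂ A)).map _) 0 = _
    rw [hg.map_map, hg.map_map, hb.1, hb.2]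
  obtain ⟨d, hd, hP, hQ, h, hdB, hdC⟩ := exists_isometric_gauge (w := .adic) c hD
    M'.fromBlocks_mul_fromBlocks_self b'.full_transpose
    ⟨X * b'.b₀, Y * b'.b₁, by rw [hc', BilinForm.full, fromBlocks_multiply]; simp⟩
    (by rw [mem_fil_adic_one_iff hk, map_reduction_sub, hr, hc, q₀.full_theta_map hk, sub_self])
    (by rw [neg_one_smul]; exact b'.full_comm)
  obtain ⟨hσ, hτ⟩ := Gauge.isUnit hd
  obtain ⟨N, hNφ, hNψ, F, hF, hF'⟩ := exists_hom_theta hσ hτ h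
  -- The skew-adjointness of the constant part C says precisely that the constant twisted form is
  -- compatible with P and Q.
  obtain ⟨q, hq₀, hq₁⟩ := (q₀.map (algebraMap k A)).exists_of_comm N (by
    rw [hNφ, hNψ, ← hc]; exact hdC.trans (neg_one_smul _ _))
  refine ⟨π, N, q, g, f.comp F, hπ, ⟨fun i j => ?_, fun i j => ?_⟩, ⟨hq₀, hq₁⟩, hg, hgω,
    hf.comp ⟨hF ▸ hσ.isInvertible, hF' ▸ hτ.isInvertible⟩, hf'.comp_gauge hF hF' hd,
    hb'.comp (Hom.preservesBilin_iff.2 ?_)⟩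
  · rw [hNφ]; exact Ideal.pow_le_self one_ne_zero (hP i j)
  · rw [hNψ]; exact Ideal.pow_le_self one_ne_zero (hQ i j)
  · rw [hF, hF', q.full_theta, hq₀, hq₁, ← TwistedForm.full_theta, ← hc]
    exact hdB

/-- Deformations of `M̄_r` with a twisted form. -/
theorem exists_theta_of_twistedForm [IsNoetherianRing A] [Invertible (2 : A)]
    [IsAdicComplete (IsLocalRing.maximalIdeal A) A] {r : ℕ} {ε : ℤˣ}
    {q₀ : TwistedForm (Mbar k r) (-ε)}
    (b₀ : BilinForm (zeroMF k r) ε) {F₀ : Hom (Mbar k r) (zeroMF k r).theta} (hF₀ : F₀.IsIso)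
    (hq₀ : F₀.PreservesTwisted q₀ b₀.theta) {ω : PS₂ A}
    {M : MatFac (PS₂ A) (Fin r ⊕ Fin r) (Fin r ⊕ Fin r) ω} {q : TwistedForm M (-ε)}
    (hM : IsDeformation hk (Mbar k r) M) (hq : q.ReducesTo hk q₀) :
    ∃ (π : A) (N : MatFac A (Fin r) (Fin r) π) (b : BilinForm N ε) (g : PS₂ A ≃ₐ[A] PS₂ A)
      (F : Hom (M.map (g : PS₂ A →+* PS₂ A)) N.theta),
      π ∈ IsLocalRing.maximalIdeal A ∧ N.IsReduced ∧ b.IsConst b₀ ∧ IsInfinitesimal hk g ∧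
      g ω = PS₂.xy A - MvPowerSeries.C π ∧ F.IsIso ∧ F.ReducesTo hk F₀ ∧
      F.PreservesTwisted (q.map (g : PS₂ A →+* PS₂ A)) b.theta := by
  obtain ⟨g, π, M', f, hπ, hg, hgω, hf, hf', hD⟩ := exists_normalized hk hM hF₀
  obtain ⟨q', hq'⟩ := (q.map (g : PS₂ A →+* PS₂ A)).exists_transport hf
  obtain ⟨c, hc, X, Y, hc'⟩ := (b₀.map (algebraMap k A)).exists_constForm
  have hr : q'.full.map (reduction hk) = b₀.theta.full := by
    refine eq_of_congruence hF₀.1 hF₀.2 ?_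
    rw [Hom.preservesTwisted_iff.1 hq₀, ← hf'.full, ← transpose_map, ← Matrix.map_mul,
      ← Matrix.map_mul, Hom.preservesTwisted_iff.1 hq', TwistedForm.full, TwistedForm.full,
      fromBlocks_map, Matrix.map_zero _ (map_zero _)]
    change fromBlocks ((q.q₀.map (g : PS₂ A →+* PS₂ A)).map _) 0 0
      ((q.q₁.map (g : PS₂ A →+* PS₂ A)).map _) = _
    rw [hg.map_map, hg.map_map, hq.1, hq.2]
  obtain ⟨d, hd, hP, hQ, h, hdB, hdC⟩ := exists_isometric_gauge (w := .adic) c hD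
    M'.fromBlocks_mul_fromBlocks_self q'.full_transpose
    ⟨X * q'.q₀, Y * q'.q₁, by rw [hc', TwistedForm.full, fromBlocks_multiply]; simp⟩
    (by rw [mem_fil_adic_one_iff hk, map_reduction_sub, hr, hc, b₀.full_theta_map hk, sub_self])
    (by rw [one_smul]; exact q'.full_comm)
  obtain ⟨hσ, hτ⟩ := Gauge.isUnit hd
  obtain ⟨N, hNφ, hNψ, F, hF, hF'⟩ := exists_hom_theta hσ hτ h
  obtain ⟨b, hb₀, hb₁⟩ := (b₀.map (algebraMap k A)).exists_of_comm N (by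
    rw [hNφ, hNψ, ← hc]; exact hdC.trans (one_smul _ _))
  refine ⟨π, N, b, g, f.comp F, hπ, ⟨fun i j => ?_, fun i j => ?_⟩, ⟨hb₀, hb₁⟩, hg, hgω,
    hf.comp ⟨hF ▸ hσ.isInvertible, hF' ▸ hτ.isInvertible⟩, hf'.comp_gauge hF hF' hd,
    hq'.comp (Hom.preservesTwisted_iff.2 ?_)⟩
  · rw [hNφ]; exact Ideal.pow_le_self one_ne_zero (hP i j)
  · rw [hNψ]; exact Ideal.pow_le_self one_ne_zero (hQ i j)
  · rw [hF, hF', b.full_theta, hb₀, hb₁, ← BilinForm.full_theta, ← hc]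
    exact hdB

end MatFac

/-! ### Forms on `M̄_r` -/

namespace MatFac

universe u v
set_option linter.unusedSectionVars false

open PS₂

section

variable {A : Type u} [CommRing A]

/-- From xM = yN it follows that y divides M and x divides N, so both vanish at the origin. -/
theorem matCoeff_smul_eq_smul {m n : Type} {s t : Fin 2} (hst : s ≠ t) {M N : Matrix m n (PS₂ A)}
    (h : (MvPowerSeries.X s : PS₂ A) • M = (MvPowerSeries.X t : PS₂ A) • N) :
    matCoeff A m n M = 0 ∧ matCoeff A m n N = 0 := by
  have key {M N : Matrix m n (PS₂ A)}
      (h : (MvPowerSeries.X 0 : PS₂ A) • M = (MvPowerSeries.X 1 : PS₂ A) • N) :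
      matCoeff A m n M = 0 ∧ matCoeff A m n N = 0 := by
    have h₁ := congrArg (fun Z => matCoeff A m n (matShiftX A m n Z)) h
    have h₂ := congrArg (fun Z => matCoeff A m n (matShiftY A m n Z)) h
    simp only [matShiftX_X_zero_smul, matShiftX_X_one_smul, matCoeff_X_smul] at h₁
    simp only [matShiftY_X_zero_smul, matShiftY_X_one_smul, map_sub, matCoeff_X_smul, map_zero,
      sub_zero] at h₂
    exact ⟨h₁, h₂.symm⟩
  match s, t with
  | 0, 0 => exact absurd rfl hst
  | 0, 1 => exact key h
  | 1, 0 => exact (key h.symm).symm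
  | 1, 1 => exact absurd rfl hst

theorem X_smul_injective {m n : Type} (s : Fin 2) {M N : Matrix m n (PS₂ A)}
    (h : (MvPowerSeries.X s : PS₂ A) • M = (MvPowerSeries.X s : PS₂ A) • N) : M = N := by
  ext i j d
  have := congrArg (MvPowerSeries.coeff (Finsupp.single s 1 + d)) (congrFun (congrFun h i) j)
  rwa [Matrix.smul_apply, Matrix.smul_apply, smul_eq_mul, smul_eq_mul, MvPowerSeries.X,
    MvPowerSeries.coeff_add_monomial_mul, MvPowerSeries.coeff_add_monomial_mul, one_mul,
    one_mul] at this

theorem isInvertible_of_diagBlocks {m n m' n' : Type} [Fintype m] [Fintype n] [Fintype m']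
    [Fintype n'] [DecidableEq m] [DecidableEq n] [DecidableEq m'] [DecidableEq n']
    {x : Matrix m n A} {y : Matrix m' n' A} (h : (fromBlocks x 0 0 y).IsInvertible) :
    x.IsInvertible ∧ y.IsInvertible := by
  obtain ⟨V, h₁, h₂⟩ := h
  rw [← fromBlocks_toBlocks V, fromBlocks_multiply, ← fromBlocks_one, fromBlocks_inj] at h₁ h₂
  simp only [Matrix.mul_zero, Matrix.zero_mul, add_zero, zero_add] at h₁ h₂
  exact ⟨⟨_, h₁.1, h₂.1⟩, ⟨_, h₁.2.2.2, h₂.2.2.2⟩⟩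

theorem matCoeff_fromBlocks {l m n o : Type} (a : Matrix n l (PS₂ A)) (b : Matrix n m (PS₂ A))
    (c : Matrix o l (PS₂ A)) (d : Matrix o m (PS₂ A)) :
    matCoeff A _ _ (fromBlocks a b c d) =
      fromBlocks (matCoeff A _ _ a) (matCoeff A _ _ b) (matCoeff A _ _ c) (matCoeff A _ _ d) :=
  fromBlocks_map _ _ _ _ _

theorem matCoeff_units_smul {m n : Type} (ε : ℤˣ) (M : Matrix m n (PS₂ A)) :
    matCoeff A m n (ε • M) = ε • matCoeff A m n M := by
  rcases Int.units_eq_one_or ε with rfl | rfl <;> simp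

theorem matCoeff_transpose {m n : Type} (M : Matrix m n (PS₂ A)) :
    matCoeff A n m Mᵀ = (matCoeff A m n M)ᵀ := rfl

/-- The constant part of a form on `θ(0, 0)` is induced by a twisted form on `(0, 0)`. -/
theorem BilinForm.exists_const {r : ℕ} {ε : ℤˣ} (b : BilinForm (zeroMF A r).theta ε) :
    ∃ q : TwistedForm (zeroMF A r) ε, matCoeff A _ _ b.full = matCoeff A _ _ q.theta.full := by
  have hc := b.comm_φ
  obtain ⟨p, q, t, s, h₀⟩ : ∃ p q t s, b.b₀ = fromBlocks p q t s :=
    ⟨_, _, _, _, (fromBlocks_toBlocks _).symm⟩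
  obtain ⟨p', q', t', s', h₁⟩ : ∃ p q t s, b.b₁ = fromBlocks p q t s :=
    ⟨_, _, _, _, (fromBlocks_toBlocks _).symm⟩
  rw [theta_φ, h₀, h₁] at hc
  simp only [zeroMF, Matrix.map_zero _ (map_zero _), neg_zero, fromBlocks_transpose,
    transpose_zero, transpose_smul, transpose_one, transpose_neg, fromBlocks_multiply,
    Matrix.zero_mul, Matrix.mul_zero, add_zero, zero_add, Matrix.neg_mul, Matrix.mul_neg,
    Matrix.smul_mul, Matrix.mul_smul, Matrix.one_mul, Matrix.mul_one, fromBlocks_neg, neg_neg,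
    fromBlocks_inj, ← smul_neg] at hc
  obtain ⟨e₁, e₂, e₃, e₄⟩ := hc
  -- Compatibility with K equates x times one off-diagonal block with y times another, so these have
  -- no constant term; the diagonal blocks of b₁ are the negatives of those of b₀.
  obtain ⟨hq, hq'⟩ := matCoeff_smul_eq_smul (by decide) e₂
  obtain ⟨ht, ht'⟩ := matCoeff_smul_eq_smul (by decide) e₃
  have hp := congrArg (matCoeff A _ _) (X_smul_injective 0 e₁)
  have hs := congrArg (matCoeff A _ _) (X_smul_injective 1 e₄)
  rw [map_neg] at hp hs hq hq'
  rw [neg_eq_zero] at hq hq'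
  have f₀ : matCoeff A _ _ b.b₀ = fromBlocks (matCoeff A _ _ p) 0 0 (matCoeff A _ _ s) := by
    rw [h₀, matCoeff_fromBlocks, hq, ht]
  have f₁ : matCoeff A _ _ b.b₁ = -fromBlocks (matCoeff A _ _ p) 0 0 (matCoeff A _ _ s) := by
    rw [h₁, matCoeff_fromBlocks, hq', ht', fromBlocks_neg, hp, hs]
    simp
  have ht₀ := congrArg (matCoeff A _ _) b.transpose_b₀
  rw [matCoeff_transpose, map_neg, matCoeff_units_smul, f₀, f₁, smul_neg, neg_neg,
    fromBlocks_transpose, fromBlocks_smul, fromBlocks_inj] at ht₀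
  have i₀ : (matCoeff A _ _ b.b₀).IsInvertible :=
    b.inv_b₀.map (MvPowerSeries.constantCoeff : PS₂ A →+* A)
  rw [f₀] at i₀
  obtain ⟨i₁, i₂⟩ := isInvertible_of_diagBlocks i₀
  -- The form induced by (q₀, q₁) has diagonal blocks q₁ and -q₀ in its component b₀, whence the
  -- order and the sign.
  refine ⟨⟨-matCoeff A _ _ s, matCoeff A _ _ p, by simp [zeroMF], by simp [zeroMF],
    by rw [transpose_neg, ht₀.2.2.2, smul_neg], ht₀.1, i₂.neg, i₁⟩, ?_⟩
  rw [TwistedForm.full_theta, BilinForm.full, matCoeff_fromBlocks, f₀, f₁, matCoeff_fromBlocks,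
    map_neg, matCoeff_C]
  simp

/-- The constant part of a twisted form on `θ(0, 0)` is induced by a form on `(0, 0)`. -/
theorem TwistedForm.exists_const {r : ℕ} {ε : ℤˣ} (q : TwistedForm (zeroMF A r).theta (-ε)) :
    ∃ b : BilinForm (zeroMF A r) ε, matCoeff A _ _ q.full = matCoeff A _ _ b.theta.full := by
  have hc := q.comm_φ
  obtain ⟨p, z, t, s, h₀⟩ : ∃ p z t s, q.q₀ = fromBlocks p z t s :=
    ⟨_, _, _, _, (fromBlocks_toBlocks _).symm⟩
  obtain ⟨p', z', t', s', h₁⟩ : ∃ p z t s, q.q₁ = fromBlocks p z t s :=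
    ⟨_, _, _, _, (fromBlocks_toBlocks _).symm⟩
  rw [theta_φ, theta_ψ, h₀, h₁] at hc
  simp only [zeroMF, Matrix.map_zero _ (map_zero _), neg_zero, fromBlocks_transpose,
    transpose_zero, transpose_smul, transpose_one, transpose_neg, fromBlocks_multiply,
    Matrix.zero_mul, Matrix.mul_zero, add_zero, zero_add, Matrix.neg_mul, Matrix.mul_neg,
    Matrix.smul_mul, Matrix.mul_smul, Matrix.one_mul, Matrix.mul_one,
    fromBlocks_inj, ← smul_neg] at hc
  obtain ⟨e₁, e₂, e₃, e₄⟩ := hc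
  obtain ⟨hp, hp'⟩ := matCoeff_smul_eq_smul (by decide) e₁
  obtain ⟨hs, hs'⟩ := matCoeff_smul_eq_smul (by decide) e₄
  have hz := congrArg (matCoeff A _ _) (X_smul_injective 1 e₂)
  have ht := congrArg (matCoeff A _ _) (X_smul_injective 0 e₃)
  rw [map_neg] at hs hs' hz ht
  rw [neg_eq_zero] at hs hs'
  have f₀ : matCoeff A _ _ q.q₀ = fromBlocks 0 (matCoeff A _ _ z) (matCoeff A _ _ t) 0 := by
    rw [h₀, matCoeff_fromBlocks, hp, hs]
  have f₁ : matCoeff A _ _ q.q₁ = -fromBlocks 0 (matCoeff A _ _ z) (matCoeff A _ _ t) 0 := by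
    rw [h₁, matCoeff_fromBlocks, hp', hs', fromBlocks_neg, hz, ← ht]
    simp
  have ht₀ := congrArg (matCoeff A _ _) q.transpose_q₀
  rw [matCoeff_transpose, matCoeff_units_smul, f₀,
    fromBlocks_transpose, fromBlocks_smul, fromBlocks_inj] at ht₀
  have i₀ : (matCoeff A _ _ q.q₀).IsInvertible :=
    q.inv_q₀.map (MvPowerSeries.constantCoeff : PS₂ A →+* A)
  rw [f₀] at i₀
  -- Exchanging the two groups of columns moves the antidiagonal blocks to the diagonal, where
  -- invertibility can be read off.
  have i₀ := i₀.submatrix (Equiv.refl _) (Equiv.sumComm _ _)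
  rw [show (fromBlocks 0 (matCoeff A _ _ z) (matCoeff A _ _ t) 0).submatrix
    (Equiv.refl _) (Equiv.sumComm _ _) = fromBlocks (matCoeff A _ _ z) 0 0 (matCoeff A _ _ t) by
      ext (i | i) (j | j) <;> rfl] at i₀
  obtain ⟨i₁, i₂⟩ := isInvertible_of_diagBlocks i₀
  refine ⟨⟨matCoeff A _ _ z, matCoeff A _ _ t, by simp [zeroMF], by simp [zeroMF],
    ht₀.2.2.1.trans (Units.neg_smul _ _), ht₀.2.1.trans (Units.neg_smul _ _), i₁, i₂⟩, ?_⟩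
  rw [BilinForm.full_theta, TwistedForm.full, matCoeff_fromBlocks, f₀, f₁, matCoeff_fromBlocks,
    map_neg, matCoeff_C]

end

variable {k : Type u} [Field k] [Invertible (2 : k)]

/-- On `θ(0, 0)` over a field, a form is isometric to its constant part. -/
theorem exists_isometry_theta_zeroMF {r : ℕ} {η : ℤˣ} {δ : k}
    (b : ConstForm k (Fin r) (Fin r) η δ)
    {B : Matrix ((Fin r ⊕ Fin r) ⊕ (Fin r ⊕ Fin r)) ((Fin r ⊕ Fin r) ⊕ (Fin r ⊕ Fin r)) (PS₂ k)}
    (hB : Bᵀ = η • B) (hB' : ∃ σ τ, b.B' * B = fromBlocks σ 0 0 τ)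
    (hBb : matCoeff k _ _ B = matCoeff k _ _ b.B)
    (hDB : (fromBlocks 0 (zeroMF k r).theta.ψ (zeroMF k r).theta.φ 0)ᵀ * B =
      δ • (B * fromBlocks 0 (zeroMF k r).theta.ψ (zeroMF k r).theta.φ 0)) :
    ∃ F : Hom (zeroMF k r).theta (zeroMF k r).theta, F.IsIso ∧
      (fromBlocks F.σ 0 0 F.τ)ᵀ * b.B * fromBlocks F.σ 0 0 F.τ = B := by
  -- Over a field 𝔪 = 0, and the doubled filtration becomes the filtration by order in x and y. A
  -- form with the right constant term agrees with the model to step 1, the operator is already K,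
  -- and the P and Q obtained have entries in 𝔪, hence vanish.
  have h𝔪 : IsLocalRing.maximalIdeal k = ⊥ := IsLocalRing.maximalIdeal_eq_bot
  have : IsAdicComplete (IsLocalRing.maximalIdeal k) k := by rw [h𝔪]; infer_instance
  obtain ⟨d, hd, hP, hQ, h, hdB, -⟩ := exists_isometric_gauge (w := .double) b
    (by rw [fromBlocks_theta_zeroMF, sub_self]; exact zero_mem _)
    (zeroMF k r).theta.fromBlocks_mul_fromBlocks_self hB hB'
    (fun i j => mem_level_double_one (by
      have := congrFun (congrFun hBb i) j
      rw [matCoeff_apply, matCoeff_apply] at this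
      rw [Matrix.sub_apply, map_sub, this, sub_self]
      exact zero_mem _)) hDB
  obtain ⟨hσ, hτ⟩ := Gauge.isUnit hd
  obtain ⟨N, hNφ, hNψ, F, hF, hF'⟩ := exists_hom_theta hσ hτ h
  have hN : N = zeroMF k r := by
    have e₁ : N.φ = 0 := by
      ext i j
      rw [hNφ]
      have := Ideal.pow_le_self one_ne_zero (hP i j)
      rwa [h𝔪] at this
    have e₂ : N.ψ = 0 := by
      ext i j
      rw [hNψ]
      have := Ideal.pow_le_self one_ne_zero (hQ i j)
      rwa [h𝔪] at this
    cases N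
    subst e₁ e₂
    rfl
  subst hN
  refine ⟨F, ⟨hF ▸ hσ.isInvertible, hF' ▸ hτ.isInvertible⟩, ?_⟩
  rw [hF, hF']
  exact hdB

/-- Every form on `M̄_r` is isometric to one induced by a twisted form on `(0, 0)`. -/
theorem exists_preservesBilin_theta {r : ℕ} {ε : ℤˣ} (b : BilinForm (Mbar k r) ε) :
    ∃ (q : TwistedForm (zeroMF k r) ε) (F : Hom (Mbar k r) (zeroMF k r).theta),
      F.IsIso ∧ F.PreservesBilin b q.theta := by
  obtain ⟨b', hb'⟩ := b.exists_transport (MbarIso_isIso k r)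
  obtain ⟨q, hq⟩ := b'.exists_const
  obtain ⟨c, hc, X, Y, hc'⟩ := q.exists_constForm
  obtain ⟨F, hF, hFB⟩ := exists_isometry_theta_zeroMF c b'.full_transpose
    ⟨X * b'.b₀, Y * b'.b₁, by rw [hc', BilinForm.full, fromBlocks_multiply]; simp⟩
    (by rw [hc, hq]) (b'.full_comm.trans (neg_one_smul _ _).symm)
  exact ⟨q, _, (MbarIso_isIso k r).comp hF, hb'.comp (Hom.preservesBilin_iff.2 (hc ▸ hFB))⟩

/-- Every twisted form on `M̄_r` is isometric to one induced by a form on `(0, 0)`. -/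
theorem exists_preservesTwisted_theta {r : ℕ} {ε : ℤˣ} (q : TwistedForm (Mbar k r) (-ε)) :
    ∃ (b : BilinForm (zeroMF k r) ε) (F : Hom (Mbar k r) (zeroMF k r).theta),
      F.IsIso ∧ F.PreservesTwisted q b.theta := by
  obtain ⟨q', hq'⟩ := q.exists_transport (MbarIso_isIso k r)
  obtain ⟨b, hb⟩ := q'.exists_const
  obtain ⟨c, hc, X, Y, hc'⟩ := b.exists_constForm
  obtain ⟨F, hF, hFB⟩ := exists_isometry_theta_zeroMF c q'.full_transpose
    ⟨X * q'.q₀, Y * q'.q₁, by rw [hc', TwistedForm.full, fromBlocks_multiply]; simp⟩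
    (by rw [hc, hb]) (q'.full_comm.trans (one_smul _ _).symm)
  exact ⟨b, _, (MbarIso_isIso k r).comp hF, hq'.comp (Hom.preservesTwisted_iff.2 (hc ▸ hFB))⟩

end MatFac

/-! ### The main theorem -/

theorem mainTheorem1 {k : Type*} [Field k] [IsAlgClosed k] [CharZero k]
    {A : Type*} [CommRing A] [IsLocalRing A] [IsNoetherianRing A]
    [IsAdicComplete (IsLocalRing.maximalIdeal A) A] [Algebra k A]
    (hk : Function.Bijective (algebraMap k (IsLocalRing.ResidueField A))) :
    -- (i), deformations without additional structure
    (∀ (r : ℕ) (ω : PS₂ A) (M : MatFac (PS₂ A) (Fin r ⊕ Fin r) (Fin r ⊕ Fin r) ω),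
      MatFac.IsDeformation hk (MatFac.Mbar k r) M →
      ∃ (π : A) (N : MatFac A (Fin r) (Fin r) π) (g : PS₂ A ≃ₐ[A] PS₂ A)
        (F : MatFac.Hom (M.map (g : PS₂ A →+* PS₂ A)) N.theta),
        π ∈ IsLocalRing.maximalIdeal A ∧ N.IsReduced ∧
        MatFac.IsInfinitesimal hk g ∧ g ω = PS₂.xy A - MvPowerSeries.C π ∧
        F.IsIso ∧ F.ReducesTo hk (MatFac.MbarIso k r)) ∧
    -- (i), deformations with a quadratic or symplectic form
    (∀ (r : ℕ) (ε : ℤˣ) (b₀ : MatFac.BilinForm (MatFac.Mbar k r) ε),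
      (∃ (q₀ : MatFac.TwistedForm (MatFac.zeroMF k r) ε)
        (F₀ : MatFac.Hom (MatFac.Mbar k r) (MatFac.zeroMF k r).theta),
        F₀.IsIso ∧ F₀.PreservesBilin b₀ q₀.theta) ∧
      ∀ (q₀ : MatFac.TwistedForm (MatFac.zeroMF k r) ε)
        (F₀ : MatFac.Hom (MatFac.Mbar k r) (MatFac.zeroMF k r).theta),
        F₀.IsIso → F₀.PreservesBilin b₀ q₀.theta →
        ∀ (ω : PS₂ A) (M : MatFac (PS₂ A) (Fin r ⊕ Fin r) (Fin r ⊕ Fin r) ω)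
          (b : MatFac.BilinForm M ε),
          MatFac.IsDeformation hk (MatFac.Mbar k r) M → b.ReducesTo hk b₀ →
          ∃ (π : A) (N : MatFac A (Fin r) (Fin r) π) (q : MatFac.TwistedForm N ε)
            (g : PS₂ A ≃ₐ[A] PS₂ A) (F : MatFac.Hom (M.map (g : PS₂ A →+* PS₂ A)) N.theta),
            π ∈ IsLocalRing.maximalIdeal A ∧ N.IsReduced ∧ q.IsConst q₀ ∧
            MatFac.IsInfinitesimal hk g ∧ g ω = PS₂.xy A - MvPowerSeries.C π ∧
            F.IsIso ∧ F.ReducesTo hk F₀ ∧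
            F.PreservesBilin (b.map (g : PS₂ A →+* PS₂ A)) q.theta) ∧
    -- (i), deformations with a twisted symplectic or twisted quadratic form
    (∀ (r : ℕ) (ε : ℤˣ) (q₀ : MatFac.TwistedForm (MatFac.Mbar k r) (-ε)),
      (∃ (b₀ : MatFac.BilinForm (MatFac.zeroMF k r) ε)
        (F₀ : MatFac.Hom (MatFac.Mbar k r) (MatFac.zeroMF k r).theta),
        F₀.IsIso ∧ F₀.PreservesTwisted q₀ b₀.theta) ∧
      ∀ (b₀ : MatFac.BilinForm (MatFac.zeroMF k r) ε)
        (F₀ : MatFac.Hom (MatFac.Mbar k r) (MatFac.zeroMF k r).theta),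
        F₀.IsIso → F₀.PreservesTwisted q₀ b₀.theta →
        ∀ (ω : PS₂ A) (M : MatFac (PS₂ A) (Fin r ⊕ Fin r) (Fin r ⊕ Fin r) ω)
          (q : MatFac.TwistedForm M (-ε)),
          MatFac.IsDeformation hk (MatFac.Mbar k r) M → q.ReducesTo hk q₀ →
          ∃ (π : A) (N : MatFac A (Fin r) (Fin r) π) (b : MatFac.BilinForm N ε)
            (g : PS₂ A ≃ₐ[A] PS₂ A) (F : MatFac.Hom (M.map (g : PS₂ A →+* PS₂ A)) N.theta),
            π ∈ IsLocalRing.maximalIdeal A ∧ N.IsReduced ∧ b.IsConst b₀ ∧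
            MatFac.IsInfinitesimal hk g ∧ g ω = PS₂.xy A - MvPowerSeries.C π ∧
            F.IsIso ∧ F.ReducesTo hk F₀ ∧
            F.PreservesTwisted (q.map (g : PS₂ A →+* PS₂ A)) b.theta) ∧
    -- (ii)
    (∀ π : A, π ∈ IsLocalRing.maximalIdeal A → (thetaFunctor π).IsEquivalence) := by
  -- The k-algebra structure provides a section of the residue map, used to lift the Clifford bases.
  let s : IsLocalRing.ResidueField A →+* A :=
    (algebraMap k A).comp (RingEquiv.ofBijective _ hk).symm.toRingHom
  have hs (a : IsLocalRing.ResidueField A) : IsLocalRing.residue A (s a) = a :=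
    RingEquiv.apply_symm_apply (RingEquiv.ofBijective _ hk) a
  let _ : Invertible (2 : k) := invertibleOfNonzero two_ne_zero
  -- Invertibility of 2 is what the correction by half of the defect and the averaging over the
  -- involution require.
  let _ : Invertible (2 : A) :=
    (Invertible.map (algebraMap k A) (2 : k)).copy 2 (map_ofNat _ 2).symm
  exact ⟨fun r ω M hM => MatFac.exists_theta_of_isDeformation hk hM,
    fun r ε b₀ => ⟨MatFac.exists_preservesBilin_theta b₀, fun q₀ F₀ hF₀ h ω M b hM hb =>
      MatFac.exists_theta_of_bilinForm hk q₀ hF₀ h hM hb⟩,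
    fun r ε q₀ => ⟨MatFac.exists_preservesTwisted_theta q₀, fun b₀ F₀ hF₀ h ω M q hM hq =>
      MatFac.exists_theta_of_twistedForm hk b₀ hF₀ h hM hq⟩,
    fun π hπ => thetaFunctor_isEquivalence s hs hπ⟩
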